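/- \textbf{Theorem.} A \emph{trace} $\sigma$ is a finite sequence of events, each with a unique identifier, a thread, and an operation $r(x)$, $w(x)$ (read, write of a variable) or $\mathsf{acq}(\ell)$, $\mathsf{rel}(\ell)$ (acquire, release of a lock), such that for each lock the operations on it alternate between acquires and releases, starting with an acquire, and each release is performed by the thread of the acquire just before it (its \emph{match}). Write $\le_{tr}^\sigma$ for the order of appearance, and $\le_{TO}^\sigma$ for its restriction to pairs of events of the same thread. The \emph{writer} of a read of $x$ is the last write to $x$ before it, if there is one; $\mathrm{prev}_\sigma(e)$ is the last event $f\neq e$ with $f\le_{TO}^\sigma e$, if there is one. Two distinct events \emph{conflict} if they access the same variable and at least one is a write. A set of events of $\sigma$ is \emph{closed} if it is downward closed under $\le_{TO}^\sigma$ and contains the writer of each of its reads; $\mathrm{cl}(r)$ is the smallest closed set containing $r$. A trace $\rho$ whose events form a closed set of events of $\sigma$ is a \emph{correct reordering} of $\sigma$ if it preserves the thread order and the writers of $\sigma$ on its events; it is \emph{optimistic} if moreover conflicting events of $\rho$ are ordered in $\rho$ as in $\sigma$, and any two acquires of the same lock whose matching releases in $\sigma$ both belong to $\rho$ are ordered in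 $\rho$ as in $\sigma$. A set $S$ of events is \emph{optimistically lock-closed} with respect to $(e_1,e_2)$ if $S$ is closed, $e_1,e_2\notin S$, $\mathrm{prev}_\sigma(e_1),\mathrm{prev}_\sigma(e_2)\in S$ (where they exist), and for every acquire $a\in S$ with matching release $r$ in $\sigma$ such that $e_1,e_2\notin\mathrm{cl}(r)$ we have $r\in S$. A conflicting pair $(e_1,e_2)$ of events of $\sigma$ is an \emph{optimistic sync-reversal race} if some optimistic correct reordering $\rho$ of $\sigma$ has an event set that is optimistically lock-closed with respect to $(e_1,e_2)$, and both $e_1$ and $e_2$ are $\sigma$-enabled in $\rho$ (that is, $e_i$ is not in $\rho$, but all other events $f\le_{TO}^\sigma e_i$ are). There is an algorithm (a single program for a unit-cost word RAM with words of $O(\log \mathcal N)$ bits) which, given a trace $\sigma$, a read or write event $e$ of $\sigma$, and a thread $t$ occurring in $\sigma$, decides whether there is an event $e'$ of thread $t$ such that $(e,e')$ is an optimistic sync-reversal race of $\sigma$, in time $$O\big((\mathcal T^2+\mathcal L)\cdot\max(\mathcal L,1)\cdot\mathcal N\big),$$ where $\mathcal N$, $\mathcal T$, $\mathcal L$ are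 the numbers of events, threads and locks occurring in $\sigma$. Here $\sigma$ is given as the array of its events, with the threads, variables and locks that occur in it each numbered consecutively from $0$, together with the numbers of events, threads, variables and locks; $e$ is given by its position and $t$ by its number. -/

import Mathlib

namespace OSR

/-! ### Traces -/

/-- Operations: reads and writes of variables, acquires and releases of locks. -/
inductive Op (Var Lck : Type) where
  | read (x : Var)
  | write (x : Var)
  | acq (l : Lck)
  | rel (l : Lck)

/-- An event `⟨i, t, op⟩` with identifier `i`, performed by thread `t`. -/
structure Event (Thr Var Lck : Type) where
  id : ℕ
  thread : Thr
  op : Op Var Lck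

/-- A trace is a finite sequence of events (well-formedness is `WellFormed` below). -/
abbrev Trace (Thr Var Lck : Type) := List (Event Thr Var Lck)

section

variable {Thr Var Lck : Type}

/-- The set of events of a trace. -/
def events (σ : Trace Thr Var Lck) : Set (Event Thr Var Lck) := {e | e ∈ σ}

/-- The threads that appear in a trace. -/
def threads (σ : Trace Thr Var Lck) : Set Thr := {t | ∃ e ∈ σ, e.thread = t}

/-- The variables that appear in a trace. -/
def vars (σ : Trace Thr Var Lck) : Set Var :=
  {x | ∃ e ∈ σ, e.op = Op.read x ∨ e.op = Op.write x}

/-- The locks that appear in a trace. -/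
def locks (σ : Trace Thr Var Lck) : Set Lck :=
  {l | ∃ e ∈ σ, e.op = Op.acq l ∨ e.op = Op.rel l}

/-- The event appears in `σ` strictly before the other one. -/
def TraceLT (σ : Trace Thr Var Lck) (e₁ e₂ : Event Thr Var Lck) : Prop :=
  ∃ i j : ℕ, i < j ∧ σ[i]? = some e₁ ∧ σ[j]? = some e₂

/-- The trace order. -/
def TraceLE (σ : Trace Thr Var Lck) (e₁ e₂ : Event Thr Var Lck) : Prop :=
  ∃ i j : ℕ, i ≤ j ∧ σ[i]? = some e₁ ∧ σ[j]? = some e₂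

/-- The thread order. -/
def ThreadLE (σ : Trace Thr Var Lck) (e₁ e₂ : Event Thr Var Lck) : Prop :=
  e₁.thread = e₂.thread ∧ TraceLE σ e₁ e₂

/-- `e` acquires or releases the lock `l`. -/
def Event.OnLock (e : Event Thr Var Lck) (l : Lck) : Prop :=
  e.op = Op.acq l ∨ e.op = Op.rel l

/-- `r` is the release event matching the acquire event `a` in `σ`: same lock, same thread, and no
operation on this lock in between. If there is no such `r` (or `a`), the match is `⊥`. -/
def IsMatch (σ : Trace Thr Var Lck) (a r : Event Thr Var Lck) : Prop :=
  ∃ l : Lck, a.op = Op.acq l ∧ r.op = Op.rel l ∧ a.thread = r.thread ∧ TraceLT σ a r ∧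
    ¬ ∃ f : Event Thr Var Lck, f.OnLock l ∧ TraceLT σ a f ∧ TraceLT σ f r

/-- Well-formed traces: identifiers are unique and, for each lock, the operations on it alternate
between acquires and releases, each release being immediately preceded (among the operations on its
lock) by a matching acquire of the same thread. -/
structure WellFormed (σ : Trace Thr Var Lck) : Prop where
  nodup_ids : (σ.map Event.id).Nodup
  rel_matched : ∀ r ∈ σ, ∀ l : Lck, r.op = Op.rel l → ∃ a ∈ σ, IsMatch σ a r
  acq_exclusive : ∀ (a₁ a₂ : Event Thr Var Lck) (l : Lck), a₁.op = Op.acq l → a₂.op = Op.acq l →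
    TraceLT σ a₁ a₂ → ∃ r : Event Thr Var Lck, r.op = Op.rel l ∧ TraceLT σ a₁ r ∧ TraceLT σ r a₂

/-- `w` is the writer of the read event `r` in `σ`, i.e. the last write before `r` to the
variable read by `r`. -/
def IsLastWrite (σ : Trace Thr Var Lck) (w r : Event Thr Var Lck) : Prop :=
  ∃ x : Var, r.op = Op.read x ∧ w.op = Op.write x ∧ TraceLE σ w r ∧
    ¬ ∃ w' : Event Thr Var Lck, w' ≠ w ∧ w'.op = Op.write x ∧ TraceLE σ w w' ∧ TraceLE σ w' r

/-- `S ⊆ events σ` is closed under thread order and reads-from. -/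
structure TLClosed (σ : Trace Thr Var Lck) (S : Set (Event Thr Var Lck)) : Prop where
  subset : S ⊆ events σ
  thread : ∀ e₁ e₂ : Event Thr Var Lck, ThreadLE σ e₁ e₂ → e₂ ∈ S → e₁ ∈ S
  lastWrite : ∀ e₁ e₂ : Event Thr Var Lck, IsLastWrite σ e₁ e₂ → e₂ ∈ S → e₁ ∈ S

/-- The smallest set containing `S ⊆ events σ` that is closed under thread order and
reads-from. -/
def TLClosure (σ : Trace Thr Var Lck) (S : Set (Event Thr Var Lck)) :
    Set (Event Thr Var Lck) :=
  ⋂₀ {S' | S ⊆ S' ∧ TLClosed σ S'}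

/-- `ρ` is a correct reordering of `σ`. -/
structure CorrectReordering (σ ρ : Trace Thr Var Lck) : Prop where
  wellFormed : WellFormed ρ
  closed : TLClosed σ (events ρ)
  thread : ∀ e₁ ∈ events ρ, ∀ e₂ ∈ events ρ, ThreadLE σ e₁ e₂ → ThreadLE ρ e₁ e₂
  lastWrite : ∀ e₁ ∈ events ρ, ∀ e₂ ∈ events ρ, IsLastWrite σ e₁ e₂ → IsLastWrite ρ e₁ e₂

/-- A conflicting pair: two different accesses to the same variable, at least one a write. -/
def Conflicting (e₁ e₂ : Event Thr Var Lck) : Prop :=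
  e₁ ≠ e₂ ∧ ∃ x : Var,
    (e₁.op = Op.write x ∧ e₂.op = Op.write x) ∨
    (e₁.op = Op.write x ∧ e₂.op = Op.read x) ∨
    (e₁.op = Op.read x ∧ e₂.op = Op.write x)

/-- `e` is `σ`-enabled in `π`: it is not in `π` but all its proper thread-predecessors are. -/
def Enabled (σ π : Trace Thr Var Lck) (e : Event Thr Var Lck) : Prop :=
  e ∉ events π ∧ ∀ e' ∈ events σ, e' ≠ e → ThreadLE σ e' e → e' ∈ events π

/-- `f` is the thread-predecessor of `e`: the last event `f ≠ e` below `e` in thread order. If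
there is none, the predecessor is `⊥`. -/
def IsPrev (σ : Trace Thr Var Lck) (f e : Event Thr Var Lck) : Prop :=
  f ≠ e ∧ ThreadLE σ f e ∧
    ∀ g : Event Thr Var Lck, g ≠ e → ThreadLE σ g e → ThreadLE σ g f

/-- `S` is optimistically lock-closed with respect to `(e₁, e₂)`. -/
structure OptLockClosed (σ : Trace Thr Var Lck) (e₁ e₂ : Event Thr Var Lck)
    (S : Set (Event Thr Var Lck)) : Prop where
  not_mem_left : e₁ ∉ S
  not_mem_right : e₂ ∉ S
  prev_left : ∀ f : Event Thr Var Lck, IsPrev σ f e₁ → f ∈ S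
  prev_right : ∀ f : Event Thr Var Lck, IsPrev σ f e₂ → f ∈ S
  closed : TLClosed σ S
  lock : ∀ a r : Event Thr Var Lck, a ∈ S → IsMatch σ a r →
    e₁ ∉ TLClosure σ {r} → e₂ ∉ TLClosure σ {r} → r ∈ S

/-- `ρ` is an optimistic correct reordering of `σ`: conflicting accesses, and critical sections on
a common lock that are completed in `ρ`, are ordered as in `σ`. -/
structure OptReordering (σ ρ : Trace Thr Var Lck) : Prop where
  correct : CorrectReordering σ ρ
  conflict : ∀ e₁ ∈ events ρ, ∀ e₂ ∈ events ρ, Conflicting e₁ e₂ →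
    (TraceLE ρ e₁ e₂ ↔ TraceLE σ e₁ e₂)
  lock : ∀ (l : Lck) (a₁ a₂ r₁ r₂ : Event Thr Var Lck), a₁ ≠ a₂ →
    a₁.op = Op.acq l → a₂.op = Op.acq l → IsMatch σ a₁ r₁ → IsMatch σ a₂ r₂ →
    r₁ ∈ events ρ → r₂ ∈ events ρ → (TraceLE ρ a₁ a₂ ↔ TraceLE σ a₁ a₂)

/-- `(e₁, e₂)` is an optimistic sync-reversal race of `σ`. -/
def IsOSRRace (σ : Trace Thr Var Lck) (e₁ e₂ : Event Thr Var Lck) : Prop :=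
  e₁ ∈ events σ ∧ e₂ ∈ events σ ∧ Conflicting e₁ e₂ ∧
    ∃ ρ : Trace Thr Var Lck, OptReordering σ ρ ∧ OptLockClosed σ e₁ e₂ (events ρ) ∧
      Enabled σ ρ e₁ ∧ Enabled σ ρ e₂

end

/-! ### A word RAM

A machine has registers and arrays, all holding natural numbers below a bound `W` (a machine word
then has `log₂ W` bits). Programs are structured; a fixed program names finitely many registers
and arrays. Time is the number of elementary steps: every arithmetic operation, memory
access, assignment and test costs one. -/

/-- Machine states. -/
structure State where
  reg : ℕ → ℕ
  arr : ℕ → ℕ → ℕ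

/-- The arithmetic instructions (subtraction is truncated at zero). -/
inductive BinOp where
  | add
  | sub
  | mul
  | div

def BinOp.eval : BinOp → ℕ → ℕ → ℕ
  | add, m, n => m + n
  | sub, m, n => m - n
  | mul, m, n => m * n
  | div, m, n => m / n

/-- Expressions: literals, registers, array reads and arithmetic. -/
inductive Expr where
  | lit (n : ℕ)
  | reg (i : ℕ)
  | get (a : ℕ) (ix : Expr)
  | bin (o : BinOp) (x y : Expr)

def Expr.eval (s : State) : Expr → ℕ
  | lit n => n
  | reg i => s.reg i
  | get a ix => s.arr a (ix.eval s)
  | bin o x y => o.eval (x.eval s) (y.eval s)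

/-- The number of elementary steps of an evaluation. -/
def Expr.cost : Expr → ℕ
  | lit _ => 1
  | reg _ => 1
  | get _ ix => ix.cost + 1
  | bin _ x y => x.cost + y.cost + 1

/-- All intermediate values of the evaluation are machine words, i.e. are below `W`. -/
def Expr.Fits (W : ℕ) (s : State) : Expr → Prop
  | lit n => n < W
  | reg i => s.reg i < W
  | get a ix => ix.Fits W s ∧ s.arr a (ix.eval s) < W
  | bin o x y => x.Fits W s ∧ y.Fits W s ∧ o.eval (x.eval s) (y.eval s) < W

/-- Programs: `ite x p q` runs `p` if `x` is non-zero and `q` otherwise; `loop x p` repeats `p`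
while `x` is non-zero. -/
inductive Prog where
  | skip
  | set (i : ℕ) (x : Expr)
  | put (a : ℕ) (ix x : Expr)
  | seq (p q : Prog)
  | ite (x : Expr) (p q : Prog)
  | loop (x : Expr) (p : Prog)

/-- Store a value in a register. -/
def State.setReg (s : State) (i v : ℕ) : State :=
  { s with reg := Function.update s.reg i v }

/-- Store a value in an array. -/
def State.setArr (s : State) (a i v : ℕ) : State :=
  { s with arr := Function.update s.arr a (Function.update (s.arr a) i v) }

/-- `Exec W p s s' c`: on a machine whose words are the numbers below `W`, the program `p` started
in state `s` halts in state `s'` after `c` elementary steps. A computation that produces a number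
that is not a machine word is stuck. -/
inductive Exec (W : ℕ) : Prog → State → State → ℕ → Prop where
  | skip (s : State) : Exec W Prog.skip s s 1
  | set (s : State) (i : ℕ) (x : Expr) (hx : x.Fits W s) :
      Exec W (Prog.set i x) s (s.setReg i (x.eval s)) (x.cost + 1)
  | put (s : State) (a : ℕ) (ix x : Expr) (hi : ix.Fits W s) (hx : x.Fits W s) :
      Exec W (Prog.put a ix x) s (s.setArr a (ix.eval s) (x.eval s)) (ix.cost + x.cost + 1)
  | seq (s s' s'' : State) (p q : Prog) (c d : ℕ) (hp : Exec W p s s' c) (hq : Exec W q s' s'' d) :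
      Exec W (Prog.seq p q) s s'' (c + d)
  | ite_true (s s' : State) (x : Expr) (p q : Prog) (c : ℕ) (hx : x.Fits W s)
      (h : x.eval s ≠ 0) (hp : Exec W p s s' c) :
      Exec W (Prog.ite x p q) s s' (x.cost + 1 + c)
  | ite_false (s s' : State) (x : Expr) (p q : Prog) (c : ℕ) (hx : x.Fits W s)
      (h : x.eval s = 0) (hq : Exec W q s s' c) :
      Exec W (Prog.ite x p q) s s' (x.cost + 1 + c)
  | loop_true (s s' s'' : State) (x : Expr) (p : Prog) (c d : ℕ) (hx : x.Fits W s)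
      (h : x.eval s ≠ 0) (hp : Exec W p s s' c) (hl : Exec W (Prog.loop x p) s' s'' d) :
      Exec W (Prog.loop x p) s s'' (x.cost + 1 + c + d)
  | loop_false (s : State) (x : Expr) (p : Prog) (hx : x.Fits W s) (h : x.eval s = 0) :
      Exec W (Prog.loop x p) s s (x.cost + 1)

/-! ### Presenting a trace to the machine -/

/-- `f` numbers the elements of the finite set `s` by `0, 1, …, |s| - 1`. -/
def IsNumbering {α : Type} (s : Set α) (f : α → ℕ) : Prop :=
  Set.BijOn f s (Set.Iio s.ncard)

section

variable {Thr Var Lck : Type}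

/-- The code of the kind of an operation. -/
def Op.kind : Op Var Lck → ℕ
  | read _ => 0
  | write _ => 1
  | acq _ => 2
  | rel _ => 3

/-- The number of the variable or lock of an operation. -/
def Op.target (nv : Var → ℕ) (nl : Lck → ℕ) : Op Var Lck → ℕ
  | read x => nv x
  | write x => nv x
  | acq l => nl l
  | rel l => nl l

/-- The initial state. Arrays `0`, `1`, `2` hold, at index `k`, the thread, the kind of operation
and the variable or lock of the `k`-th event (counted from zero); registers `0` to `5` hold the
numbers of events, threads, variables and locks, the position `i` of the given event and the number
of the given thread. Everything else is zero. -/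
noncomputable def inputState (nt : Thr → ℕ) (nv : Var → ℕ) (nl : Lck → ℕ) (σ : Trace Thr Var Lck) (i : ℕ)
    (t : Thr) : State where
  reg
    | 0 => σ.length
    | 1 => (threads σ).ncard
    | 2 => (vars σ).ncard
    | 3 => (locks σ).ncard
    | 4 => i
    | 5 => nt t
    | _ => 0
  arr
    | 0 => fun k => (σ.map fun e => nt e.thread).getD k 0
    | 1 => fun k => (σ.map fun e => e.op.kind).getD k 0
    | 2 => fun k => (σ.map fun e => e.op.target nv nl).getD k 0
    | _ => fun _ => 0

/-- `e` is a read or a write event. -/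
def Event.IsAccess (e : Event Thr Var Lck) : Prop :=
  ∃ x : Var, e.op = Op.read x ∨ e.op = Op.write x

end

end OSR

namespace OSR

/-! ### A language of bounded loops -/

instance : Add Expr := ⟨Expr.bin BinOp.add⟩
instance : Sub Expr := ⟨Expr.bin BinOp.sub⟩
instance : Mul Expr := ⟨Expr.bin BinOp.mul⟩
instance : Div Expr := ⟨Expr.bin BinOp.div⟩

/-- `lt x y` is non-zero iff `x < y`. -/
def Expr.lt (x y : Expr) : Expr := y - x

/-- `eq x y` is non-zero iff `x = y`. -/
def Expr.eq (x y : Expr) : Expr := Expr.lit 1 - ((x - y) + (y - x))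

section ExprEval

variable (s : State) (x y : Expr)

@[simp] theorem Expr.eval_lit (n : ℕ) : (Expr.lit n).eval s = n := rfl
@[simp] theorem Expr.eval_reg (i : ℕ) : (Expr.reg i).eval s = s.reg i := rfl
@[simp] theorem Expr.eval_get (a : ℕ) : (Expr.get a x).eval s = s.arr a (x.eval s) := rfl
@[simp] theorem Expr.eval_add : (x + y).eval s = x.eval s + y.eval s := rfl
@[simp] theorem Expr.eval_sub : (x - y).eval s = x.eval s - y.eval s := rfl
@[simp] theorem Expr.eval_mul : (x * y).eval s = x.eval s * y.eval s := rfl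
@[simp] theorem Expr.eval_div : (x / y).eval s = x.eval s / y.eval s := rfl

@[simp] theorem Expr.eval_lt : (Expr.lt x y).eval s = 0 ↔ ¬ x.eval s < y.eval s := by
  simp only [Expr.lt, Expr.eval_sub]; omega

@[simp] theorem Expr.eval_eq : (Expr.eq x y).eval s = 0 ↔ ¬ x.eval s = y.eval s := by
  simp only [Expr.eq, Expr.eval_sub, Expr.eval_add, Expr.eval_lit]; omega

end ExprEval

/-- The number of leaves of an expression. -/
def Expr.leaves : Expr → ℕ
  | lit _ => 1
  | reg _ => 1
  | get _ ix => ix.leaves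
  | bin _ x y => x.leaves + y.leaves

/-- All literals are at most eight. -/
def Expr.litsOk : Expr → Bool
  | lit n => n ≤ 8
  | reg _ => true
  | get _ ix => ix.litsOk
  | bin _ x y => x.litsOk && y.litsOk

/-- The value never exceeds a bound on the memory contents. -/
def Expr.small : Expr → Bool
  | lit _ => true
  | reg _ => true
  | get _ _ => true
  | bin BinOp.sub x _ => x.small
  | bin BinOp.div x _ => x.small
  | bin BinOp.add _ _ => false
  | bin BinOp.mul _ _ => false

/-- The value to be stored, truncated at `K` unless it cannot be larger. -/
def Expr.stored (K : ℕ) (x : Expr) (s : State) : ℕ :=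
  bif x.small then x.eval s else min (x.eval s) K

/-- The expression computing `Expr.stored`, when register `6` holds `K`. -/
def Expr.clamp (x : Expr) : Expr :=
  bif x.small then x else x - (x - Expr.reg 6)

/-- All memory contents are at most `K`. -/
structure State.Bdd (K : ℕ) (s : State) : Prop where
  reg : ∀ i, s.reg i ≤ K
  arr : ∀ a i, s.arr a i ≤ K

theorem Expr.one_le_leaves (x : Expr) : 1 ≤ x.leaves := by
  induction x with
  | lit n => simp [leaves]
  | reg i => simp [leaves]
  | get a ix ih => simpa [leaves] using ih
  | bin o x y hx hy => simp only [leaves]; omega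

theorem Expr.eval_le {K : ℕ} {s : State} (hK : 8 ≤ K) (hs : s.Bdd K) (x : Expr)
    (hx : x.litsOk = true) : x.eval s ≤ K ^ x.leaves := by
  induction x with
  | lit n => simp only [litsOk, decide_eq_true_eq] at hx; simp [leaves]; omega
  | reg i => simpa [leaves] using hs.reg i
  | get a ix ih =>
    calc s.arr a (ix.eval s) ≤ K := hs.arr _ _
      _ = K ^ 1 := (pow_one K).symm
      _ ≤ K ^ ix.leaves := Nat.pow_le_pow_right (by omega) ix.one_le_leaves
  | bin o x y ihx ihy =>
    simp only [litsOk, Bool.and_eq_true] at hx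
    have h1 := ihx hx.1
    have h2 := ihy hx.2
    have p1 : 2 ≤ K ^ x.leaves := by
      calc 2 ≤ K ^ 1 := by rw [pow_one]; omega
        _ ≤ _ := Nat.pow_le_pow_right (by omega) x.one_le_leaves
    have p2 : 2 ≤ K ^ y.leaves := by
      calc 2 ≤ K ^ 1 := by rw [pow_one]; omega
        _ ≤ _ := Nat.pow_le_pow_right (by omega) y.one_le_leaves
    have p3 : K ^ x.leaves ≤ K ^ (x.leaves + y.leaves) := Nat.pow_le_pow_right (by omega) (by omega)
    simp only [leaves, eval]
    cases o with
    | add => rw [pow_add]; simp only [BinOp.eval]; nlinarith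
    | sub => simp only [BinOp.eval]; omega
    | mul => rw [pow_add]; exact Nat.mul_le_mul h1 h2
    | div => exact (Nat.div_le_self _ _).trans (h1.trans p3)

theorem Expr.fits_of_leaves {K W m : ℕ} {s : State} (hK : 8 ≤ K) (hs : s.Bdd K) (hW : K ^ m < W)
    (x : Expr) (hx : x.litsOk = true) (hm : x.leaves ≤ m) : x.Fits W s := by
  have key : ∀ z : Expr, z.litsOk = true → z.leaves ≤ m → z.eval s < W := fun z hz hzm =>
    ((z.eval_le hK hs hz).trans (Nat.pow_le_pow_right (by omega) hzm)).trans_lt hW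
  induction x with
  | lit n => exact key _ hx hm
  | reg i => exact key _ hx hm
  | get a ix ih => exact ⟨ih hx hm, key _ hx hm⟩
  | bin o x y ihx ihy =>
    have h := key _ hx hm
    simp only [litsOk, Bool.and_eq_true] at hx
    simp only [leaves] at hm
    exact ⟨ihx hx.1 (by omega), ihy hx.2 (by omega), h⟩

theorem Expr.eval_le_of_small {K : ℕ} {s : State} (hK : 8 ≤ K) (hs : s.Bdd K) (x : Expr)
    (hx : x.litsOk = true) (h : x.small = true) : x.eval s ≤ K := by
  induction x with
  | lit n => simp only [litsOk, decide_eq_true_eq] at hx; simp; omega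
  | reg i => exact hs.reg i
  | get a ix ih => exact hs.arr _ _
  | bin o x y ihx ihy =>
    simp only [litsOk, Bool.and_eq_true] at hx
    cases o with
    | add => simp [small] at h
    | mul => simp [small] at h
    | sub => exact (Nat.sub_le _ _).trans (ihx hx.1 h)
    | div => exact (Nat.div_le_self _ _).trans (ihx hx.1 h)

theorem Expr.stored_le {K : ℕ} {s : State} (hK : 8 ≤ K) (hs : s.Bdd K) (x : Expr)
    (hx : x.litsOk = true) : x.stored K s ≤ K := by
  unfold stored
  cases h : x.small with
  | true => exact x.eval_le_of_small hK hs hx h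
  | false => exact min_le_right _ _

theorem Expr.eval_clamp {K : ℕ} {s : State} (hs : s.reg 6 = K) (x : Expr) :
    x.clamp.eval s = x.stored K s := by
  unfold stored clamp
  cases x.small with
  | true => rfl
  | false => simp only [cond_false, Expr.eval_sub, Expr.eval_reg, hs]; omega

/-- Programs with bounded loops only: `loop i n p` repeats `p` for the values `0, 1, …` below the
content of register `n` in register `i`. -/
inductive Cmd where
  | skip
  | set (i : ℕ) (x : Expr)
  | put (a : ℕ) (ix x : Expr)
  | seq (p q : Cmd)
  | ite (x : Expr) (p q : Cmd)
  | loop (i n : ℕ) (p : Cmd)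

namespace Cmd

instance : Append Cmd := ⟨Cmd.seq⟩

/-- The effect of a program. -/
def run (K : ℕ) : Cmd → State → State
  | skip, s => s
  | set i x, s => s.setReg i (x.stored K s)
  | put a ix x, s => s.setArr a (ix.eval s) (x.stored K s)
  | seq p q, s => q.run K (p.run K s)
  | ite x p q, s => if x.eval s = 0 then q.run K s else p.run K s
  | loop i n p, s =>
    Nat.rec (s.setReg i 0) (fun j st => (p.run K st).setReg i (j + 1)) (s.reg n)

/-- The registers that a program changes. -/
def regs : Cmd → List ℕ
  | skip => []
  | set i _ => [i]
  | put _ _ _ => []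
  | seq p q => p.regs ++ q.regs
  | ite _ p q => p.regs ++ q.regs
  | loop i _ p => i :: p.regs

/-- The arrays that a program changes. -/
def arrs : Cmd → List ℕ
  | skip => []
  | set _ _ => []
  | put a _ _ => [a]
  | seq p q => p.arrs ++ q.arrs
  | ite _ p q => p.arrs ++ q.arrs
  | loop _ _ p => p.arrs

/-- Syntactic conditions: small expressions, constant loop bounds, untouched loop counters. -/
def wf : Cmd → Bool
  | skip => true
  | set i x => (7 ≤ i) && x.litsOk && (x.leaves ≤ 12)
  | put _ ix x => ix.litsOk && (ix.leaves ≤ 12) && x.litsOk && (x.leaves ≤ 12)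
  | seq p q => p.wf && q.wf
  | ite x p q => x.litsOk && (x.leaves ≤ 12) && p.wf && q.wf
  | loop i n p => (7 ≤ i) && (n < 7) && p.wf && (!p.regs.contains i)

/-- The program for the machine. -/
def compile : Cmd → Prog
  | skip => Prog.skip
  | set i x => Prog.set i x.clamp
  | put a ix x => Prog.put a ix x.clamp
  | seq p q => Prog.seq p.compile q.compile
  | ite x p q => Prog.ite x p.compile q.compile
  | loop i n p => Prog.seq (Prog.set i (Expr.lit 0))
      (Prog.loop (Expr.reg n - Expr.reg i)
        (Prog.seq p.compile (Prog.set i (Expr.reg i + Expr.lit 1))))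

/-- A bound for the running time, in terms of the initial contents of the registers. -/
def time (f : ℕ → ℕ) : Cmd → ℕ
  | skip => 1
  | set _ x => x.clamp.cost + 1
  | put _ ix x => ix.cost + x.clamp.cost + 1
  | seq p q => p.time f + q.time f
  | ite x p q => x.cost + 1 + p.time f + q.time f
  | loop _ n p => f n * (p.time f + 8) + 6

end Cmd

section StateLemmas

variable (s : State) (i j v a b : ℕ)

@[simp] theorem State.reg_setReg : (s.setReg i v).reg j = if j = i then v else s.reg j := by
  simp [State.setReg, Function.update_apply]
@[simp] theorem State.arr_setReg : (s.setReg i v).arr = s.arr := rfl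
@[simp] theorem State.reg_setArr : (s.setArr a i v).reg = s.reg := rfl
@[simp] theorem State.arr_setArr : (s.setArr a i v).arr b =
    if b = a then Function.update (s.arr a) i v else s.arr b := by
  unfold State.setArr
  by_cases h : b = a
  · subst h; simp
  · simp [h]

theorem State.Bdd.setReg {K : ℕ} {s : State} (hs : s.Bdd K) {v : ℕ} (i : ℕ) (hv : v ≤ K) :
    (s.setReg i v).Bdd K := by
  refine ⟨fun j => ?_, hs.arr⟩
  rw [State.reg_setReg]
  split_ifs
  exacts [hv, hs.reg j]

theorem State.Bdd.setArr {K : ℕ} {s : State} (hs : s.Bdd K) {v : ℕ} (a i : ℕ) (hv : v ≤ K) :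
    (s.setArr a i v).Bdd K := by
  refine ⟨hs.reg, fun b j => ?_⟩
  rw [State.arr_setArr]
  split_ifs with h
  · rw [Function.update_apply]; split_ifs
    exacts [hv, hs.arr _ _]
  · exact hs.arr _ _

end StateLemmas

namespace Cmd

variable {K : ℕ}

theorem run_reg (p : Cmd) : ∀ (s : State) (r : ℕ), r ∉ p.regs → (p.run K s).reg r = s.reg r := by
  induction p with
  | skip => intro s r _; rfl
  | set i x => intro s r h; simp [regs] at h; simp [run, h]
  | put a ix x => intro s r h; simp [run]
  | seq p q hp hq =>
    intro s r h; simp [regs] at h; simp only [run]; rw [hq _ _ h.2, hp _ _ h.1]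
  | ite x p q hp hq =>
    intro s r h; simp [regs] at h; simp only [run]; split_ifs
    exacts [hq _ _ h.2, hp _ _ h.1]
  | loop i n p hp =>
    intro s r h; simp [regs] at h; simp only [run]
    induction s.reg n with
    | zero => simp [h.1]
    | succ m ih => simp only [State.reg_setReg, if_neg h.1]; rw [hp _ _ h.2, ih]

theorem run_arr (p : Cmd) : ∀ (s : State) (a : ℕ), a ∉ p.arrs → (p.run K s).arr a = s.arr a := by
  induction p with
  | skip => intro s r _; rfl
  | set i x => intro s r h; simp [run]
  | put a ix x => intro s r h; simp [arrs] at h; simp [run, h]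
  | seq p q hp hq =>
    intro s r h; simp [arrs] at h; simp only [run]; rw [hq _ _ h.2, hp _ _ h.1]
  | ite x p q hp hq =>
    intro s r h; simp [arrs] at h; simp only [run]; split_ifs
    exacts [hq _ _ h.2, hp _ _ h.1]
  | loop i n p hp =>
    intro s r h; simp only [run]
    induction s.reg n with
    | zero => simp
    | succ m ih => rw [State.arr_setReg, hp _ _ h, ih]

theorem run_bdd (hK : 8 ≤ K) (p : Cmd) : ∀ (s : State), p.wf = true → s.Bdd K → s.reg 6 = K →
    (p.run K s).Bdd K ∧ (∀ r < 7, (p.run K s).reg r = s.reg r) := by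
  induction p with
  | skip => intro s _ hs _; exact ⟨hs, fun _ _ => rfl⟩
  | set i x =>
    intro s h hs h6; simp [wf] at h
    exact ⟨hs.setReg _ (x.stored_le hK hs h.1.2), fun r hr => by simp [run]; omega⟩
  | put a ix x =>
    intro s h hs h6; simp [wf] at h
    exact ⟨hs.setArr _ _ (x.stored_le hK hs h.1.2), fun r hr => by simp [run]⟩
  | seq p q hp hq =>
    intro s h hs h6; simp [wf] at h
    obtain ⟨h1, h2⟩ := hp s h.1 hs h6
    obtain ⟨h3, h4⟩ := hq (p.run K s) h.2 h1 ((h2 6 (by omega)).trans h6)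
    exact ⟨h3, fun r hr => (h4 r hr).trans (h2 r hr)⟩
  | ite x p q hp hq =>
    intro s h hs h6; simp [wf] at h
    simp only [run]; split_ifs
    exacts [hq s h.2 hs h6, hp s h.1.2 hs h6]
  | loop i n p hp =>
    intro s h hs h6; simp [wf] at h
    obtain ⟨⟨⟨h1, h2⟩, h3⟩, h4⟩ := h
    have key : ∀ m ≤ K,
        (Nat.rec (s.setReg i 0) (fun j st => (p.run K st).setReg i (j + 1)) m : State).Bdd K ∧
        (∀ r < 7, (Nat.rec (s.setReg i 0) (fun j st => (p.run K st).setReg i (j + 1)) m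
          : State).reg r = s.reg r) := by
      intro m
      induction m with
      | zero => intro _; exact ⟨hs.setReg _ (by omega), fun r hr => by simp; omega⟩
      | succ m ih =>
        intro hm
        obtain ⟨a1, a2⟩ := ih (by omega)
        obtain ⟨b1, b2⟩ := hp _ h3 a1 ((a2 6 (by omega)).trans h6)
        refine ⟨b1.setReg _ hm, fun r hr => ?_⟩
        simp only [State.reg_setReg]
        rw [if_neg (by omega), b2 r hr, a2 r hr]
    exact key _ (hs.reg n)

/-- The compiled program runs on the machine as described by `run`, in time `time`. -/
theorem exec {W : ℕ} (hK : 8 ≤ K) (hW : K ^ 32 < W) (p : Cmd) : ∀ (s : State), p.wf = true →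
    s.Bdd K → s.reg 6 = K → ∀ f : ℕ → ℕ, (∀ r < 7, f r = s.reg r) →
    ∃ c, Exec W p.compile s (p.run K s) c ∧ c ≤ p.time f := by
  have fits : ∀ (s : State), s.Bdd K → ∀ x : Expr, x.litsOk = true → x.leaves ≤ 32 → x.Fits W s :=
    fun s hs x hx hl => x.fits_of_leaves hK hs hW hx hl
  have cfits : ∀ (s : State), s.Bdd K → ∀ x : Expr, x.litsOk = true → x.leaves ≤ 12 →
      x.clamp.Fits W s := by
    intro s hs x hx hl
    apply fits s hs
    · unfold Expr.clamp
      cases x.small with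
      | true => exact hx
      | false => change (x.litsOk && (x.litsOk && true)) = true; simp [hx]
    · unfold Expr.clamp
      cases x.small with
      | true => simp only [cond_true]; omega
      | false => change x.leaves + (x.leaves + 1) ≤ 32; omega
  induction p with
  | skip => intro s _ hs _ f hf; exact ⟨1, Exec.skip s, le_rfl⟩
  | set i x =>
    intro s h hs h6 f hf; simp [wf] at h
    refine ⟨_, ?_, le_rfl⟩
    have := Exec.set (W := W) s i x.clamp (cfits s hs x h.1.2 h.2)
    rwa [x.eval_clamp h6] at this
  | put a ix x =>
    intro s h hs h6 f hf; simp [wf] at h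
    refine ⟨_, ?_, le_rfl⟩
    have := Exec.put (W := W) s a ix x.clamp (fits s hs ix h.1.1.1 (by omega))
      (cfits s hs x h.1.2 h.2)
    rwa [x.eval_clamp h6] at this
  | seq p q hp hq =>
    intro s h hs h6 f hf; simp [wf] at h
    obtain ⟨h1, h2⟩ := run_bdd hK p s h.1 hs h6
    obtain ⟨c, hc, hc'⟩ := hp s h.1 hs h6 f hf
    obtain ⟨d, hd, hd'⟩ := hq (p.run K s) h.2 h1 ((h2 6 (by omega)).trans h6) f
      (fun r hr => (hf r hr).trans (h2 r hr).symm)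
    exact ⟨c + d, Exec.seq _ _ _ _ _ _ _ hc hd, by simp only [time]; omega⟩
  | ite x p q hp hq =>
    intro s h hs h6 f hf; simp [wf] at h
    have hx := fits s hs x h.1.1.1 (by omega)
    by_cases h0 : x.eval s = 0
    · obtain ⟨c, hc, hc'⟩ := hq s h.2 hs h6 f hf
      exact ⟨_, by rw [run, if_pos h0]; exact Exec.ite_false _ _ _ _ _ _ hx h0 hc,
        by simp only [time]; omega⟩
    · obtain ⟨c, hc, hc'⟩ := hp s h.1.2 hs h6 f hf
      exact ⟨_, by rw [run, if_neg h0]; exact Exec.ite_true _ _ _ _ _ _ hx h0 hc,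
        by simp only [time]; omega⟩
  | loop i n p hp =>
    intro s h hs h6 f hf
    simp [wf] at h
    obtain ⟨⟨⟨h1, h2⟩, h3⟩, h4⟩ := h
    set F : ℕ → State := fun m =>
      (Nat.rec (s.setReg i 0) (fun j st => (p.run K st).setReg i (j + 1)) m : State) with hF
    have Fs : ∀ m, F (m + 1) = (p.run K (F m)).setReg i (m + 1) := fun m => rfl
    have key : ∀ m ≤ K, (F m).Bdd K ∧ (∀ r < 7, (F m).reg r = s.reg r) ∧ (F m).reg i = m := by
      intro m
      induction m with
      | zero =>
        intro _
        exact ⟨hs.setReg _ (by omega), fun r hr => by simp [hF]; omega, by simp [hF]⟩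
      | succ m ih =>
        intro hm
        obtain ⟨a1, a2, a3⟩ := ih (by omega)
        obtain ⟨b1, b2⟩ := run_bdd hK p _ h3 a1 ((a2 6 (by omega)).trans h6)
        refine ⟨b1.setReg _ hm, fun r hr => ?_, by simp [Fs]⟩
        rw [Fs, State.reg_setReg, if_neg (by omega), b2 r hr, a2 r hr]
    have hnK := hs.reg n
    have loop : ∀ d m, m + d = s.reg n → ∃ c,
        Exec W (Prog.loop (Expr.reg n - Expr.reg i)
          (Prog.seq p.compile (Prog.set i (Expr.reg i + Expr.lit 1)))) (F m) (F (s.reg n)) c ∧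
        c ≤ d * (p.time f + 8) + 4 := by
      intro d
      induction d with
      | zero =>
        intro m hm
        obtain ⟨a1, a2, a3⟩ := key m (by omega)
        obtain rfl : m = s.reg n := by omega
        refine ⟨_, Exec.loop_false _ _ _ (fits _ a1 _ rfl (show 2 ≤ 32 by omega)) ?_, ?_⟩
        · rw [Expr.eval_sub, Expr.eval_reg, Expr.eval_reg, a2 n h2, a3]; omega
        · change 1 + 1 + 1 + 1 ≤ _; omega
      | succ d ih =>
        intro m hm
        obtain ⟨a1, a2, a3⟩ := key m (by omega)
        obtain ⟨b1, b2⟩ := run_bdd hK p _ h3 a1 ((a2 6 (by omega)).trans h6)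
        obtain ⟨c, hc, hc'⟩ := hp _ h3 a1 ((a2 6 (by omega)).trans h6) f
          (fun r hr => (hf r hr).trans (a2 r hr).symm)
        obtain ⟨e, he, he'⟩ := ih (m + 1) (by omega)
        have hset := Exec.set (W := W) (p.run K (F m)) i (Expr.reg i + Expr.lit 1)
          (fits _ b1 _ rfl (show 2 ≤ 32 by omega))
        rw [Expr.eval_add, Expr.eval_reg, Expr.eval_lit, run_reg p _ i h4, a3, ← Fs] at hset
        refine ⟨_, Exec.loop_true _ _ _ _ _ _ _ (fits _ a1 _ rfl (show 2 ≤ 32 by omega)) ?_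
          (Exec.seq _ _ _ _ _ _ _ hc hset) he, ?_⟩
        · rw [Expr.eval_sub, Expr.eval_reg, Expr.eval_reg, a2 n h2, a3]; omega
        · change 1 + 1 + 1 + 1 + (c + (1 + 1 + 1 + 1)) + e ≤ _
          rw [Nat.succ_mul]; omega
    obtain ⟨c, hc, hc'⟩ := loop (s.reg n) 0 (by omega)
    have hset := Exec.set (W := W) s i (Expr.lit 0) (fits _ hs _ rfl (show 1 ≤ 32 by omega))
    refine ⟨_, Exec.seq _ _ _ _ _ _ _ hset hc, ?_⟩
    change 1 + 1 + c ≤ f n * (p.time f + 8) + 6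
    rw [hf n h2]; omega

/-- Induction over the passes of a loop. -/
theorem run_loop_induction (i n : ℕ) (p : Cmd) (s : State) (I : ℕ → State → Prop)
    (h0 : I 0 (s.setReg i 0))
    (hstep : ∀ j st, j < s.reg n → st.reg i = j → (∀ r ∉ i :: p.regs, st.reg r = s.reg r) →
      (∀ a ∉ p.arrs, st.arr a = s.arr a) → I j st → I (j + 1) ((p.run K st).setReg i (j + 1))) :
    I (s.reg n) ((loop i n p).run K s) := by
  set F : ℕ → State := fun m =>
    (Nat.rec (s.setReg i 0) (fun j st => (p.run K st).setReg i (j + 1)) m : State) with hF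
  have Fs : ∀ m, F (m + 1) = (p.run K (F m)).setReg i (m + 1) := fun m => rfl
  have key : ∀ m, m ≤ s.reg n → I m (F m) ∧ (F m).reg i = m ∧
      (∀ r ∉ i :: p.regs, (F m).reg r = s.reg r) ∧ (∀ a ∉ p.arrs, (F m).arr a = s.arr a) := by
    intro m
    induction m with
    | zero =>
      intro _
      refine ⟨h0, by simp [hF], fun r hr => ?_, fun a _ => rfl⟩
      simp only [List.mem_cons, not_or] at hr
      simp [hF, hr.1]
    | succ m ih =>
      intro hm
      obtain ⟨a1, a2, a3, a4⟩ := ih (by omega)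
      refine ⟨hstep m _ (by omega) a2 a3 a4 a1, by simp [Fs], fun r hr => ?_, fun a ha => ?_⟩
      · have := a3 r hr
        simp only [List.mem_cons, not_or] at hr
        rw [Fs, State.reg_setReg, if_neg hr.1, run_reg p _ r hr.2, this]
      · rw [Fs, State.arr_setReg, run_arr p _ a ha, a4 a ha]
  exact (key _ le_rfl).1

end Cmd

/-! ### Traces of numbers -/

/-- A trace given by the numbers of its threads, variables and locks: event `i < N` is performed by
thread `th i`, has an operation of kind `kd i` and accesses variable or lock `tg i`. -/
structure NTrace where
  (N T V L : ℕ)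
  (th kd tg : ℕ → ℕ)

namespace NTrace

variable (D : NTrace)

/-- A common numbering of variables and locks. -/
def obj (i : ℕ) : ℕ := D.tg i + D.V * (D.kd i / 2)

/-- Event `r` is the release matching the acquire `a`. -/
structure Match (a r : ℕ) : Prop where
  lt : a < r
  lt_N : r < D.N
  kd_acq : D.kd a = 2
  kd_rel : D.kd r = 3
  obj_eq : D.obj a = D.obj r
  th_eq : D.th a = D.th r
  next : ∀ f, a < f → f < r → D.obj f ≠ D.obj a

/-- Event `w` is the writer of the read `r`. -/
structure Writer (w r : ℕ) : Prop where
  lt : w < r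
  lt_N : r < D.N
  kd_write : D.kd w = 1
  kd_read : D.kd r = 0
  obj_eq : D.obj w = D.obj r
  last : ∀ f, w < f → f < r → D.obj f = D.obj w → D.kd f ≠ 1

/-- Ranges of the numbers and well-formedness. -/
structure Valid : Prop where
  th_lt : ∀ i < D.N, D.th i < D.T
  kd_lt : ∀ i < D.N, D.kd i < 4
  tg_var : ∀ i < D.N, D.kd i < 2 → D.tg i < D.V
  tg_lock : ∀ i < D.N, 2 ≤ D.kd i → D.tg i < D.L
  T_le : D.T ≤ D.N
  V_le : D.V ≤ D.N
  L_le : D.L ≤ D.N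
  rel_matched : ∀ r < D.N, D.kd r = 3 → ∃ a, D.Match a r
  acq_exclusive : ∀ a b, a < b → b < D.N → D.kd a = 2 → D.kd b = 2 → D.obj a = D.obj b →
    ∃ r, a < r ∧ r < b ∧ D.kd r = 3 ∧ D.obj r = D.obj a

/-- Conflicting accesses. -/
def Conflict (i j : ℕ) : Prop :=
  i ≠ j ∧ D.obj i = D.obj j ∧ D.kd i < 2 ∧ D.kd j < 2 ∧ (D.kd i = 1 ∨ D.kd j = 1)

/-- Closure of `{r}` under thread order and reads-from. -/
inductive Cl (r : ℕ) : ℕ → Prop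
  | refl : Cl r r
  | thread (i j : ℕ) : Cl r j → i < j → D.th i = D.th j → Cl r i
  | writer (w j : ℕ) : Cl r j → D.Writer w j → Cl r w

/-- The least optimistically lock-closed set, up to the requirement that it avoids `p` and `q`. -/
inductive Need (p q : ℕ) : ℕ → Prop
  | left (i : ℕ) : i < p → D.th i = D.th p → Need p q i
  | right (i : ℕ) : i < q → D.th i = D.th q → Need p q i
  | thread (i j : ℕ) : Need p q j → i < j → D.th i = D.th j → Need p q i
  | writer (w j : ℕ) : Need p q j → D.Writer w j → Need p q w
  | lock (a r : ℕ) : Need p q a → D.Match a r → ¬ D.Cl r p → ¬ D.Cl r q → Need p q r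

/-- The order constraints that point forward in the trace. -/
def Before (i j : ℕ) : Prop :=
  i < j ∧ (D.th i = D.th j ∨ (D.obj i = D.obj j ∧ (D.kd i % 2 = 1 ∨ D.kd j = 1)))

/-- The events of `S` that have to precede some release of `y` in `S`. -/
inductive Reach (S : ℕ → Prop) (y : ℕ) : ℕ → Prop
  | rel (r : ℕ) : S r → D.kd r = 3 → D.obj r = y → Reach S y r
  | step (i j : ℕ) : S i → Reach S y j → D.Before i j → Reach S y i

/-- An acquire in `S` whose matching release is not in `S`. -/
def Open (S : ℕ → Prop) (a : ℕ) : Prop :=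
  S a ∧ D.kd a = 2 ∧ ∀ r, D.Match a r → ¬ S r

/-- The order `key` on `S` is an optimistic sync-reversal witness for `p` and `q`. -/
structure Witness (p q : ℕ) (S : ℕ → Prop) (key : ℕ → ℕ) : Prop where
  lt_N : ∀ i, S i → i < D.N
  inj : ∀ i j, S i → S j → key i = key j → i = j
  rel_matched : ∀ r, S r → D.kd r = 3 → ∃ a, S a ∧ D.kd a = 2 ∧ D.obj a = D.obj r ∧
    D.th a = D.th r ∧ key a < key r ∧
    ∀ f, S f → D.obj f = D.obj a → key a < key f → ¬ key f < key r
  acq_exclusive : ∀ a b, S a → S b → D.kd a = 2 → D.kd b = 2 → D.obj a = D.obj b →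
    key a < key b → ∃ r, S r ∧ D.kd r = 3 ∧ D.obj r = D.obj a ∧ key a < key r ∧ key r < key b
  thread_closed : ∀ i j, S j → i < j → D.th i = D.th j → S i
  writer_closed : ∀ w r, S r → D.Writer w r → S w
  thread_key : ∀ i j, S j → i < j → D.th i = D.th j → key i < key j
  writer_key : ∀ w r, S r → D.Writer w r → key w < key r ∧
    ∀ f, S f → D.obj f = D.obj w → D.kd f = 1 → key w < key f → ¬ key f < key r
  conflict : ∀ i j, S i → S j → D.Conflict i j → (key i < key j ↔ i < j)
  lock : ∀ a b r s, a ≠ b → D.obj a = D.obj b → D.Match a r → D.Match b s → S r → S s →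
    (key a < key b ↔ a < b)
  not_left : ¬ S p
  not_right : ¬ S q
  left : ∀ i, i < p → D.th i = D.th p → S i
  right : ∀ i, i < q → D.th i = D.th q → S i
  lock_closed : ∀ a r, S a → D.Match a r → ¬ D.Cl r p → ¬ D.Cl r q → S r

/-- The conditions that the least optimistically lock-closed set has to satisfy. -/
structure Good (p q : ℕ) : Prop where
  not_left : ¬ D.Need p q p
  not_right : ¬ D.Need p q q
  unique : ∀ a b, D.Open (D.Need p q) a → D.Open (D.Need p q) b → D.obj a = D.obj b → a = b
  acyclic : ∃ rank : ℕ → ℕ, ∀ a b, D.Open (D.Need p q) a → D.Open (D.Need p q) b →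
    D.Reach (D.Need p q) (D.obj b) a → rank a < rank b

variable {D}

theorem Valid.kind_eq (h : D.Valid) {i j : ℕ} (hi : i < D.N) (hj : j < D.N)
    (hx : D.obj i = D.obj j) : D.kd i / 2 = D.kd j / 2 ∧ D.tg i = D.tg j := by
  have aux : ∀ i j, i < D.N → j < D.N → D.obj i = D.obj j → D.kd i < 2 → D.kd j < 2 := by
    intro i j hi hj hx h2
    by_contra h3
    have a1 := h.tg_var i hi h2
    have a2 := h.kd_lt j hj
    have a3 : D.kd i / 2 = 0 := by omega
    have a4 : D.kd j / 2 = 1 := by omega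
    simp only [obj, a3, a4] at hx
    omega
  have b1 := aux i j hi hj hx
  have b2 := aux j i hj hi hx.symm
  have b3 := h.kd_lt i hi
  have b4 := h.kd_lt j hj
  have b5 : D.kd i / 2 = D.kd j / 2 := by omega
  refine ⟨b5, ?_⟩
  simp only [obj, b5] at hx
  omega

theorem Valid.exists_match (h : D.Valid) {a r : ℕ} (har : a < r) (hr : r < D.N) (ha : D.kd a = 2)
    (hk : D.kd r = 3) (hx : D.obj a = D.obj r) : ∃ s, s ≤ r ∧ D.Match a s := by
  classical
  have hex : ∃ s, a < s ∧ s < D.N ∧ D.kd s = 3 ∧ D.obj a = D.obj s := ⟨r, har, hr, hk, hx⟩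
  obtain ⟨h1, h2, h3, h4⟩ := Nat.find_spec hex
  have hmin := fun m hm => Nat.find_min hex (m := m) hm
  have hle : Nat.find hex ≤ r := Nat.find_min' hex ⟨har, hr, hk, hx⟩
  generalize Nat.find hex = s at *
  obtain ⟨b, hb⟩ := h.rel_matched s h2 h3
  rcases lt_trichotomy b a with hba | rfl | hab
  · exact absurd (h4.trans hb.obj_eq.symm) (hb.next a hba h1)
  · exact ⟨s, hle, hb⟩
  · obtain ⟨t, ht1, ht2, ht3, ht4⟩ := h.acq_exclusive a b hab (hb.lt.trans hb.lt_N) ha hb.kd_acq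
      (h4.trans hb.obj_eq.symm)
    exact absurd ⟨ht1, ht2.trans (hb.lt.trans h2), ht3, ht4.symm⟩ (hmin t (ht2.trans hb.lt))

theorem Match.unique {a r s : ℕ} (hr : D.Match a r) (hs : D.Match a s) :
    r = s := by
  rcases lt_trichotomy r s with h1 | h1 | h1
  · exact absurd hr.obj_eq.symm (hs.next r hr.lt h1)
  · exact h1
  · exact absurd hs.obj_eq.symm (hr.next s hs.lt h1)

theorem Match.lt_acq {r b s : ℕ} (hs : D.Match b s) (hk : D.kd r = 3)
    (hx : D.obj r = D.obj b) (hrs : r < s) : r < b := by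
  have h1 : ¬ b < r := fun hb => hs.next r hb hrs hx
  have h2 : r ≠ b := by rintro rfl; have := hs.kd_acq; omega
  omega

theorem Need.lt_N {p q i : ℕ} (hp : p < D.N) (hq : q < D.N) (h : D.Need p q i) : i < D.N := by
  induction h with
  | left i hi _ => omega
  | right i hi _ => omega
  | thread i j _ hi _ ih => omega
  | writer w j _ hw ih => have := hw.lt; omega
  | lock a r _ hm _ _ ih => exact hm.lt_N

theorem Witness.need_subset {p q : ℕ} {S : ℕ → Prop} {key : ℕ → ℕ} (w : D.Witness p q S key)
    {i : ℕ} (h : D.Need p q i) : S i := by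
  induction h with
  | left i hi ht => exact w.left i hi ht
  | right i hi ht => exact w.right i hi ht
  | thread i j _ hi ht ih => exact w.thread_closed i j ih hi ht
  | writer v j _ hw ih => exact w.writer_closed v j ih hw
  | lock a r _ hm h1 h2 ih => exact w.lock_closed a r ih hm h1 h2

section Forward

variable {p q : ℕ} {S : ℕ → Prop} {key : ℕ → ℕ}

theorem Witness.lt_of_key (w : D.Witness p q S key) {i j : ℕ} (hi : S i) (hk : key i < key j)
    (ht : D.th i = D.th j) : i < j := by
  rcases lt_trichotomy i j with h | rfl | h
  · exact h
  · omega
  · have := w.thread_key j i hi h ht.symm; omega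

theorem Witness.no_op_between (w : D.Witness p q S key) {a r f : ℕ} (hr : S r) (hm : D.Match a r)
    (hf : S f) (hx : D.obj f = D.obj a) (h1 : key a < key f) : ¬ key f < key r := by
  obtain ⟨b, hb, hkb, hxb, htb, hlt, hno⟩ := w.rel_matched r hr hm.kd_rel
  have ha := w.thread_closed a r hr hm.lt hm.th_eq
  have hbr := w.lt_of_key hb hlt htb
  rcases lt_trichotomy a b with h | rfl | h
  · exact absurd (hxb.trans hm.obj_eq.symm) (hm.next b h hbr)
  · exact hno f hf hx h1
  · exact absurd (w.thread_key a r hr hm.lt hm.th_eq)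
      (hno a ha (hm.obj_eq.trans hxb.symm) (w.thread_key b a ha h (htb.trans hm.th_eq.symm)))

theorem Witness.open_last (h : D.Valid) (w : D.Witness p q S key) {a r : ℕ} (ha : D.Open S a)
    (hr : S r) (hk : D.kd r = 3) (hx : D.obj r = D.obj a) : key r < key a := by
  classical
  obtain ⟨haS, hka, hno⟩ := ha
  by_contra hlt
  have hne : key r ≠ key a := fun he => by
    have := w.inj r a hr haS he; subst this; omega
  have hex : ∃ k, ∃ s, S s ∧ D.kd s = 3 ∧ D.obj s = D.obj a ∧ key a < key s ∧ key s = k :=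
    ⟨_, r, hr, hk, hx, by omega, rfl⟩
  obtain ⟨s, hs, hks, hxs, has, hkey⟩ := Nat.find_spec hex
  have hmin := fun m hm => Nat.find_min hex (m := m) hm
  rw [← hkey] at hmin
  obtain ⟨b, hb, hkb, hxb, htb, hbs, hbno⟩ := w.rel_matched s hs hks
  have hba : b = a := by
    rcases lt_trichotomy (key b) (key a) with h1 | h1 | h1
    · exact absurd has (hbno a haS (hxs.symm.trans hxb.symm) h1)
    · exact w.inj b a hb haS h1
    · obtain ⟨t, ht, hkt, hxt, h2, h3⟩ :=
        w.acq_exclusive a b haS hb hka hkb (hxs.symm.trans hxb.symm) h1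
      exact absurd ⟨t, ht, hkt, hxt, h2, rfl⟩ (hmin (key t) (by omega))
  subst hba
  have hbs' := w.lt_of_key hb hbs htb
  obtain ⟨t, hts, hmt⟩ := h.exists_match hbs' (w.lt_N s hs) hka hks hxs.symm
  refine hno t hmt ?_
  rcases hts.lt_or_eq with h1 | rfl
  · exact w.thread_closed t s hs h1 (hmt.th_eq.symm.trans htb)
  · exact hs

theorem Witness.key_of_before (h : D.Valid) (w : D.Witness p q S key) {i j : ℕ} (hi : S i)
    (hj : S j) (hb : D.Before i j) : key i < key j := by
  obtain ⟨hlt, ht | ⟨hx, hk⟩⟩ := hb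
  · exact w.thread_key i j hj hlt ht
  have hiN := w.lt_N i hi
  have hjN := w.lt_N j hj
  have k1 := h.kd_lt i hiN
  have k2 := h.kd_lt j hjN
  have k3 := (h.kind_eq hiN hjN hx).1
  have rel_acq : ∀ j, S j → i < j → D.obj i = D.obj j → D.kd i = 3 → D.kd j = 2 →
      key i < key j := by
    intro j hj hlt hx hk3 hk2
    by_cases ho : ∃ s, D.Match j s ∧ S s
    · obtain ⟨s, hms, hs⟩ := ho
      obtain ⟨a, hma⟩ := h.rel_matched i hiN hk3
      have haj : a < j := hma.lt.trans hlt
      have h1 := (w.lock a j i s haj.ne (hma.obj_eq.trans hx) hma hms hi hs).2 haj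
      have h2 := w.no_op_between hi hma hj (hx.symm.trans hma.obj_eq.symm) h1
      have h3 : key i ≠ key j := fun he => hlt.ne (w.inj i j hi hj he)
      omega
    · push Not at ho
      exact w.open_last h ⟨hj, hk2, ho⟩ hi hk3 hx
  by_cases hv : D.kd i < 2
  · exact (w.conflict i j hi hj ⟨hlt.ne, hx, hv, by omega, by omega⟩).2 hlt
  · have hk3 : D.kd i = 3 := by omega
    by_cases hk2 : D.kd j = 2
    · exact rel_acq j hj hlt hx hk3 hk2
    · obtain ⟨b, hmb⟩ := h.rel_matched j hjN (by omega)
      have hb := w.thread_closed b j hj hmb.lt hmb.th_eq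
      have hib := hmb.lt_acq hk3 (hx.trans hmb.obj_eq.symm) hlt
      exact (rel_acq b hb hib (hx.trans hmb.obj_eq.symm) hk3 hmb.kd_acq).trans
        (w.thread_key b j hj hmb.lt hmb.th_eq)

theorem Witness.open_of_need (w : D.Witness p q S key) {a : ℕ}
    (ha : D.Open (D.Need p q) a) : D.Open S a := by
  obtain ⟨h1, h2, h3⟩ := ha
  refine ⟨w.need_subset h1, h2, fun r hm hr => h3 r hm (Need.lock a r h1 hm ?_ ?_)⟩
  all_goals
    intro hc
    have : ∀ i, D.Cl r i → S i := fun i hi => by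
      induction hi with
      | refl => exact hr
      | thread i j _ hij ht ih => exact w.thread_closed i j ih hij ht
      | writer v j _ hv ih => exact w.writer_closed v j ih hv
  · exact w.not_left (this _ hc)
  · exact w.not_right (this _ hc)

theorem Witness.good (h : D.Valid) (w : D.Witness p q S key) : D.Good p q where
  not_left := fun hn => w.not_left (w.need_subset hn)
  not_right := fun hn => w.not_right (w.need_subset hn)
  unique := by
    intro a b ha hb hx
    have ha' := w.open_of_need ha
    have hb' := w.open_of_need hb
    have key_ne : ∀ a b, D.Open S a → D.Open S b → D.obj a = D.obj b → ¬ key a < key b := by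
      intro a b ha hb hx hlt
      obtain ⟨r, hr, hk, hxr, h1, -⟩ := w.acq_exclusive a b ha.1 hb.1 ha.2.1 hb.2.1 hx hlt
      have := w.open_last h ha hr hk hxr
      omega
    exact w.inj a b ha'.1 hb'.1 (le_antisymm (not_lt.1 (key_ne b a hb' ha' hx.symm))
      (not_lt.1 (key_ne a b ha' hb' hx)))
  acyclic := by
    refine ⟨key, fun a b ha hb hr => ?_⟩
    have hreach : ∀ i, D.Reach (D.Need p q) (D.obj b) i →
        S i ∧ ∃ r, S r ∧ D.kd r = 3 ∧ D.obj r = D.obj b ∧ key i ≤ key r := by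
      intro i hi
      induction hi with
      | rel r hr hk hx => exact ⟨w.need_subset hr, r, w.need_subset hr, hk, hx, le_rfl⟩
      | step i j hi _ hb ih =>
        obtain ⟨hj, r, hr, hk, hx, hle⟩ := ih
        have := w.key_of_before h (w.need_subset hi) hj hb
        exact ⟨w.need_subset hi, r, hr, hk, hx, by omega⟩
    obtain ⟨-, r, hr, hk, hx, hle⟩ := hreach a hr
    have := w.open_last h (w.open_of_need hb) hr hk hx
    omega

end Forward

section Backward

variable (D) in
/-- The smallest rank of an open acquire whose lock has a release that `i` has to precede. -/
noncomputable def level (S : ℕ → Prop) (rank : ℕ → ℕ) (i : ℕ) : ℕ :=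
  sInf {m | m = (Finset.range D.N).sup rank + 1 ∨
    ∃ b, D.Open S b ∧ D.Reach S (D.obj b) i ∧ m = rank b}

variable {S : ℕ → Prop} {rank : ℕ → ℕ}

theorem level_le {i b : ℕ} (hb : D.Open S b) (hr : D.Reach S (D.obj b) i) :
    D.level S rank i ≤ rank b :=
  Nat.sInf_le (Or.inr ⟨b, hb, hr, rfl⟩)

theorem lt_level {i a : ℕ} (ha : a < D.N)
    (h : ∀ b, D.Open S b → D.Reach S (D.obj b) i → rank a < rank b) :
    rank a < D.level S rank i := by
  have hne : {m | m = (Finset.range D.N).sup rank + 1 ∨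
    ∃ b, D.Open S b ∧ D.Reach S (D.obj b) i ∧ m = rank b}.Nonempty := ⟨_, Or.inl rfl⟩
  rcases Nat.sInf_mem hne with h1 | ⟨b, hb, hr, hm⟩
  · have : rank a ≤ (Finset.range D.N).sup rank := Finset.le_sup (Finset.mem_range.2 ha)
    unfold level
    omega
  · have := h b hb hr
    unfold level
    omega

theorem level_mono {i j : ℕ} (hi : S i) (hb : D.Before i j) :
    D.level S rank i ≤ D.level S rank j := by
  refine csInf_le_csInf ⟨0, fun _ _ => Nat.zero_le _⟩ ⟨_, Or.inl rfl⟩ ?_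
  rintro m (h | ⟨b, hbo, hr, rfl⟩)
  · exact Or.inl h
  · exact Or.inr ⟨b, hbo, Reach.step i j hi hr hb, rfl⟩

theorem Good.exists_witness (h : D.Valid) {p q : ℕ} (hp : p < D.N) (hq : q < D.N)
    (g : D.Good p q) : ∃ key, D.Witness p q (D.Need p q) key := by
  obtain ⟨rank, hrank⟩ := g.acyclic
  set S := D.Need p q with hS
  have hN : ∀ i, S i → i < D.N := fun i hi => hi.lt_N hp hq
  set key : ℕ → ℕ := fun i => D.level S rank i * D.N + i with hkey
  have key_lt : ∀ i j, i < D.N → D.level S rank i < D.level S rank j → key i < key j := by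
    intro i j hi hl
    simp only [hkey]
    nlinarith [Nat.mul_le_mul_right D.N (Nat.succ_le_of_lt hl)]
  have before : ∀ i j, S i → S j → D.Before i j → key i < key j := by
    intro i j hi hj hb
    rcases (level_mono (rank := rank) hi hb).lt_or_eq with h1 | h1
    · exact key_lt i j (hN i hi) h1
    · simp only [hkey, h1]; have := hb.1; omega
  have back : ∀ a r, D.Open S a → S r → D.kd r = 3 → D.obj r = D.obj a → key r < key a := by
    intro a r ha hr hk hx
    exact key_lt r a (hN r hr) ((level_le ha (Reach.rel r hr hk hx)).trans_lt
      (lt_level (hN a ha.1) fun b hb hrb => hrank a b ha hb hrb))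
  have relacq : ∀ r a, S r → S a → r < a → D.kd r = 3 → D.obj r = D.obj a → key r < key a :=
    fun r a hr ha hlt hk hx => before r a hr ha ⟨hlt, Or.inr ⟨hx, Or.inl (by omega)⟩⟩
  have thr : ∀ i j, S j → i < j → D.th i = D.th j → key i < key j :=
    fun i j hj hij ht => before i j (Need.thread i j hj hij ht) hj ⟨hij, Or.inl ht⟩
  have conf : ∀ i j, S i → S j → D.Conflict i j → i < j → key i < key j := by
    intro i j hi hj ⟨_, hx, h1, h2, h3⟩ hij
    exact before i j hi hj ⟨hij, Or.inr ⟨hx, by omega⟩⟩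
  have locks : ∀ a b r s, D.obj a = D.obj b → D.Match a r → D.Match b s → S r → S s → a < b →
      key a < key b := by
    intro a b r s hx hr hs hrS hsS hab
    have hrb : r < b := by
      by_contra hle
      have hne : r ≠ b := by rintro rfl; have := hr.kd_rel; have := hs.kd_acq; omega
      exact hr.next b hab (by omega) hx.symm
    exact (thr a r hrS hr.lt hr.th_eq).trans (relacq r b hrS
      (Need.thread b s hsS hs.lt hs.th_eq) hrb hr.kd_rel (hr.obj_eq.symm.trans hx))
  have opens : ∀ a, S a → D.kd a = 2 → D.Open S a ∨ ∃ r, D.Match a r ∧ S r := by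
    intro a ha hk
    by_cases ho : ∃ r, D.Match a r ∧ S r
    · exact Or.inr ho
    · push Not at ho; exact Or.inl ⟨ha, hk, ho⟩
  refine ⟨key, ?_⟩
  constructor
  case lt_N => exact hN
  case inj =>
    intro i j hi hj hk
    have h1 := hN i hi
    have h2 := hN j hj
    have := congrArg (· % D.N) hk
    simpa [hkey, Nat.mod_eq_of_lt h1, Nat.mod_eq_of_lt h2, Nat.add_mod] using this
  case rel_matched =>
    intro r hr hk
    obtain ⟨a, hm⟩ := h.rel_matched r (hN r hr) hk
    have ha : S a := Need.thread a r hr hm.lt hm.th_eq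
    refine ⟨a, ha, hm.kd_acq, hm.obj_eq, hm.th_eq, thr a r hr hm.lt hm.th_eq, ?_⟩
    intro f hf hx h1 h2
    have hfa : f ≠ a := by rintro rfl; omega
    have hfr : f ≠ r := by rintro rfl; omega
    have hkf : D.kd f = 2 ∨ D.kd f = 3 := by
      have k1 := (h.kind_eq (hN f hf) (hN a ha) hx).1
      have k2 := h.kd_lt f (hN f hf)
      have k3 := hm.kd_acq
      omega
    rcases lt_or_gt_of_ne hfa with h3 | h3
    · rcases hkf with hkf | hkf
      · rcases opens f hf hkf with ho | ⟨s, hms, hs⟩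
        · have := back f r ho hr hk (hm.obj_eq.symm.trans hx.symm); omega
        · have := locks f a s r hx hms hm hs hr h3; omega
      · have := relacq f a hf ha h3 hkf hx; omega
    · have h4 : r < f := by
        by_contra hle
        exact hm.next f h3 (by omega) hx
      have := relacq r f hr hf h4 hk (hm.obj_eq.symm.trans hx.symm); omega
  case acq_exclusive =>
    intro a b ha hb hka hkb hx hlt
    have hab : a ≠ b := by rintro rfl; omega
    rcases opens a ha hka with hao | ⟨r, hmr, hr⟩
    · rcases opens b hb hkb with hbo | ⟨s, hms, hs⟩
      · exact absurd (g.unique a b hao hbo hx) hab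
      · have h1 := back a s hao hs hms.kd_rel (hms.obj_eq.symm.trans hx.symm)
        have h2 := thr b s hs hms.lt hms.th_eq
        omega
    · refine ⟨r, hr, hmr.kd_rel, hmr.obj_eq.symm, thr a r hr hmr.lt hmr.th_eq, ?_⟩
      have hxr := hmr.obj_eq.symm.trans hx
      rcases opens b hb hkb with hbo | ⟨s, hms, hs⟩
      · exact back b r hbo hr hmr.kd_rel hxr
      · rcases lt_or_gt_of_ne hab with h1 | h1
        · have hrb : r < b := by
            by_contra hle
            have hne : r ≠ b := by rintro rfl; have := hmr.kd_rel; omega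
            exact hmr.next b h1 (by omega) hx.symm
          exact relacq r b hr hb hrb hmr.kd_rel hxr
        · have := locks b a s r hx.symm hms hmr hs hr h1; omega
  case thread_closed => exact fun i j hj hij ht => Need.thread i j hj hij ht
  case writer_closed => exact fun w r hr hw => Need.writer w r hr hw
  case thread_key => exact thr
  case writer_key =>
    intro w r hr hw
    have hwS : S w := Need.writer w r hr hw
    have hkw := hw.kd_write
    have hkr := hw.kd_read
    refine ⟨conf w r hwS hr ⟨hw.lt.ne, hw.obj_eq, by omega, by omega, by omega⟩ hw.lt, ?_⟩
    intro f hf hx hkf h1 h2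
    have hfw : f ≠ w := by rintro rfl; omega
    have hfr : f ≠ r := by rintro rfl; omega
    rcases lt_or_gt_of_ne hfw with h3 | h3
    · have := conf f w hf hwS ⟨hfw, hx, by omega, by omega, by omega⟩ h3; omega
    · have h4 : r < f := by
        by_contra hle
        exact hw.last f h3 (by omega) hx hkf
      have := conf r f hr hf ⟨h4.ne, hw.obj_eq.symm.trans hx.symm, by omega, by omega, by omega⟩ h4
      omega
  case conflict =>
    intro i j hi hj hc
    refine ⟨fun hk => ?_, conf i j hi hj hc⟩
    by_contra hle
    obtain ⟨h0, hx, h1, h2, h3⟩ := hc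
    have := conf j i hj hi ⟨h0.symm, hx.symm, h2, h1, h3.symm⟩ (by omega)
    omega
  case lock =>
    intro a b r s hab hx hr hs hrS hsS
    refine ⟨fun hk => ?_, locks a b r s hx hr hs hrS hsS⟩
    by_contra hle
    have := locks b a s r hx.symm hs hr hsS hrS (by omega)
    omega
  case not_left => exact g.not_left
  case not_right => exact g.not_right
  case left => exact fun i hi ht => Need.left i hi ht
  case right => exact fun i hi ht => Need.right i hi ht
  case lock_closed => exact fun a r ha hm h1 h2 => Need.lock a r ha hm h1 h2

end Backward

/-- Races are decided by the least optimistically lock-closed set. -/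
theorem Valid.exists_witness_iff (h : D.Valid) {p q : ℕ} (hp : p < D.N) (hq : q < D.N) :
    (∃ S key, D.Witness p q S key) ↔ D.Good p q :=
  ⟨fun ⟨_, _, w⟩ => w.good h, fun g => ⟨_, g.exists_witness h hp hq⟩⟩

end NTrace

/-! ### Numbering a trace -/

section Coding

variable {Thr Var Lck : Type}

/-- The trace of numbers that is presented to the machine. -/
noncomputable def code (nt : Thr → ℕ) (nv : Var → ℕ) (nl : Lck → ℕ) (σ : Trace Thr Var Lck) :
    NTrace where
  N := σ.length
  T := (threads σ).ncard
  V := (vars σ).ncard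
  L := (locks σ).ncard
  th k := (σ.map fun e => nt e.thread).getD k 0
  kd k := (σ.map fun e => e.op.kind).getD k 0
  tg k := (σ.map fun e => e.op.target nv nl).getD k 0

/-- The assumptions on a trace and its presentation. -/
structure Coded (nt : Thr → ℕ) (nv : Var → ℕ) (nl : Lck → ℕ) (σ : Trace Thr Var Lck) : Prop where
  wf : WellFormed σ
  thr : IsNumbering (threads σ) nt
  var : IsNumbering (vars σ) nv
  lck : IsNumbering (locks σ) nl

/-- The trace `ρ` consists of the events of `σ` at the positions in `S`, ordered by `key`. -/
structure Rep (σ ρ : Trace Thr Var Lck) (S : ℕ → Prop) (key : ℕ → ℕ) : Prop where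
  sub : ∀ e ∈ ρ, e ∈ σ
  mem : ∀ i e, σ[i]? = some e → (e ∈ ρ ↔ S i)
  lt : ∀ i j e f, σ[i]? = some e → σ[j]? = some f →
    (TraceLT ρ e f ↔ S i ∧ S j ∧ key i < key j)
  le : ∀ i j e f, σ[i]? = some e → σ[j]? = some f →
    (TraceLE ρ e f ↔ S i ∧ S j ∧ key i ≤ key j)
  lt_length : ∀ i, S i → i < σ.length
  inj : ∀ i j, S i → S j → key i = key j → i = j

variable {nt : Thr → ℕ} {nv : Var → ℕ} {nl : Lck → ℕ} {σ ρ : Trace Thr Var Lck}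

theorem pos_unique (hσ : σ.Nodup) {i j : ℕ} {e : Event Thr Var Lck} (hi : σ[i]? = some e)
    (hj : σ[j]? = some e) : i = j := by
  obtain ⟨h1, h2⟩ := List.getElem?_eq_some_iff.1 hi
  exact (List.getElem?_inj h1 hσ).1 (hi.trans hj.symm)

theorem WellFormed.nodup (h : WellFormed σ) : σ.Nodup := List.Nodup.of_map _ h.nodup_ids

theorem exists_pos {e : Event Thr Var Lck} (h : e ∈ σ) : ∃ i : ℕ, σ[i]? = some e :=
  List.getElem?_of_mem h

theorem mem_of_pos {i : ℕ} {e : Event Thr Var Lck} (h : σ[i]? = some e) : e ∈ σ :=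
  List.mem_of_getElem? h

theorem pos_lt {i : ℕ} {e : Event Thr Var Lck} (h : σ[i]? = some e) : i < σ.length :=
  (List.getElem?_eq_some_iff.1 h).1

theorem exists_at {i : ℕ} (h : i < σ.length) : ∃ e, σ[i]? = some e :=
  ⟨σ[i], List.getElem?_eq_getElem h⟩

theorem Rep.of_index (hσ : σ.Nodup) (hsub : ∀ e ∈ ρ, e ∈ σ) {S : ℕ → Prop}
    {key : ℕ → ℕ} (hS : ∀ i e, σ[i]? = some e → (e ∈ ρ ↔ S i)) (hN : ∀ i, S i → i < σ.length)
    (hkey : ∀ i j e f, σ[i]? = some e → σ[j]? = some f → ∀ k l : ℕ, ρ[k]? = some e →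
      ρ[l]? = some f → (k < l ↔ key i < key j)) : Rep σ ρ S key where
  sub := hsub
  mem := hS
  lt := by
    intro i j e f hi hj
    constructor
    · rintro ⟨k, l, hkl, hk, hl⟩
      exact ⟨(hS i e hi).1 (mem_of_pos hk), (hS j f hj).1 (mem_of_pos hl),
        (hkey i j e f hi hj k l hk hl).1 hkl⟩
    · rintro ⟨h1, h2, h3⟩
      obtain ⟨k, hk⟩ := exists_pos ((hS i e hi).2 h1)
      obtain ⟨l, hl⟩ := exists_pos ((hS j f hj).2 h2)
      exact ⟨k, l, (hkey i j e f hi hj k l hk hl).2 h3, hk, hl⟩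
  le := by
    intro i j e f hi hj
    constructor
    · rintro ⟨k, l, hkl, hk, hl⟩
      refine ⟨(hS i e hi).1 (mem_of_pos hk), (hS j f hj).1 (mem_of_pos hl), ?_⟩
      have := hkey j i f e hj hi l k hl hk
      omega
    · rintro ⟨h1, h2, h3⟩
      obtain ⟨k, hk⟩ := exists_pos ((hS i e hi).2 h1)
      obtain ⟨l, hl⟩ := exists_pos ((hS j f hj).2 h2)
      have := hkey j i f e hj hi l k hl hk
      exact ⟨k, l, by omega, hk, hl⟩
  lt_length := hN
  inj := by
    intro i j hi hj hk
    obtain ⟨e, he⟩ := exists_at (hN i hi)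
    obtain ⟨f, hf⟩ := exists_at (hN j hj)
    obtain ⟨k, hk'⟩ := exists_pos ((hS i e he).2 hi)
    obtain ⟨l, hl⟩ := exists_pos ((hS j f hf).2 hj)
    have h1 := hkey j i f e hf he l k hl hk'
    have h2 := hkey i j e f he hf k l hk' hl
    obtain rfl : k = l := by omega
    obtain rfl : e = f := Option.some_injective _ (hk'.symm.trans hl)
    exact pos_unique hσ he hf

theorem Rep.self (hσ : σ.Nodup) : Rep σ σ (· < σ.length) id :=
  Rep.of_index hσ (fun _ h => h) (fun i e h => ⟨fun _ => pos_lt h, fun _ => mem_of_pos h⟩)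
    (fun _ h => h) (fun i j e f hi hj k l hk hl => by
      rw [pos_unique hσ hk hi, pos_unique hσ hl hj]; rfl)

theorem Rep.exists_of_nodup (hσ : σ.Nodup) (hρ : ρ.Nodup) (hsub : ∀ e ∈ ρ, e ∈ σ) :
    ∃ S key, Rep σ ρ S key := by
  classical
  refine ⟨fun i => ∃ e, σ[i]? = some e ∧ e ∈ ρ,
    fun i => if h : ∃ k : ℕ, ρ[k]? = σ[i]? then h.choose else 0, ?_⟩
  refine Rep.of_index hσ hsub (fun i e h => ⟨fun h' => ⟨e, h, h'⟩, ?_⟩)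
    (fun i ⟨e, h, _⟩ => pos_lt h) ?_
  · rintro ⟨f, hf, hm⟩
    rwa [Option.some_injective _ (h.symm.trans hf)]
  · intro i j e f hi hj k l hk hl
    have key : ∀ (i k : ℕ) (e : Event Thr Var Lck), σ[i]? = some e → ρ[k]? = some e →
        (if h : ∃ k : ℕ, ρ[k]? = σ[i]? then h.choose else 0) = k := by
      intro i k e hi hk
      have hex : ∃ k : ℕ, ρ[k]? = σ[i]? := ⟨k, hk.trans hi.symm⟩
      rw [dif_pos hex]
      exact pos_unique hρ (hex.choose_spec.trans hi) hk
    rw [key i k e hi hk, key j l f hj hl]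

/-- Every injective key is realised by a list of events. -/
theorem Rep.exists_of_key (hσ : σ.Nodup) {S : ℕ → Prop} {key : ℕ → ℕ}
    (hN : ∀ i, S i → i < σ.length) (inj : ∀ i j, S i → S j → key i = key j → i = j) :
    ∃ ρ : Trace Thr Var Lck, ρ.Nodup ∧ Rep σ ρ S key := by
  classical
  set P : List ℕ := ((List.range σ.length).filter fun i => decide (S i)).insertionSort
    (fun i j => key i ≤ key j) with hP
  have hmem : ∀ i, i ∈ P ↔ S i := by
    intro i
    rw [hP, List.mem_insertionSort, List.mem_filter, List.mem_range, decide_eq_true_eq]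
    exact ⟨fun h => h.2, fun h => ⟨hN i h, h⟩⟩
  have hnd : P.Nodup :=
    (List.perm_insertionSort _ _).nodup_iff.2 (List.nodup_range.filter _)
  have hsort : P.Pairwise (fun i j => key i ≤ key j) := List.pairwise_insertionSort _ _
  have hPN : ∀ i ∈ P, i < σ.length := fun i hi => hN i ((hmem i).1 hi)
  set ρ : Trace Thr Var Lck := P.pmap (fun i h => σ[i]) hPN with hρ
  have hlen : ρ.length = P.length := by simp [hρ]
  have hget : ∀ (k : ℕ) (e : Event Thr Var Lck), ρ[k]? = some e →
      ∃ (hk : k < P.length), σ[P[k]]? = some e := by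
    intro k e he
    obtain ⟨hk, h⟩ := List.getElem?_eq_some_iff.1 he
    refine ⟨by omega, ?_⟩
    simp only [hρ, List.getElem_pmap] at h
    rw [List.getElem?_eq_getElem (hPN _ (List.getElem_mem _)), h]
  have hmemρ : ∀ i e, σ[i]? = some e → (e ∈ ρ ↔ S i) := by
    intro i e hi
    rw [hρ, List.mem_pmap]
    constructor
    · rintro ⟨j, hj, rfl⟩
      have : i = j := pos_unique hσ hi (List.getElem?_eq_getElem _)
      rw [this]; exact (hmem j).1 hj
    · intro h
      exact ⟨i, (hmem i).2 h, (List.getElem?_eq_some_iff.1 hi).2⟩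
  have hρnd : ρ.Nodup := by
    refine hnd.pmap ?_
    intro a ha b hb hab
    exact (List.Nodup.getElem_inj_iff hσ).1 hab
  refine ⟨ρ, hρnd, Rep.of_index hσ ?_ hmemρ hN ?_⟩
  · intro e he
    rw [hρ, List.mem_pmap] at he
    obtain ⟨j, hj, rfl⟩ := he
    exact List.getElem_mem _
  · intro i j e f hi hj k l hk hl
    obtain ⟨hkP, hk'⟩ := hget k e hk
    obtain ⟨hlP, hl'⟩ := hget l f hl
    obtain rfl : i = P[k] := pos_unique hσ hi hk'
    obtain rfl : j = P[l] := pos_unique hσ hj hl'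
    have mono : ∀ k l (hk : k < P.length) (hl : l < P.length), k < l → key P[k] < key P[l] := by
      intro k l hk hl hkl
      refine lt_of_le_of_ne (List.pairwise_iff_getElem.1 hsort k l hk hl hkl) fun he => ?_
      have := inj _ _ ((hmem _).1 (List.getElem_mem hk)) ((hmem _).1 (List.getElem_mem hl)) he
      exact hkl.ne ((List.Nodup.getElem_inj_iff hnd).1 this)
    refine ⟨mono k l hkP hlP, fun h => ?_⟩
    by_contra hle
    rcases (not_lt.1 hle).lt_or_eq with h1 | rfl
    · have := mono l k hlP hkP h1; omega
    · omega

section Values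

variable (nt nv nl) {i : ℕ} {e : Event Thr Var Lck}

theorem code_th (h : σ[i]? = some e) : (code nt nv nl σ).th i = nt e.thread := by
  simp [code, h]

theorem code_kd (h : σ[i]? = some e) : (code nt nv nl σ).kd i = e.op.kind := by
  simp [code, h]

theorem code_tg (h : σ[i]? = some e) : (code nt nv nl σ).tg i = e.op.target nv nl := by
  simp [code, h]

end Values

theorem ncard_threads_le : (threads σ).ncard ≤ σ.length := by
  classical
  have h : threads σ ⊆ ((σ.map fun e => e.thread).toFinset : Set Thr) := by
    rintro _ ⟨e, he, rfl⟩
    simp only [List.coe_toFinset, List.mem_map, Set.mem_ofPred_eq]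
    exact ⟨e, he, rfl⟩
  refine (Set.ncard_le_ncard h (Finset.finite_toSet _)).trans ?_
  rw [Set.ncard_coe_finset]
  exact (List.toFinset_card_le _).trans (by simp)

/-- The variable that an operation accesses. -/
def Op.var? : Op Var Lck → Option Var
  | read x => some x
  | write x => some x
  | _ => none

/-- The lock that an operation accesses. -/
def Op.lck? : Op Var Lck → Option Lck
  | acq l => some l
  | rel l => some l
  | _ => none

theorem ncard_vars_le : (vars σ).ncard ≤ σ.length := by
  classical
  have h : vars σ ⊆ ((σ.filterMap fun e => e.op.var?).toFinset : Set Var) := by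
    rintro x ⟨e, he, h⟩
    simp only [List.coe_toFinset, List.mem_filterMap, Set.mem_ofPred_eq]
    exact ⟨e, he, by rcases h with h | h <;> rw [h] <;> rfl⟩
  refine (Set.ncard_le_ncard h (Finset.finite_toSet _)).trans ?_
  rw [Set.ncard_coe_finset]
  exact (List.toFinset_card_le _).trans (List.length_filterMap_le _ _)

theorem ncard_locks_le : (locks σ).ncard ≤ σ.length := by
  classical
  have h : locks σ ⊆ ((σ.filterMap fun e => e.op.lck?).toFinset : Set Lck) := by
    rintro x ⟨e, he, h⟩
    simp only [List.coe_toFinset, List.mem_filterMap, Set.mem_ofPred_eq]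
    exact ⟨e, he, by rcases h with h | h <;> rw [h] <;> rfl⟩
  refine (Set.ncard_le_ncard h (Finset.finite_toSet _)).trans ?_
  rw [Set.ncard_coe_finset]
  exact (List.toFinset_card_le _).trans (List.length_filterMap_le _ _)

/-- The variable or lock that an operation accesses. -/
def Op.obj : Op Var Lck → Var ⊕ Lck
  | read x => Sum.inl x
  | write x => Sum.inl x
  | acq l => Sum.inr l
  | rel l => Sum.inr l

theorem Op.eq_read {o : Op Var Lck} {x : Var} :
    o = Op.read x ↔ o.kind = 0 ∧ o.obj = Sum.inl x := by
  cases o <;> simp [Op.kind, Op.obj]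

theorem Op.eq_write {o : Op Var Lck} {x : Var} :
    o = Op.write x ↔ o.kind = 1 ∧ o.obj = Sum.inl x := by
  cases o <;> simp [Op.kind, Op.obj]

theorem Op.eq_acq {o : Op Var Lck} {l : Lck} :
    o = Op.acq l ↔ o.kind = 2 ∧ o.obj = Sum.inr l := by
  cases o <;> simp [Op.kind, Op.obj]

theorem Op.eq_rel {o : Op Var Lck} {l : Lck} :
    o = Op.rel l ↔ o.kind = 3 ∧ o.obj = Sum.inr l := by
  cases o <;> simp [Op.kind, Op.obj]

theorem Op.exists_inl {o : Op Var Lck} (h : o.kind < 2) : ∃ x, o.obj = Sum.inl x := by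
  cases o <;> simp [Op.kind, Op.obj] at h ⊢

theorem Op.exists_inr {o : Op Var Lck} (h : 2 ≤ o.kind) : ∃ l, o.obj = Sum.inr l := by
  cases o <;> simp [Op.kind, Op.obj] at h ⊢

theorem Op.kind_lt (o : Op Var Lck) : o.kind < 4 := by
  cases o <;> simp [Op.kind]

theorem Event.onLock_iff {e : Event Thr Var Lck} {l : Lck} : e.OnLock l ↔ e.op.obj = Sum.inr l := by
  unfold Event.OnLock; cases e.op <;> simp [Op.obj]

section Translation

variable {i j : ℕ} {e f : Event Thr Var Lck}

theorem Coded.target_lt (c : Coded nt nv nl σ) (he : e ∈ σ) :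
    (e.op.kind < 2 → e.op.target nv nl < (vars σ).ncard) ∧
    (2 ≤ e.op.kind → e.op.target nv nl < (locks σ).ncard) := by
  have hv := fun x (h : x ∈ vars σ) => c.var.mapsTo h
  have hl := fun l (h : l ∈ locks σ) => c.lck.mapsTo h
  cases ho : e.op with
  | read x => simpa [Op.kind, Op.target] using hv x ⟨e, he, Or.inl ho⟩
  | write x => simpa [Op.kind, Op.target] using hv x ⟨e, he, Or.inr ho⟩
  | acq l => simpa [Op.kind, Op.target] using hl l ⟨e, he, Or.inl ho⟩
  | rel l => simpa [Op.kind, Op.target] using hl l ⟨e, he, Or.inr ho⟩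

theorem Coded.th_eq_iff (c : Coded nt nv nl σ) (he : σ[i]? = some e) (hf : σ[j]? = some f) :
    (code nt nv nl σ).th i = (code nt nv nl σ).th j ↔ e.thread = f.thread := by
  rw [code_th nt nv nl he, code_th nt nv nl hf]
  exact c.thr.injOn.eq_iff ⟨e, mem_of_pos he, rfl⟩ ⟨f, mem_of_pos hf, rfl⟩

theorem Coded.obj_eq_iff (c : Coded nt nv nl σ) (he : σ[i]? = some e) (hf : σ[j]? = some f) :
    (code nt nv nl σ).obj i = (code nt nv nl σ).obj j ↔ e.op.obj = f.op.obj := by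
  have h1 := c.target_lt (mem_of_pos he)
  have h2 := c.target_lt (mem_of_pos hf)
  have hvar : ∀ {e : Event Thr Var Lck} {x : Var}, e ∈ σ → e.op.obj = Sum.inl x → x ∈ vars σ := by
    intro e x he hx
    refine ⟨e, he, ?_⟩
    cases ho : e.op <;> simp_all [Op.obj]
  have hlck : ∀ {e : Event Thr Var Lck} {x : Lck}, e ∈ σ → e.op.obj = Sum.inr x → x ∈ locks σ := by
    intro e x he hx
    refine ⟨e, he, ?_⟩
    cases ho : e.op <;> simp_all [Op.obj]
  have hobj : ∀ {i : ℕ} {e : Event Thr Var Lck}, σ[i]? = some e → (code nt nv nl σ).obj i =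
      Sum.elim nv (fun l => nl l + (vars σ).ncard) e.op.obj := by
    intro i e he
    unfold NTrace.obj
    rw [code_kd nt nv nl he, code_tg nt nv nl he]
    change _ + (vars σ).ncard * _ = _
    cases e.op <;> simp [Op.kind, Op.target, Op.obj]
  have hrange : ∀ {e : Event Thr Var Lck}, e ∈ σ → ∀ x, e.op.obj = Sum.inl x →
      nv x < (vars σ).ncard := fun he x hx => c.var.mapsTo (hvar he hx)
  rw [hobj he, hobj hf]
  have m1 := mem_of_pos he
  have m2 := mem_of_pos hf
  cases hx : e.op.obj with
  | inl x =>
    cases hy : f.op.obj with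
    | inl y =>
      simp only [Sum.elim_inl, Sum.inl.injEq]
      exact c.var.injOn.eq_iff (hvar m1 hx) (hvar m2 hy)
    | inr y =>
      have := hrange m1 x hx
      simp only [Sum.elim_inl, Sum.elim_inr, reduceCtorEq, iff_false]; omega
  | inr x =>
    cases hy : f.op.obj with
    | inl y =>
      have := hrange m2 y hy
      simp only [Sum.elim_inl, Sum.elim_inr, reduceCtorEq, iff_false]; omega
    | inr y =>
      simp only [Sum.elim_inr, Sum.inr.injEq, add_left_inj]
      exact c.lck.injOn.eq_iff (hlck m1 hx) (hlck m2 hy)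

namespace NTrace

/-- `r` is the release matching the acquire `a` in `S` with respect to the order `key`. -/
def MatchIn (D : NTrace) (S : ℕ → Prop) (key : ℕ → ℕ) (a r : ℕ) : Prop :=
  S a ∧ S r ∧ D.kd a = 2 ∧ D.kd r = 3 ∧ D.obj a = D.obj r ∧ D.th a = D.th r ∧ key a < key r ∧
    ∀ f, S f → D.obj f = D.obj a → key a < key f → ¬ key f < key r

/-- `w` is the writer of the read `r` in `S` with respect to the order `key`. -/
def WriterIn (D : NTrace) (S : ℕ → Prop) (key : ℕ → ℕ) (w r : ℕ) : Prop :=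
  S w ∧ S r ∧ D.kd w = 1 ∧ D.kd r = 0 ∧ D.obj w = D.obj r ∧ key w < key r ∧
    ∀ f, S f → D.obj f = D.obj w → D.kd f = 1 → key w < key f → ¬ key f < key r

theorem matchIn_id {D : NTrace} {a r : ℕ} : D.MatchIn (· < D.N) id a r ↔ D.Match a r := by
  constructor
  · rintro ⟨_, h2, h3, h4, h5, h6, h7, h8⟩
    exact ⟨h7, h2, h3, h4, h5, h6, fun f h9 h10 h11 => h8 f (lt_trans h10 h2) h11 h9 h10⟩
  · rintro ⟨h1, h2, h3, h4, h5, h6, h7⟩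
    exact ⟨h1.trans h2, h2, h3, h4, h5, h6, h1, fun f _ h9 h10 h11 => h7 f h10 h11 h9⟩

theorem writerIn_id {D : NTrace} {a r : ℕ} : D.WriterIn (· < D.N) id a r ↔ D.Writer a r := by
  constructor
  · rintro ⟨_, h2, h3, h4, h5, h7, h8⟩
    exact ⟨h7, h2, h3, h4, h5, fun f h9 h10 h11 h12 => h8 f (lt_trans h10 h2) h11 h12 h9 h10⟩
  · rintro ⟨h1, h2, h3, h4, h5, h7⟩
    exact ⟨h1.trans h2, h2, h3, h4, h5, h1, fun f _ h9 h12 h10 h11 => h7 f h10 h11 h9 h12⟩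

end NTrace

theorem Rep.isMatch_iff {S : ℕ → Prop} {key : ℕ → ℕ} (c : Coded nt nv nl σ) (R : Rep σ ρ S key)
    (he : σ[i]? = some e) (hf : σ[j]? = some f) :
    IsMatch ρ e f ↔ (code nt nv nl σ).MatchIn S key i j := by
  have k1 := code_kd nt nv nl he
  have k2 := code_kd nt nv nl hf
  unfold IsMatch NTrace.MatchIn
  rw [c.obj_eq_iff he hf, c.th_eq_iff he hf, k1, k2, R.lt i j e f he hf]
  constructor
  · rintro ⟨l, h1, h2, h3, ⟨h4, h5, h6⟩, h7⟩
    rw [Op.eq_acq] at h1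
    rw [Op.eq_rel] at h2
    refine ⟨h4, h5, h1.1, h2.1, h1.2.trans h2.2.symm, h3, h6, fun k hk hx h8 h9 => h7 ?_⟩
    obtain ⟨g, hg⟩ := exists_at (R.lt_length k hk)
    rw [c.obj_eq_iff hg he] at hx
    exact ⟨g, Event.onLock_iff.2 (hx.trans h1.2), (R.lt i k e g he hg).2 ⟨h4, hk, h8⟩,
      (R.lt k j g f hg hf).2 ⟨hk, h5, h9⟩⟩
  · rintro ⟨h1, h2, h3, h4, h5, h6, h7, h8⟩
    obtain ⟨l, hl⟩ := Op.exists_inr h3.ge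
    refine ⟨l, Op.eq_acq.2 ⟨h3, hl⟩, Op.eq_rel.2 ⟨h4, h5.symm.trans hl⟩, h6, ⟨h1, h2, h7⟩, ?_⟩
    rintro ⟨g, hg, h9, h10⟩
    obtain ⟨k, hk⟩ : ∃ k : ℕ, σ[k]? = some g := by
      obtain ⟨_, _, _, _, hm⟩ := h9
      exact exists_pos (R.sub g (mem_of_pos hm))
    obtain ⟨-, hk', h11⟩ := (R.lt i k e g he hk).1 h9
    exact h8 k hk' ((c.obj_eq_iff hk he).2 ((Event.onLock_iff.1 hg).trans hl.symm)) h11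
      ((R.lt k j g f hk hf).1 h10).2.2

theorem Rep.isLastWrite_iff {S : ℕ → Prop} {key : ℕ → ℕ} (c : Coded nt nv nl σ)
    (R : Rep σ ρ S key) (he : σ[i]? = some e) (hf : σ[j]? = some f) :
    IsLastWrite ρ e f ↔ (code nt nv nl σ).WriterIn S key i j := by
  have k1 := code_kd nt nv nl he
  have k2 := code_kd nt nv nl hf
  unfold IsLastWrite NTrace.WriterIn
  rw [c.obj_eq_iff he hf, k1, k2, R.le i j e f he hf]
  constructor
  · rintro ⟨l, h2, h1, ⟨h4, h5, h6⟩, h7⟩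
    rw [Op.eq_write] at h1
    rw [Op.eq_read] at h2
    have hlt : key i < key j := by
      refine lt_of_le_of_ne h6 fun h => ?_
      have := R.inj i j h4 h5 h
      subst this
      rw [Option.some_injective _ (he.symm.trans hf)] at h1
      omega
    refine ⟨h4, h5, h1.1, h2.1, h1.2.trans h2.2.symm, hlt, fun k hk hx hw h8 h9 => h7 ?_⟩
    obtain ⟨g, hg⟩ := exists_at (R.lt_length k hk)
    rw [c.obj_eq_iff hg he] at hx
    rw [code_kd nt nv nl hg] at hw
    refine ⟨g, ?_, Op.eq_write.2 ⟨hw, hx.trans h1.2⟩, (R.le i k e g he hg).2 ⟨h4, hk, h8.le⟩,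
      (R.le k j g f hg hf).2 ⟨hk, h5, h9.le⟩⟩
    rintro rfl
    have := pos_unique c.wf.nodup he hg
    subst this
    omega
  · rintro ⟨h1, h2, h3, h4, h5, h7, h8⟩
    obtain ⟨l, hl⟩ := Op.exists_inl (o := e.op) (by omega)
    refine ⟨l, Op.eq_read.2 ⟨h4, h5.symm.trans hl⟩, Op.eq_write.2 ⟨h3, hl⟩, ⟨h1, h2, h7.le⟩, ?_⟩
    rintro ⟨g, hne, hg, h9, h10⟩
    obtain ⟨k, hk⟩ : ∃ k : ℕ, σ[k]? = some g := by
      obtain ⟨_, _, _, _, hm⟩ := h9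
      exact exists_pos (R.sub g (mem_of_pos hm))
    rw [Op.eq_write] at hg
    obtain ⟨-, hk', h11⟩ := (R.le i k e g he hk).1 h9
    have h12 := ((R.le k j g f hk hf).1 h10).2.2
    refine h8 k hk' ((c.obj_eq_iff hk he).2 (hg.2.trans hl.symm))
      ((code_kd nt nv nl hk).trans hg.1) (lt_of_le_of_ne h11 fun h => ?_)
      (lt_of_le_of_ne h12 fun h => ?_)
    · have := R.inj i k h1 hk' h
      subst this
      exact hne (Option.some_injective _ (hk.symm.trans he))
    · have := R.inj k j hk' h2 h
      subst this
      rw [Option.some_injective _ (hk.symm.trans hf)] at hg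
      omega

theorem Coded.match_iff (c : Coded nt nv nl σ) (he : σ[i]? = some e) (hf : σ[j]? = some f) :
    IsMatch σ e f ↔ (code nt nv nl σ).Match i j := by
  rw [(Rep.self c.wf.nodup).isMatch_iff c he hf]
  exact NTrace.matchIn_id

theorem Coded.writer_iff (c : Coded nt nv nl σ) (he : σ[i]? = some e) (hf : σ[j]? = some f) :
    IsLastWrite σ e f ↔ (code nt nv nl σ).Writer i j := by
  rw [(Rep.self c.wf.nodup).isLastWrite_iff c he hf]
  exact NTrace.writerIn_id

theorem Coded.traceLE_iff (c : Coded nt nv nl σ) (he : σ[i]? = some e) (hf : σ[j]? = some f) :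
    TraceLE σ e f ↔ i ≤ j := by
  rw [(Rep.self c.wf.nodup).le i j e f he hf]
  exact ⟨fun h => h.2.2, fun h => ⟨pos_lt he, pos_lt hf, h⟩⟩

theorem Coded.traceLT_iff (c : Coded nt nv nl σ) (he : σ[i]? = some e) (hf : σ[j]? = some f) :
    TraceLT σ e f ↔ i < j := by
  rw [(Rep.self c.wf.nodup).lt i j e f he hf]
  exact ⟨fun h => h.2.2, fun h => ⟨pos_lt he, pos_lt hf, h⟩⟩

theorem Coded.conflicting_iff (c : Coded nt nv nl σ) (he : σ[i]? = some e)
    (hf : σ[j]? = some f) : Conflicting e f ↔ (code nt nv nl σ).Conflict i j := by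
  unfold Conflicting NTrace.Conflict
  rw [c.obj_eq_iff he hf, code_kd nt nv nl he, code_kd nt nv nl hf]
  have hne : e ≠ f ↔ i ≠ j := by
    rw [not_iff_not]
    constructor
    · rintro rfl; exact pos_unique c.wf.nodup he hf
    · rintro rfl; exact Option.some_injective _ (he.symm.trans hf)
  rw [hne]
  refine and_congr_right fun _ => ?_
  constructor
  · rintro ⟨x, ⟨h1, h2⟩ | ⟨h1, h2⟩ | ⟨h1, h2⟩⟩ <;> rw [h1, h2] <;> simp [Op.obj, Op.kind]
  · rintro ⟨h1, h2, h3, h4⟩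
    obtain ⟨x, hx⟩ := Op.exists_inl h2
    have hx' := h1.symm.trans hx
    refine ⟨x, ?_⟩
    rw [Op.eq_write, Op.eq_write, Op.eq_read, Op.eq_read]
    simp only [hx, hx', and_true]
    omega

theorem Coded.valid (c : Coded nt nv nl σ) : (code nt nv nl σ).Valid := by
  have R := Rep.self c.wf.nodup
  constructor
  · intro i hi
    obtain ⟨e, he⟩ := exists_at hi
    rw [code_th nt nv nl he]
    exact c.thr.mapsTo ⟨e, mem_of_pos he, rfl⟩
  · intro i hi
    obtain ⟨e, he⟩ := exists_at hi
    rw [code_kd nt nv nl he]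
    exact e.op.kind_lt
  · intro i hi
    obtain ⟨e, he⟩ := exists_at hi
    rw [code_kd nt nv nl he, code_tg nt nv nl he]
    exact (c.target_lt (mem_of_pos he)).1
  · intro i hi
    obtain ⟨e, he⟩ := exists_at hi
    rw [code_kd nt nv nl he, code_tg nt nv nl he]
    exact (c.target_lt (mem_of_pos he)).2
  · exact ncard_threads_le
  · exact ncard_vars_le
  · exact ncard_locks_le
  · intro r hr hk
    obtain ⟨e, he⟩ := exists_at hr
    rw [code_kd nt nv nl he] at hk
    obtain ⟨l, hl⟩ := Op.exists_inr (o := e.op) (by omega)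
    obtain ⟨f, hf, hm⟩ := c.wf.rel_matched e (mem_of_pos he) l (Op.eq_rel.2 ⟨hk, hl⟩)
    obtain ⟨a, ha⟩ := exists_pos hf
    exact ⟨a, (c.match_iff ha he).1 hm⟩
  · intro a b hab hb h1 h2 hx
    obtain ⟨e, he⟩ := exists_at (hab.trans hb)
    obtain ⟨f, hf⟩ := exists_at hb
    rw [code_kd nt nv nl he] at h1
    rw [code_kd nt nv nl hf] at h2
    rw [c.obj_eq_iff he hf] at hx
    obtain ⟨l, hl⟩ := Op.exists_inr (o := e.op) (by omega)
    obtain ⟨g, hg, h3, h4⟩ := c.wf.acq_exclusive e f l (Op.eq_acq.2 ⟨h1, hl⟩)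
      (Op.eq_acq.2 ⟨h2, hx.symm.trans hl⟩) ((c.traceLT_iff he hf).2 hab)
    obtain ⟨r, hr⟩ : ∃ k : ℕ, σ[k]? = some g := by
      obtain ⟨_, _, _, _, hm⟩ := h3
      exact exists_pos (mem_of_pos hm)
    rw [Op.eq_rel] at hg
    exact ⟨r, (c.traceLT_iff he hr).1 h3, (c.traceLT_iff hr hf).1 h4,
      (code_kd nt nv nl hr).trans hg.1, (c.obj_eq_iff hr he).2 (hg.2.trans hl.symm)⟩

theorem Rep.tlClosed_iff {S : ℕ → Prop} {key : ℕ → ℕ} (c : Coded nt nv nl σ)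
    (R : Rep σ ρ S key) : TLClosed σ (events ρ) ↔
      (∀ i j, S j → i < j → (code nt nv nl σ).th i = (code nt nv nl σ).th j → S i) ∧
      (∀ w r, S r → (code nt nv nl σ).Writer w r → S w) := by
  constructor
  · intro h
    constructor
    · intro i j hj hij ht
      obtain ⟨f, hf⟩ := exists_at (R.lt_length j hj)
      obtain ⟨e, he⟩ := exists_at (hij.trans (R.lt_length j hj))
      exact (R.mem i e he).1 (h.thread e f ⟨(c.th_eq_iff he hf).1 ht,
        (c.traceLE_iff he hf).2 hij.le⟩ ((R.mem j f hf).2 hj))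
    · intro i j hj hw
      obtain ⟨f, hf⟩ := exists_at (R.lt_length j hj)
      obtain ⟨e, he⟩ := exists_at (hw.lt.trans (R.lt_length j hj))
      exact (R.mem i e he).1 (h.lastWrite e f ((c.writer_iff he hf).2 hw) ((R.mem j f hf).2 hj))
  · rintro ⟨h1, h2⟩
    refine ⟨R.sub, ?_, ?_⟩
    · rintro e f ⟨ht, hle⟩ hfρ
      obtain ⟨j, hf⟩ := exists_pos (R.sub f hfρ)
      obtain ⟨i, he⟩ : ∃ k : ℕ, σ[k]? = some e := by
        obtain ⟨i, _, _, hm, _⟩ := hle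
        exact ⟨i, hm⟩
      have hj := (R.mem j f hf).1 hfρ
      refine (R.mem i e he).2 ?_
      rcases ((c.traceLE_iff he hf).1 hle).lt_or_eq with h | rfl
      · exact h1 i j hj h ((c.th_eq_iff he hf).2 ht)
      · exact hj
    · intro e f hw hfρ
      obtain ⟨j, hf⟩ := exists_pos (R.sub f hfρ)
      obtain ⟨i, he⟩ : ∃ k : ℕ, σ[k]? = some e := by
        obtain ⟨_, _, _, ⟨i, _, _, hm, _⟩, _⟩ := hw
        exact ⟨i, hm⟩
      exact (R.mem i e he).2 (h2 i j ((R.mem j f hf).1 hfρ) ((c.writer_iff he hf).1 hw))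

theorem NTrace.Cl.le {D : NTrace} {r i : ℕ} (h : D.Cl r i) : i ≤ r := by
  induction h with
  | refl => exact le_rfl
  | thread i j _ hij _ ih => omega
  | writer w j _ hw ih => have := hw.lt; omega

theorem Coded.mem_closure_iff (c : Coded nt nv nl σ) (he : σ[i]? = some e)
    (hf : σ[j]? = some f) : e ∈ TLClosure σ {f} ↔ (code nt nv nl σ).Cl j i := by
  have R := Rep.self c.wf.nodup
  constructor
  · intro h
    have hN : ∀ i, (code nt nv nl σ).Cl j i → i < σ.length := fun i hi => hi.le.trans_lt (pos_lt hf)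
    obtain ⟨ρ, -, R'⟩ := Rep.exists_of_key c.wf.nodup (key := id) hN (fun i j _ _ h => h)
    have := Set.mem_sInter.1 h (events ρ) ⟨?_, ?_⟩
    · exact (R'.mem i e he).1 this
    · rw [Set.singleton_subset_iff]
      exact (R'.mem j f hf).2 NTrace.Cl.refl
    · exact (R'.tlClosed_iff c).2 ⟨fun i j hj hij ht => NTrace.Cl.thread i j hj hij ht,
        fun w r hr hw => NTrace.Cl.writer w r hr hw⟩
  · intro h
    refine Set.mem_sInter.2 ?_
    rintro S' ⟨h1, h2⟩
    rw [Set.singleton_subset_iff] at h1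
    induction h generalizing e with
    | refl => rwa [Option.some_injective _ (he.symm.trans hf)]
    | thread i k hk hik ht ih =>
      obtain ⟨g, hg⟩ := exists_at (hk.le.trans_lt (pos_lt hf))
      exact h2.thread e g ⟨(c.th_eq_iff he hg).1 ht, (c.traceLE_iff he hg).2 hik.le⟩ (ih hg)
    | writer i k hk hw ih =>
      obtain ⟨g, hg⟩ := exists_at (hk.le.trans_lt (pos_lt hf))
      exact h2.lastWrite e g ((c.writer_iff he hg).2 hw) (ih hg)

end Translation

end Coding

section Races

variable {Thr Var Lck : Type} {nt : Thr → ℕ} {nv : Var → ℕ} {nl : Lck → ℕ}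
  {σ ρ : Trace Thr Var Lck} {p q : ℕ} {e f : Event Thr Var Lck}

theorem Rep.witness {S : ℕ → Prop} {key : ℕ → ℕ} (c : Coded nt nv nl σ) (R : Rep σ ρ S key)
    (hp : σ[p]? = some e) (hq : σ[q]? = some f) (ho : OptReordering σ ρ)
    (hc : OptLockClosed σ e f (events ρ)) (h1 : Enabled σ ρ e) (h2 : Enabled σ ρ f) :
    (code nt nv nl σ).Witness p q S key := by
  have hcl := (R.tlClosed_iff c).1 hc.closed
  have at_S : ∀ {i}, S i → ∃ e, σ[i]? = some e ∧ e ∈ ρ := fun {i} hi => by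
    obtain ⟨e, he⟩ := exists_at (R.lt_length i hi)
    exact ⟨e, he, (R.mem i e he).2 hi⟩
  constructor
  case lt_N => exact R.lt_length
  case inj => exact R.inj
  case rel_matched =>
    intro r hr hk
    obtain ⟨g, hg, hgρ⟩ := at_S hr
    rw [code_kd nt nv nl hg] at hk
    obtain ⟨l, hl⟩ := Op.exists_inr (o := g.op) (by omega)
    obtain ⟨h, hhρ, hm⟩ := ho.correct.wellFormed.rel_matched g hgρ l (Op.eq_rel.2 ⟨hk, hl⟩)
    obtain ⟨a, ha⟩ := exists_pos (R.sub h hhρ)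
    obtain ⟨m1, _, m2, _, m3, m4, m5, m6⟩ := (R.isMatch_iff c ha hg).1 hm
    exact ⟨a, m1, m2, m3, m4, m5, m6⟩
  case acq_exclusive =>
    intro a b ha hb h1 h2 hx hlt
    obtain ⟨g, hg, hgρ⟩ := at_S ha
    obtain ⟨h, hh, hhρ⟩ := at_S hb
    rw [code_kd nt nv nl hg] at h1
    rw [code_kd nt nv nl hh] at h2
    rw [c.obj_eq_iff hg hh] at hx
    obtain ⟨l, hl⟩ := Op.exists_inr (o := g.op) (by omega)
    obtain ⟨k, hk, h3, h4⟩ := ho.correct.wellFormed.acq_exclusive g h l (Op.eq_acq.2 ⟨h1, hl⟩)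
      (Op.eq_acq.2 ⟨h2, hx.symm.trans hl⟩) ((R.lt a b g h hg hh).2 ⟨ha, hb, hlt⟩)
    obtain ⟨r, hr⟩ : ∃ i : ℕ, σ[i]? = some k := by
      obtain ⟨_, _, _, _, hm⟩ := h3
      exact exists_pos (R.sub k (mem_of_pos hm))
    rw [Op.eq_rel] at hk
    obtain ⟨_, hrS, h5⟩ := (R.lt a r g k hg hr).1 h3
    exact ⟨r, hrS, (code_kd nt nv nl hr).trans hk.1, (c.obj_eq_iff hr hg).2 (hk.2.trans hl.symm),
      h5, ((R.lt r b k h hr hh).1 h4).2.2⟩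
  case thread_closed => exact hcl.1
  case writer_closed => exact hcl.2
  case thread_key =>
    intro i j hj hij ht
    obtain ⟨g, hg, hgρ⟩ := at_S (hcl.1 i j hj hij ht)
    obtain ⟨h, hh, hhρ⟩ := at_S hj
    have := (ho.correct.thread g hgρ h hhρ ⟨(c.th_eq_iff hg hh).1 ht,
      (c.traceLE_iff hg hh).2 hij.le⟩).2
    obtain ⟨h1, h2, h3⟩ := (R.le i j g h hg hh).1 this
    exact lt_of_le_of_ne h3 fun h4 => hij.ne (R.inj i j h1 h2 h4)
  case writer_key =>
    intro w r hr hw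
    obtain ⟨g, hg, hgρ⟩ := at_S (hcl.2 w r hr hw)
    obtain ⟨h, hh, hhρ⟩ := at_S hr
    have := ho.correct.lastWrite g hgρ h hhρ ((c.writer_iff hg hh).2 hw)
    obtain ⟨_, _, _, _, _, h3, h4⟩ := (R.isLastWrite_iff c hg hh).1 this
    exact ⟨h3, h4⟩
  case conflict =>
    intro i j hi hj hcf
    obtain ⟨g, hg, hgρ⟩ := at_S hi
    obtain ⟨h, hh, hhρ⟩ := at_S hj
    have := ho.conflict g hgρ h hhρ ((c.conflicting_iff hg hh).2 hcf)
    rw [R.le i j g h hg hh, c.traceLE_iff hg hh] at this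
    have hne : key i ≠ key j := fun h => hcf.1 (R.inj i j hi hj h)
    have hne' := hcf.1
    constructor
    · intro h; have := this.1 ⟨hi, hj, h.le⟩; omega
    · intro h; have := (this.2 h.le).2.2; omega
  case lock =>
    intro a b r s hab hx hr hs hrS hsS
    have haS := hcl.1 a r hrS hr.lt hr.th_eq
    have hbS := hcl.1 b s hsS hs.lt hs.th_eq
    obtain ⟨g, hg, hgρ⟩ := at_S haS
    obtain ⟨h, hh, hhρ⟩ := at_S hbS
    obtain ⟨g', hg', hgρ'⟩ := at_S hrS
    obtain ⟨h', hh', hhρ'⟩ := at_S hsS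
    have k1 := hr.kd_acq
    have k2 := hs.kd_acq
    rw [code_kd nt nv nl hg] at k1
    rw [code_kd nt nv nl hh] at k2
    rw [c.obj_eq_iff hg hh] at hx
    obtain ⟨l, hl⟩ := Op.exists_inr (o := g.op) (by omega)
    have := ho.lock l g h g' h' (by rintro rfl; exact hab (pos_unique c.wf.nodup hg hh))
      (Op.eq_acq.2 ⟨k1, hl⟩) (Op.eq_acq.2 ⟨k2, hx.symm.trans hl⟩) ((c.match_iff hg hg').2 hr)
      ((c.match_iff hh hh').2 hs) hgρ' hhρ'
    rw [R.le a b g h hg hh, c.traceLE_iff hg hh] at this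
    have hne : key a ≠ key b := fun h => hab (R.inj a b haS hbS h)
    constructor
    · intro h; have := this.1 ⟨haS, hbS, h.le⟩; omega
    · intro h; have := (this.2 h.le).2.2; omega
  case not_left => exact fun h => hc.not_mem_left ((R.mem p e hp).2 h)
  case not_right => exact fun h => hc.not_mem_right ((R.mem q f hq).2 h)
  case left =>
    intro i hi ht
    obtain ⟨g, hg⟩ := exists_at (hi.trans (pos_lt hp))
    refine (R.mem i g hg).1 (h1.2 g (mem_of_pos hg) ?_
      ⟨(c.th_eq_iff hg hp).1 ht, (c.traceLE_iff hg hp).2 hi.le⟩)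
    rintro rfl
    exact hi.ne (pos_unique c.wf.nodup hg hp)
  case right =>
    intro i hi ht
    obtain ⟨g, hg⟩ := exists_at (hi.trans (pos_lt hq))
    refine (R.mem i g hg).1 (h2.2 g (mem_of_pos hg) ?_
      ⟨(c.th_eq_iff hg hq).1 ht, (c.traceLE_iff hg hq).2 hi.le⟩)
    rintro rfl
    exact hi.ne (pos_unique c.wf.nodup hg hq)
  case lock_closed =>
    intro a r ha hm hn1 hn2
    obtain ⟨g, hg, hgρ⟩ := at_S ha
    obtain ⟨h, hh⟩ := exists_at hm.lt_N
    refine (R.mem r h hh).1 (hc.lock g h hgρ ((c.match_iff hg hh).2 hm) ?_ ?_)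
    · rwa [c.mem_closure_iff hp hh]
    · rwa [c.mem_closure_iff hq hh]

theorem Rep.optReordering {S : ℕ → Prop} {key : ℕ → ℕ} (c : Coded nt nv nl σ) (hρ : ρ.Nodup)
    (R : Rep σ ρ S key) (w : (code nt nv nl σ).Witness p q S key) : OptReordering σ ρ := by
  have at_ρ : ∀ {e}, e ∈ ρ → ∃ i : ℕ, σ[i]? = some e ∧ S i := fun {e} he => by
    obtain ⟨i, hi⟩ := exists_pos (R.sub e he)
    exact ⟨i, hi, (R.mem i e hi).1 he⟩
  refine ⟨⟨⟨?_, ?_, ?_⟩, (R.tlClosed_iff c).2 ⟨w.thread_closed, w.writer_closed⟩, ?_, ?_⟩, ?_, ?_⟩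
  · refine List.Nodup.map_on ?_ hρ
    intro x hx y hy hxy
    exact List.inj_on_of_nodup_map c.wf.nodup_ids (R.sub x hx) (R.sub y hy) hxy
  · intro g hg l hl
    obtain ⟨r, hr, hrS⟩ := at_ρ hg
    rw [Op.eq_rel] at hl
    obtain ⟨a, h1, h2, h3, h4, h5, h6⟩ := w.rel_matched r hrS ((code_kd nt nv nl hr).trans hl.1)
    obtain ⟨k, hk⟩ := exists_at (R.lt_length a h1)
    exact ⟨k, (R.mem a k hk).2 h1, (R.isMatch_iff c hk hr).2
      ⟨h1, hrS, h2, (code_kd nt nv nl hr).trans hl.1, h3, h4, h5, h6⟩⟩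
  · intro g h l hg hh hlt
    obtain ⟨a, ha, haS⟩ : ∃ i : ℕ, σ[i]? = some g ∧ S i := by
      obtain ⟨_, _, _, hm, _⟩ := hlt
      exact at_ρ (mem_of_pos hm)
    obtain ⟨b, hb, hbS⟩ : ∃ i : ℕ, σ[i]? = some h ∧ S i := by
      obtain ⟨_, _, _, _, hm⟩ := hlt
      exact at_ρ (mem_of_pos hm)
    rw [Op.eq_acq] at hg hh
    obtain ⟨r, h1, h2, h3, h4, h5⟩ := w.acq_exclusive a b haS hbS
      ((code_kd nt nv nl ha).trans hg.1) ((code_kd nt nv nl hb).trans hh.1)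
      ((c.obj_eq_iff ha hb).2 (hg.2.trans hh.2.symm)) ((R.lt a b g h ha hb).1 hlt).2.2
    obtain ⟨k, hk⟩ := exists_at (R.lt_length r h1)
    exact ⟨k, Op.eq_rel.2 ⟨(code_kd nt nv nl hk).symm.trans h2,
      ((c.obj_eq_iff hk ha).1 h3).trans hg.2⟩, (R.lt a r g k ha hk).2 ⟨haS, h1, h4⟩,
      (R.lt r b k h hk hb).2 ⟨h1, hbS, h5⟩⟩
  · rintro g hg h hh ⟨ht, hle⟩
    obtain ⟨i, hi, hiS⟩ := at_ρ hg
    obtain ⟨j, hj, hjS⟩ := at_ρ hh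
    refine ⟨ht, (R.le i j g h hi hj).2 ⟨hiS, hjS, ?_⟩⟩
    rcases ((c.traceLE_iff hi hj).1 hle).lt_or_eq with h1 | rfl
    · exact (w.thread_key i j hjS h1 ((c.th_eq_iff hi hj).2 ht)).le
    · exact le_rfl
  · intro g hg h hh hw
    obtain ⟨i, hi, hiS⟩ := at_ρ hg
    obtain ⟨j, hj, hjS⟩ := at_ρ hh
    have hw' := (c.writer_iff hi hj).1 hw
    obtain ⟨h1, h2⟩ := w.writer_key i j hjS hw'
    exact (R.isLastWrite_iff c hi hj).2 ⟨hiS, hjS, hw'.kd_write, hw'.kd_read, hw'.obj_eq, h1, h2⟩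
  · intro g hg h hh hcf
    obtain ⟨i, hi, hiS⟩ := at_ρ hg
    obtain ⟨j, hj, hjS⟩ := at_ρ hh
    have hcf' := (c.conflicting_iff hi hj).1 hcf
    have h1 := w.conflict i j hiS hjS hcf'
    have hne : key i ≠ key j := fun h => hcf'.1 (R.inj i j hiS hjS h)
    have hne' := hcf'.1
    rw [R.le i j g h hi hj, c.traceLE_iff hi hj]
    constructor
    · rintro ⟨_, _, h⟩; omega
    · intro h; exact ⟨hiS, hjS, by omega⟩
  · intro l g h g' h' hne hg hh hm hm' hgρ' hhρ'
    obtain ⟨r, hr, hrS⟩ := at_ρ hgρ'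
    obtain ⟨s, hs, hsS⟩ := at_ρ hhρ'
    obtain ⟨a, ha⟩ : ∃ i : ℕ, σ[i]? = some g := by
      obtain ⟨_, _, _, _, ⟨i, _, _, hm, _⟩, _⟩ := hm
      exact ⟨i, hm⟩
    obtain ⟨b, hb⟩ : ∃ i : ℕ, σ[i]? = some h := by
      obtain ⟨_, _, _, _, ⟨i, _, _, hm, _⟩, _⟩ := hm'
      exact ⟨i, hm⟩
    rw [c.match_iff ha hr] at hm
    rw [c.match_iff hb hs] at hm'
    rw [Op.eq_acq] at hg hh
    have haS := w.thread_closed a r hrS hm.lt hm.th_eq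
    have hbS := w.thread_closed b s hsS hm'.lt hm'.th_eq
    have hab : a ≠ b := by
      rintro rfl; exact hne (Option.some_injective _ (ha.symm.trans hb))
    have h1 := w.lock a b r s hab ((c.obj_eq_iff ha hb).2 (hg.2.trans hh.2.symm)) hm hm' hrS hsS
    have hne : key a ≠ key b := fun h => hab (R.inj a b haS hbS h)
    rw [R.le a b g h ha hb, c.traceLE_iff ha hb]
    constructor
    · rintro ⟨_, _, h⟩; omega
    · intro h; exact ⟨haS, hbS, by omega⟩

theorem Rep.enabled {S : ℕ → Prop} {key : ℕ → ℕ} (c : Coded nt nv nl σ) (R : Rep σ ρ S key)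
    (hp : σ[p]? = some e) (h1 : ¬ S p)
    (h2 : ∀ i, i < p → (code nt nv nl σ).th i = (code nt nv nl σ).th p → S i) :
    Enabled σ ρ e := by
  refine ⟨fun h => h1 ((R.mem p e hp).1 h), ?_⟩
  rintro g hg hne ⟨ht, hle⟩
  obtain ⟨i, hi⟩ := exists_pos hg
  rcases ((c.traceLE_iff hi hp).1 hle).lt_or_eq with h | rfl
  · exact (R.mem i g hi).2 (h2 i h ((c.th_eq_iff hi hp).2 ht))
  · exact absurd (Option.some_injective _ (hi.symm.trans hp)) hne

theorem IsPrev.mem_of_enabled (h1 : Enabled σ ρ e) (h : IsPrev σ f e) : f ∈ ρ := by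
  obtain ⟨hne, hle, -⟩ := h
  have hf : f ∈ σ := by
    obtain ⟨_, _, _, _, hm, _⟩ := hle
    exact mem_of_pos hm
  exact h1.2 f hf hne hle

/-- Races in terms of positions. -/
theorem Coded.isOSRRace_iff (c : Coded nt nv nl σ) (hp : σ[p]? = some e) (hq : σ[q]? = some f) :
    IsOSRRace σ e f ↔ (code nt nv nl σ).Conflict p q ∧ (code nt nv nl σ).Good p q := by
  rw [← c.valid.exists_witness_iff (pos_lt hp) (pos_lt hq)]
  constructor
  · rintro ⟨_, _, h1, ρ, h2, h3, h4, h5⟩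
    obtain ⟨S, key, R⟩ := Rep.exists_of_nodup c.wf.nodup h2.correct.wellFormed.nodup
      h2.correct.closed.subset
    exact ⟨(c.conflicting_iff hp hq).1 h1, S, key, R.witness c hp hq h2 h3 h4 h5⟩
  · rintro ⟨h1, S, key, w⟩
    obtain ⟨ρ, hρ, R⟩ := Rep.exists_of_key c.wf.nodup w.lt_N w.inj
    have e1 := R.enabled c hp w.not_left w.left
    have e2 := R.enabled c hq w.not_right w.right
    refine ⟨mem_of_pos hp, mem_of_pos hq, (c.conflicting_iff hp hq).2 h1, ρ,
      R.optReordering c hρ w, ⟨e1.1, e2.1, fun g h => h.mem_of_enabled e1,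
        fun g h => h.mem_of_enabled e2, (R.tlClosed_iff c).2 ⟨w.thread_closed, w.writer_closed⟩,
        ?_⟩, e1, e2⟩
    intro g h hg hm hn1 hn2
    obtain ⟨a, ha⟩ := exists_pos (R.sub g hg)
    obtain ⟨r, hr⟩ : ∃ i : ℕ, σ[i]? = some h := by
      obtain ⟨_, _, _, _, ⟨_, i, _, _, hm⟩, _⟩ := hm
      exact ⟨i, hm⟩
    rw [c.mem_closure_iff hp hr] at hn1
    rw [c.mem_closure_iff hq hr] at hn2
    exact (R.mem r h hr).2 (w.lock_closed a r ((R.mem a g ha).1 hg) ((c.match_iff ha hr).1 hm)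
      hn1 hn2)

end Races

/-! ### Reasoning about programs -/

section SimpLemmas

variable (K : ℕ) (s : State) (x y : Expr)

@[simp] theorem Expr.small_lit (n : ℕ) : (Expr.lit n).small = true := id rfl
@[simp] theorem Expr.small_reg (i : ℕ) : (Expr.reg i).small = true := id rfl
@[simp] theorem Expr.small_get (a : ℕ) : (Expr.get a x).small = true := id rfl
@[simp] theorem Expr.small_add : (x + y).small = false := id rfl
@[simp] theorem Expr.small_sub : (x - y).small = x.small := id rfl
@[simp] theorem Expr.small_mul : (x * y).small = false := id rfl

@[simp] theorem Cmd.run_append (p q : Cmd) : (p ++ q).run K s = q.run K (p.run K s) := rfl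
@[simp] theorem Cmd.run_skip : Cmd.skip.run K s = s := rfl
@[simp] theorem Cmd.run_set (i : ℕ) : (Cmd.set i x).run K s =
    s.setReg i (bif x.small then x.eval s else min (x.eval s) K) := rfl
@[simp] theorem Cmd.run_put (a : ℕ) : (Cmd.put a y x).run K s =
    s.setArr a (y.eval s) (bif x.small then x.eval s else min (x.eval s) K) := rfl
@[simp] theorem Cmd.run_ite (p q : Cmd) : (Cmd.ite x p q).run K s =
    if x.eval s = 0 then q.run K s else p.run K s := rfl

end SimpLemmas

@[simp] theorem State.setReg_self (s : State) (i : ℕ) : s.setReg i (s.reg i) = s := by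
  simp [State.setReg]

@[simp] theorem State.setArr_self (s : State) (a i : ℕ) : s.setArr a i (s.arr a i) = s := by
  simp [State.setArr]

/-- Replace the content of a register by `x`, if this is larger. -/
def Cmd.raise (i : ℕ) (x : Expr) : Cmd := Cmd.ite (Expr.lt (Expr.reg i) x) (Cmd.set i x) Cmd.skip

/-- Replace an array entry by `x`, if this is larger. -/
def Cmd.raiseAt (a : ℕ) (ix x : Expr) : Cmd :=
  Cmd.ite (Expr.lt (Expr.get a ix) x) (Cmd.put a ix x) Cmd.skip

@[simp] theorem Cmd.run_raise (K : ℕ) (s : State) (i : ℕ) (x : Expr) (h : x.small = true) :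
    (Cmd.raise i x).run K s = s.setReg i (max (s.reg i) (x.eval s)) := by
  simp only [Cmd.raise, Cmd.run_ite, Expr.eval_lt, Expr.eval_reg, Cmd.run_set, h, cond_true,
    Cmd.run_skip]
  split_ifs with h
  · rw [max_eq_right (by omega)]
  · rw [max_eq_left (by omega), State.setReg_self]

@[simp] theorem Cmd.run_raiseAt (K : ℕ) (s : State) (a : ℕ) (ix x : Expr) (h : x.small = true) :
    (Cmd.raiseAt a ix x).run K s =
      s.setArr a (ix.eval s) (max (s.arr a (ix.eval s)) (x.eval s)) := by
  simp only [Cmd.raiseAt, Cmd.run_ite, Expr.eval_lt, Expr.eval_get, Cmd.run_put, h, cond_true,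
    Cmd.run_skip]
  split_ifs with h
  · rw [max_eq_right (by omega)]
  · rw [max_eq_left (by omega), State.setArr_self]

/-- The constant part of the memory. -/
structure Input (D : NTrace) (p t : ℕ) (s : State) : Prop where
  N : s.reg 0 = D.N
  T : s.reg 1 = D.T
  V : s.reg 2 = D.V
  L : s.reg 3 = D.L
  p : s.reg 4 = p
  t : s.reg 5 = t
  th : s.arr 0 = D.th
  kd : s.arr 1 = D.kd
  tg : s.arr 2 = D.tg

theorem Input.congr {D : NTrace} {p t : ℕ} {s s' : State} (h : Input D p t s)
    (hr : ∀ r < 7, s'.reg r = s.reg r) (ha : ∀ a < 3, s'.arr a = s.arr a) : Input D p t s' where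
  N := (hr 0 (by omega)).trans h.N
  T := (hr 1 (by omega)).trans h.T
  V := (hr 2 (by omega)).trans h.V
  L := (hr 3 (by omega)).trans h.L
  p := (hr 4 (by omega)).trans h.p
  t := (hr 5 (by omega)).trans h.t
  th := (ha 0 (by omega)).trans h.th
  kd := (ha 1 (by omega)).trans h.kd
  tg := (ha 2 (by omega)).trans h.tg

/-- A program that leaves the input alone. -/
def Cmd.keepsInput (c : Cmd) : Bool := c.regs.all (7 ≤ ·) && c.arrs.all (3 ≤ ·)

theorem Input.run {D : NTrace} {p t : ℕ} {s : State} (h : Input D p t s) {c : Cmd}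
    (hc : c.keepsInput = true) (K : ℕ) : Input D p t (c.run K s) := by
  simp only [Cmd.keepsInput, Bool.and_eq_true, List.all_eq_true, decide_eq_true_eq] at hc
  exact h.congr (fun r hr => c.run_reg s r fun hm => by have := hc.1 r hm; omega)
    (fun a ha => c.run_arr s a fun hm => by have := hc.2 a hm; omega)

/-- `run_loop_induction` for a program that leaves the input alone. -/
theorem Cmd.run_loop_input {D : NTrace} {p t K : ℕ} {s : State} (h : Input D p t s) (i n : ℕ)
    (c : Cmd) (hc : (Cmd.loop i n c).keepsInput = true) (I : ℕ → State → Prop)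
    (h0 : I 0 (s.setReg i 0))
    (hstep : ∀ j st, j < s.reg n → st.reg i = j → Input D p t st →
      (∀ r ∉ i :: c.regs, st.reg r = s.reg r) → (∀ a ∉ c.arrs, st.arr a = s.arr a) → I j st →
      I (j + 1) ((c.run K st).setReg i (j + 1))) :
    I (s.reg n) ((Cmd.loop i n c).run K s) := by
  simp only [Cmd.keepsInput, Cmd.regs, Cmd.arrs, Bool.and_eq_true, List.all_eq_true,
    decide_eq_true_eq] at hc
  refine Cmd.run_loop_induction i n c s I h0 fun j st h1 h2 h3 h4 h5 => hstep j st h1 h2 ?_ h3 h4 h5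
  exact h.congr (fun r hr => h3 r fun hm => by have := hc.1 r hm; omega)
    (fun a ha => h4 a fun hm => by have := hc.2 a hm; omega)

theorem pair_inj {N a b c d : ℕ} (hb : b < N) (hd : d < N) (h : a * N + b = c * N + d) :
    a = c ∧ b = d := by
  have h1 := congrArg (· / N) h
  have h2 := congrArg (· % N) h
  have hN : 0 < N := by omega
  rw [mul_comm a, mul_comm c] at h1 h2
  simp only [Nat.mul_add_div hN, Nat.div_eq_of_lt hb, Nat.div_eq_of_lt hd, Nat.mul_add_mod,
    Nat.mod_eq_of_lt hb, Nat.mod_eq_of_lt hd] at h1 h2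
  omega

namespace NTrace

variable (D : NTrace)

/-- The number of events of thread `v`. -/
def cnt (v : ℕ) : ℕ := Nat.count (fun j => D.th j = v) D.N

/-- The position of an event in its thread. -/
def idx (i : ℕ) : ℕ := Nat.count (fun j => D.th j = D.th i) i

variable {D}

theorem cnt_le (v : ℕ) : D.cnt v ≤ D.N := Nat.count_le _

theorem idx_lt_cnt {i : ℕ} (h : i < D.N) : D.idx i < D.cnt (D.th i) :=
  Nat.count_strict_mono (p := fun j => D.th j = D.th i) rfl h

theorem idx_lt {i : ℕ} (h : i < D.N) : D.idx i < D.N := (idx_lt_cnt h).trans_le (cnt_le _)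

theorem idx_lt_idx {i j : ℕ} (ht : D.th i = D.th j) : D.idx i < D.idx j ↔ i < j := by
  have aux : ∀ {i j}, D.th i = D.th j → i < j → D.idx i < D.idx j := by
    intro i j ht h
    unfold idx
    rw [← ht]
    exact Nat.count_strict_mono (p := fun k => D.th k = D.th i) rfl h
  refine ⟨fun h => ?_, aux ht⟩
  by_contra hle
  rcases (not_lt.1 hle).lt_or_eq with h1 | rfl
  · have := aux ht.symm h1; omega
  · omega

theorem idx_inj {i j : ℕ} (ht : D.th i = D.th j) (h : D.idx i = D.idx j) : i = j := by
  have h1 := idx_lt_idx ht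
  have h2 := idx_lt_idx ht.symm
  omega

theorem exists_idx {v k : ℕ} (h : k < D.cnt v) : ∃ i < D.N, D.th i = v ∧ D.idx i = k := by
  have hN : ∀ m, k < Nat.count (fun j => D.th j = v) m → ∃ i < m, D.th i = v ∧ D.idx i = k := by
    intro m
    induction m with
    | zero => intro h; simp at h
    | succ m ih =>
      intro h
      by_cases hk : k < Nat.count (fun j => D.th j = v) m
      · obtain ⟨i, hi, h1⟩ := ih hk
        exact ⟨i, by omega, h1⟩
      · rw [Nat.count_succ] at h
        by_cases hv : D.th m = v
        · refine ⟨m, by omega, hv, ?_⟩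
          rw [if_pos hv] at h
          unfold idx
          rw [hv]
          omega
        · rw [if_neg hv] at h; omega
  exact hN D.N h

end NTrace

open _root_.OSR.Expr _root_.OSR.Cmd

/-! ### Positions in threads -/

/-- Compute the position of each event in its thread (array `3`), the number of events of each
thread (array `4`), and the table of the events of each thread (array `5`). -/
def indexCmd : Cmd :=
  loop 7 0 (
    put 3 (reg 7) (get 4 (get 0 (reg 7))) ++
    put 5 (get 0 (reg 7) * reg 0 + get 4 (get 0 (reg 7))) (reg 7) ++
    put 4 (get 0 (reg 7)) (get 4 (get 0 (reg 7)) + lit 1))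

structure IndexSpec (D : NTrace) (s : State) : Prop where
  idx : ∀ i < D.N, s.arr 3 i = D.idx i
  cnt : ∀ v, s.arr 4 v = D.cnt v
  ev : ∀ i < D.N, s.arr 5 (D.th i * D.N + D.idx i) = i

theorem indexCmd_spec {D : NTrace} {p t K : ℕ} {s : State} (hs : Input D p t s) (hK : D.N ≤ K)
    (h4 : ∀ i, s.arr 4 i = 0) : IndexSpec D (indexCmd.run K s) := by
  have key := Cmd.run_loop_input (K := K) hs 7 0 _ (by rfl : indexCmd.keepsInput = true)
    (fun j st => (∀ i < j, st.arr 3 i = D.idx i) ∧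
      (∀ v, st.arr 4 v = Nat.count (fun i => D.th i = v) j) ∧
      (∀ i < j, st.arr 5 (D.th i * D.N + D.idx i) = i)) (by simp [h4]) ?_
  · rw [hs.N] at key
    exact ⟨key.1, key.2.1, key.2.2⟩
  · rintro j st hj h7 hst - - ⟨a1, a2, a3⟩
    rw [hs.N] at hj
    have hle : Nat.count (fun i => D.th i = D.th j) j < D.N := (Nat.count_le _).trans_lt hj
    simp [hst.th, hst.N, h7, a2, Function.update_apply]
    refine ⟨?_, ?_, ?_⟩
    · intro i hi
      split_ifs with h
      · subst h; rfl
      · exact a1 i (by omega)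
    · intro v
      rw [Nat.count_succ]
      split_ifs with h h' h'
      · subst h; omega
      · exact absurd h.symm h'
      · exact absurd h'.symm h
      · rfl
    · intro i hi
      split_ifs with h
      · have := pair_inj (NTrace.idx_lt (by omega)) hle h
        exact (NTrace.idx_inj this.1.symm this.2.symm)
      · refine a3 i ?_
        rcases hi.lt_or_eq with h1 | rfl
        · exact h1
        · exact absurd rfl h

/-! ### Writers and matching releases -/

/-- One more than the last position before `i` where `P` holds, or zero. -/
def lastBefore (P : ℕ → Prop) [DecidablePred P] : ℕ → ℕ
  | 0 => 0
  | i + 1 => if P i then i + 1 else lastBefore P i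

section LastBefore

variable {P : ℕ → Prop} [DecidablePred P] {i w : ℕ}

theorem lastBefore_eq_succ :
    lastBefore P i = w + 1 ↔ w < i ∧ P w ∧ ∀ j, w < j → j < i → ¬ P j := by
  induction i with
  | zero => simp [lastBefore]
  | succ i ih =>
    simp only [lastBefore]
    split_ifs with h
    · constructor
      · intro he
        obtain rfl : i = w := by omega
        exact ⟨by omega, h, fun j h1 h2 => by omega⟩
      · rintro ⟨h1, h2, h3⟩
        by_contra hne
        exact h3 i (by omega) (by omega) h
    · rw [ih]
      constructor
      · rintro ⟨h1, h2, h3⟩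
        refine ⟨by omega, h2, fun j h4 h5 => ?_⟩
        rcases Nat.lt_succ_iff_lt_or_eq.1 h5 with h6 | rfl
        exacts [h3 j h4 h6, h]
      · rintro ⟨h1, h2, h3⟩
        have : w ≠ i := by rintro rfl; exact h h2
        exact ⟨by omega, h2, fun j h4 h5 => h3 j h4 (by omega)⟩

end LastBefore

/-- The number of the variable or lock of an event. -/
def objE (ix : Expr) : Expr := get 2 ix + reg 2 * (get 1 ix / lit 2)

theorem Input.eval_objE {D : NTrace} {p t : ℕ} {s : State} (h : Input D p t s) (ix : Expr) :
    (objE ix).eval s = D.obj (ix.eval s) := by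
  simp [objE, h.tg, h.kd, h.V, NTrace.obj]

theorem NTrace.Match.acq_unique {D : NTrace} {a b r : ℕ} (ha : D.Match a r) (hb : D.Match b r) :
    a = b := by
  rcases lt_trichotomy a b with h | h | h
  · exact absurd (hb.obj_eq.trans ha.obj_eq.symm) (ha.next b h hb.lt)
  · exact h
  · exact absurd (ha.obj_eq.trans hb.obj_eq.symm) (hb.next a h ha.lt)

/-- Compute one more than the position of the writer of each read (array `7`). -/
def writerCmd : Cmd :=
  loop 7 0 (
    ite (get 1 (reg 7))
      (ite (Expr.eq (get 1 (reg 7)) (lit 1)) (put 6 (objE (reg 7)) (reg 7 + lit 1)) skip)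
      (put 7 (reg 7) (get 6 (objE (reg 7)))))

theorem writerCmd_spec {D : NTrace} {p t K : ℕ} {s : State} (hs : Input D p t s) (hK : D.N ≤ K)
    (h6 : ∀ i, s.arr 6 i = 0) (h7 : ∀ i, s.arr 7 i = 0) :
    ∀ i < D.N, ∀ w, (writerCmd.run K s).arr 7 i = w + 1 ↔ D.Writer w i := by
  have key := Cmd.run_loop_input (K := K) hs 7 0 _ (by rfl : writerCmd.keepsInput = true)
    (fun j st => (∀ x, st.arr 6 x = lastBefore (fun i => D.kd i = 1 ∧ D.obj i = x) j) ∧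
      (∀ i < j, st.arr 7 i = if D.kd i = 0 then
        lastBefore (fun k => D.kd k = 1 ∧ D.obj k = D.obj i) i else 0) ∧
      (∀ i, j ≤ i → st.arr 7 i = 0)) (by simp [h6, h7, lastBefore]) ?_
  · rw [hs.N] at key
    intro i hi w
    rw [writerCmd, key.2.1 i hi]
    split_ifs with h
    · rw [lastBefore_eq_succ]
      constructor
      · rintro ⟨h1, ⟨h2, h3⟩, h4⟩
        exact ⟨h1, hi, h2, h, h3, fun f h5 h6 h7 h8 => h4 f h5 h6 ⟨h8, h7.trans h3⟩⟩
      · intro hw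
        exact ⟨hw.lt, ⟨hw.kd_write, hw.obj_eq⟩, fun f h5 h6 h8 =>
          hw.last f h5 h6 (h8.2.trans hw.obj_eq.symm) h8.1⟩
    · exact iff_of_false (by simp) fun hw => h hw.kd_read
  · rintro j st hj h7 hst - - ⟨a1, a2, a3⟩
    rw [hs.N] at hj
    by_cases h0 : D.kd j = 0
    · simp [hst.kd, h7, h0, hst.eval_objE, a1, Function.update_apply, lastBefore]
      refine ⟨fun i hi => ?_, fun i hi => ?_⟩
      · split_ifs with h1 h2 h2
        · subst h1; rfl
        · subst h1; exact absurd h0 h2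
        · rw [a2 i (by omega), if_pos h2]
        · rw [a2 i (by omega), if_neg h2]
      · rw [if_neg (by omega)]; exact a3 i (by omega)
    · by_cases h1 : D.kd j = 1
      · simp [hst.kd, h7, h1, hst.eval_objE, a1, Function.update_apply, lastBefore]
        refine ⟨fun x => ?_, fun i hi => ?_, fun i hi => a3 i (by omega)⟩
        · split_ifs with h1 h2 h2
          · omega
          · exact absurd h1.symm h2
          · exact absurd h2.symm h1
          · rfl
        · rcases hi.lt_or_eq with h | rfl
          · exact a2 i h
          · rw [a3 i le_rfl, if_neg h0]
      · simp [hst.kd, h7, h0, h1, a1, lastBefore]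
        refine ⟨fun i hi => ?_, fun i hi => a3 i (by omega)⟩
        rcases hi.lt_or_eq with h | rfl
        · exact a2 i h
        · rw [a3 i le_rfl, if_neg h0]

/-- Compute one more than the position of the matching release of each acquire (array `9`). -/
def matchCmd : Cmd :=
  loop 7 0 (
    ite (Expr.eq (get 1 (reg 7)) (lit 2))
      (put 8 (objE (reg 7)) (reg 7 + lit 1))
      (ite (Expr.eq (get 1 (reg 7)) (lit 3))
        (put 9 (get 8 (objE (reg 7)) - lit 1) (reg 7 + lit 1)) skip))

theorem matchCmd_spec {D : NTrace} (hD : D.Valid) {p t K : ℕ} {s : State} (hs : Input D p t s)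
    (hK : D.N ≤ K) (h8 : ∀ i, s.arr 8 i = 0) (h9 : ∀ i, s.arr 9 i = 0) :
    ∀ a r, (matchCmd.run K s).arr 9 a = r + 1 ↔ D.Match a r := by
  have key := Cmd.run_loop_input (K := K) hs 7 0 _ (by rfl : matchCmd.keepsInput = true)
    (fun j st => (∀ x, st.arr 8 x = lastBefore (fun i => D.kd i = 2 ∧ D.obj i = x) j) ∧
      (∀ a r, st.arr 9 a = r + 1 ↔ D.Match a r ∧ r < j)) (by simp [h8, h9, lastBefore]) ?_
  · rw [hs.N] at key
    intro a r
    rw [matchCmd, key.2 a r]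
    exact ⟨fun h => h.1, fun h => ⟨h, h.lt_N⟩⟩
  · rintro j st hj h7 hst - - ⟨a1, a2⟩
    rw [hs.N] at hj
    have keep : D.kd j ≠ 3 → ∀ a r, (st.arr 9 a = r + 1 ↔ D.Match a r ∧ r < j + 1) := by
      intro h3 a r
      rw [a2]
      refine and_congr_right fun hm => ⟨fun h => by omega, fun h => ?_⟩
      rcases Nat.lt_succ_iff_lt_or_eq.1 h with h | rfl
      · exact h
      · exact absurd hm.kd_rel h3
    by_cases h2 : D.kd j = 2
    · simp only [Cmd.run_ite, Expr.eval_eq, Expr.eval_get, Expr.eval_reg, Expr.eval_lit, hst.kd, h7,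
        h2, not_true_eq_false, if_false, Cmd.run_put, hst.eval_objE]
      simp only [State.arr_setReg]
      refine ⟨fun x => ?_, by simpa using keep (by omega)⟩
      simp [lastBefore, h2, a1, Function.update_apply, h7]
      split_ifs with h3 h4 h4
      · omega
      · exact absurd h3.symm h4
      · exact absurd h4.symm h3
      · rfl
    · by_cases h3 : D.kd j = 3
      · obtain ⟨b, hb⟩ := hD.rel_matched j hj h3
        have hlast : st.arr 8 (D.obj j) = b + 1 := by
          rw [a1, lastBefore_eq_succ]
          exact ⟨hb.lt, ⟨hb.kd_acq, hb.obj_eq⟩,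
            fun k h4 h5 h6 => hb.next k h4 h5 (h6.2.trans hb.obj_eq.symm)⟩
        simp only [Cmd.run_ite, Expr.eval_eq, Expr.eval_get, Expr.eval_reg, Expr.eval_lit, hst.kd,
          h7, h3, not_true_eq_false, if_false, Cmd.run_put, hst.eval_objE, Expr.eval_sub, hlast]
        simp only [State.arr_setReg]
        refine ⟨fun x => by simpa [lastBefore, h2] using a1 x, fun a r => ?_⟩
        simp [Function.update_apply, h7]
        rw [min_eq_left (by omega)]
        split_ifs with h4
        · subst h4
          constructor
          · intro h5
            obtain rfl : j = r := by omega
            exact ⟨hb, le_rfl⟩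
          · rintro ⟨h5, -⟩
            rw [hb.unique h5]
        · rw [a2]
          refine and_congr_right fun hm => ⟨fun h => by omega, fun h => ?_⟩
          rcases h.lt_or_eq with h | rfl
          · exact h
          · exact absurd (hm.acq_unique hb) h4
      · simp only [Cmd.run_ite, Expr.eval_eq, Expr.eval_get, Expr.eval_reg, Expr.eval_lit, hst.kd,
          h7, h2, h3, not_false_eq_true, if_true, Cmd.run_skip, State.arr_setReg]
        exact ⟨fun x => by simpa [lastBefore, h2] using a1 x, keep h3⟩

/-! ### Propagation along closures -/

theorem NTrace.Cl.trans {D : NTrace} {i j k : ℕ} (h1 : D.Cl i j) (h2 : D.Cl j k) : D.Cl i k := by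
  induction h2 with
  | refl => exact h1
  | thread k l _ hkl ht ih => exact NTrace.Cl.thread k l ih hkl ht
  | writer w l _ hw ih => exact NTrace.Cl.writer w l ih hw

theorem NTrace.cl_iff {D : NTrace} {i k : ℕ} : D.Cl i k ↔
    k = i ∨ (∃ j < i, D.th j = D.th i ∧ D.Cl j k) ∨ ∃ w, D.Writer w i ∧ D.Cl w k := by
  constructor
  · intro h
    induction h with
    | refl => exact Or.inl rfl
    | thread k l _ hkl ht ih =>
      rcases ih with rfl | ⟨j, hj, hjt, hc⟩ | ⟨w, hw, hc⟩
      · exact Or.inr (Or.inl ⟨k, hkl, ht, NTrace.Cl.refl⟩)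
      · exact Or.inr (Or.inl ⟨j, hj, hjt, NTrace.Cl.thread k l hc hkl ht⟩)
      · exact Or.inr (Or.inr ⟨w, hw, NTrace.Cl.thread k l hc hkl ht⟩)
    | writer v l _ hv ih =>
      rcases ih with rfl | ⟨j, hj, hjt, hc⟩ | ⟨w, hw, hc⟩
      · exact Or.inr (Or.inr ⟨v, hv, NTrace.Cl.refl⟩)
      · exact Or.inr (Or.inl ⟨j, hj, hjt, NTrace.Cl.writer v l hc hv⟩)
      · exact Or.inr (Or.inr ⟨w, hw, NTrace.Cl.writer v l hc hv⟩)
  · rintro (rfl | ⟨j, hj, hjt, hc⟩ | ⟨w, hw, hc⟩)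
    · exact NTrace.Cl.refl
    · exact (NTrace.Cl.thread j i NTrace.Cl.refl hj hjt).trans hc
    · exact (NTrace.Cl.writer w i NTrace.Cl.refl hw).trans hc

/-- Compute in array `y` the maximal value of `init` on the closure of each event; array `z` is for
the running maxima of the threads. -/
def propCmd (y z : ℕ) (init : Expr) : Cmd :=
  loop 7 0 (
    set 10 init ++
    raise 10 (get z (get 0 (reg 7))) ++
    ite (get 7 (reg 7)) (raise 10 (get y (get 7 (reg 7) - lit 1))) skip ++
    put y (reg 7) (reg 10) ++
    put z (get 0 (reg 7)) (reg 10))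

theorem propCmd_spec {D : NTrace} {p t K y z : ℕ} {init : Expr} {ini : ℕ → ℕ} {s : State}
    (hs : Input D p t s) (hk : (propCmd y z init).keepsInput = true) (hyz : y ≠ z) (hy0 : 0 ≠ y) (hy7 : y ≠ 7)
    (hz7 : z ≠ 7) (hw : ∀ i < D.N, ∀ w, s.arr 7 i = w + 1 ↔ D.Writer w i)
    (hz : ∀ i, s.arr z i = 0)
    (hini : ∀ st j, Input D p t st → j < D.N → st.reg 7 = j → (∀ a, a ≠ y → a ≠ z →
      st.arr a = s.arr a) → init.stored K st = ini j) :
    ∀ i < D.N, ∀ m > 0, m ≤ ((propCmd y z init).run K s).arr y i ↔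
      ∃ k, D.Cl i k ∧ m ≤ ini k := by
  have key := Cmd.run_loop_input (K := K) hs 7 0 _ hk
    (fun j st => (∀ i < j, ∀ m > 0, m ≤ st.arr y i ↔ ∃ k, D.Cl i k ∧ m ≤ ini k) ∧
      (∀ v, ∀ m > 0, m ≤ st.arr z v ↔ ∃ i < j, D.th i = v ∧ m ≤ st.arr y i)) ?_ ?_
  · rw [hs.N] at key
    exact key.1
  · refine ⟨by simp, fun v m hm => ?_⟩
    simp only [State.arr_setReg, hz]
    constructor
    · intro h; omega
    · rintro ⟨i, hi, -⟩; omega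
  · rintro j st hj h7 hst - ha ⟨a1, a2⟩
    rw [hs.N] at hj
    have ha' : ∀ a, a ≠ y → a ≠ z → st.arr a = s.arr a := by
      intro a h1 h2
      refine ha a ?_
      change a ∉ ([] ++ ([] ++ []) ++ (([] ++ []) ++ []) ++ [y] ++ [z] : List ℕ)
      simp [h1, h2]
    have hw7 : st.arr 7 = s.arr 7 := ha' 7 hy7.symm hz7.symm
    set u := ini j with hu
    set v := st.arr z (D.th j) with hv
    set w := if st.arr 7 j = 0 then 0 else st.arr y (st.arr 7 j - 1) with hw'
    have hini' := hini st j hst hj h7 ha'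
    unfold Expr.stored at hini'
    have hrun : ((set 10 init ++
        raise 10 (get z (get 0 (reg 7))) ++
        ite (get 7 (reg 7)) (raise 10 (get y (get 7 (reg 7) - lit 1))) skip ++
        put y (reg 7) (reg 10) ++
        put z (get 0 (reg 7)) (reg 10)).run K st).arr =
        ((st.setArr y j (max u (max v w))).setArr z (D.th j) (max u (max v w))).arr := by
      simp only [Cmd.run_append, Cmd.run_set, hini']
      by_cases h2 : st.arr 7 j = 0
      · have : w = 0 := by rw [hw', if_pos h2]
        simp [h7, hst.th, ← hv, h2, this, hy0]
        rfl
      · have : w = st.arr y (st.arr 7 j - 1) := by rw [hw', if_neg h2]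
        simp [h7, hst.th, ← hv, h2, this, hy0]
        rfl
    have hnew : ∀ m > 0, m ≤ max u (max v w) ↔ ∃ k, D.Cl j k ∧ m ≤ ini k := by
      intro m hm
      have e1 : m ≤ v ↔ ∃ i < j, D.th i = D.th j ∧ m ≤ st.arr y i := a2 _ m hm
      have e2 : m ≤ w ↔ ∃ i, D.Writer i j ∧ m ≤ st.arr y i := by
        rw [hw']
        split_ifs with h
        · refine ⟨fun h => by omega, ?_⟩
          rintro ⟨i, hi, -⟩
          rw [← hw j hj, ← hw7] at hi
          omega
        · obtain ⟨i, hi⟩ := Nat.exists_eq_succ_of_ne_zero h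
          have hwi : D.Writer i j := by rw [← hw j hj, ← hw7]; exact hi
          rw [hi]
          constructor
          · intro h; exact ⟨i, hwi, h⟩
          · rintro ⟨i', hi', h⟩
            rw [← hw j hj, ← hw7, hi] at hi'
            obtain rfl : i = i' := by simpa using hi'
            exact h
      rw [le_max_iff, le_max_iff, e1, e2]
      constructor
      · rintro (h | ⟨i, hi, ht, h⟩ | ⟨i, hi, h⟩)
        · exact ⟨j, NTrace.Cl.refl, h⟩
        · obtain ⟨k, hk, hk'⟩ := (a1 i hi m hm).1 h
          exact ⟨k, NTrace.cl_iff.2 (Or.inr (Or.inl ⟨i, hi, ht, hk⟩)), hk'⟩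
        · obtain ⟨k, hk, hk'⟩ := (a1 i hi.lt m hm).1 h
          exact ⟨k, NTrace.cl_iff.2 (Or.inr (Or.inr ⟨i, hi, hk⟩)), hk'⟩
      · rintro ⟨k, hk, hk'⟩
        rcases NTrace.cl_iff.1 hk with rfl | ⟨i, hi, ht, hc⟩ | ⟨i, hi, hc⟩
        · exact Or.inl hk'
        · exact Or.inr (Or.inl ⟨i, hi, ht, (a1 i hi m hm).2 ⟨k, hc, hk'⟩⟩)
        · exact Or.inr (Or.inr ⟨i, hi, (a1 i hi.lt m hm).2 ⟨k, hc, hk'⟩⟩)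
    rw [State.arr_setReg, hrun]
    simp only [State.arr_setArr, hyz, hyz.symm, if_true, if_false,
      Function.update_apply]
    refine ⟨fun i hi m hm => ?_, fun x m hm => ?_⟩
    · split_ifs with h
      · subst h; exact hnew m hm
      · exact a1 i (by omega) m hm
    · split_ifs with h
      · subst h
        constructor
        · intro h
          exact ⟨j, by omega, rfl, by rw [if_pos rfl]; exact h⟩
        · rintro ⟨i, hi, ht, h⟩
          split_ifs at h with h1
          · exact h
          · have : m ≤ v := (a2 _ m hm).2 ⟨i, by omega, ht, h⟩
            omega
      · rw [a2 x m hm]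
        constructor
        · rintro ⟨i, hi, ht, h'⟩
          exact ⟨i, by omega, ht, by rw [if_neg (by omega)]; exact h'⟩
        · rintro ⟨i, hi, ht, h'⟩
          have : i ≠ j := by rintro rfl; exact h ht.symm
          rw [if_neg this] at h'
          exact ⟨i, by omega, ht, h'⟩

/-! ### Growing the least lock-closed sets -/

namespace NTrace

variable (D : NTrace)

open Classical in
/-- The `k`-th event of thread `v`. -/
noncomputable def pos (v k : ℕ) : ℕ :=
  if h : k < D.cnt v then (exists_idx h).choose else 0

variable {D}

theorem pos_spec {v k : ℕ} (h : k < D.cnt v) :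
    D.pos v k < D.N ∧ D.th (D.pos v k) = v ∧ D.idx (D.pos v k) = k := by
  unfold pos
  rw [dif_pos h]
  exact (exists_idx h).choose_spec

theorem pos_idx {i : ℕ} (h : i < D.N) : D.pos (D.th i) (D.idx i) = i := by
  obtain ⟨_, h2, h3⟩ := pos_spec (idx_lt_cnt h)
  exact idx_inj h2 h3

theorem Need.mono {p t j k i : ℕ} (hjk : j ≤ k) (hk : k < D.cnt t)
    (h : D.Need p (D.pos t j) i) : D.Need p (D.pos t k) i := by
  rcases hjk.lt_or_eq with hlt | rfl
  swap; · exact h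
  obtain ⟨a1, a2, a3⟩ := pos_spec (hjk.trans_lt hk)
  obtain ⟨b1, b2, b3⟩ := pos_spec hk
  have hpos : D.pos t j < D.pos t k := (idx_lt_idx (a2.trans b2.symm)).1 (by omega)
  induction h with
  | left i hi ht => exact Need.left i hi ht
  | right i hi ht => exact Need.right i (hi.trans hpos) (ht.trans (a2.trans b2.symm))
  | thread i l _ hil ht ih => exact Need.thread i l ih hil ht
  | writer w l _ hw ih => exact Need.writer w l ih hw
  | lock a r _ hm h1 h2 ih =>
    exact Need.lock a r ih hm h1 fun hc => h2 (Cl.thread _ _ hc hpos (a2.trans b2.symm))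

/-- The invariant of the growth process: at time `k`, the first `n v` events of thread `v` have been
added, `tau` records the times, and at time `j` at least `G (j * T + v)` events of `v` are
required. -/
structure Growth (D : NTrace) (p t : ℕ) (kap : ℕ → ℕ) (k : ℕ) (n G tau : ℕ → ℕ) : Prop where
  k_le : k ≤ D.cnt t
  n_le : ∀ v, n v ≤ D.cnt v
  tau_ne : ∀ i < D.N, tau i ≠ 0 ↔ D.idx i < n (D.th i)
  tau_sound : ∀ i < D.N, D.idx i < n (D.th i) →
    ∃ j ≤ k, j < D.cnt t ∧ tau i = D.N - j ∧ D.Need p (D.pos t j) i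
  G_sound : ∀ j < D.cnt t, ∀ i < D.N, D.idx i < G (j * D.T + D.th i) → D.Need p (D.pos t j) i
  G_le : ∀ j < D.cnt t, ∀ v < D.T, G (j * D.T + v) ≤ D.cnt v
  complete : ∀ j < k, ∀ i, D.Need p (D.pos t j) i → D.N - j ≤ tau i
  demand_writer : ∀ i < D.N, D.idx i < n (D.th i) → ∀ w, D.Writer w i →
    D.idx w < n (D.th w) ∨ D.idx w < G (k * D.T + D.th w)
  demand_lock : ∀ a < D.N, D.idx a < n (D.th a) → ∀ r, D.Match a r → ¬ D.Cl r p →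
    D.idx r < n (D.th r) ∨ ∃ j, k ≤ j ∧ (j ≤ k ∨ j ≤ kap r) ∧ D.idx r < G (j * D.T + D.th r)
  base_right : ∀ j, k ≤ j → j < D.cnt t → j ≤ G (j * D.T + t)
  base_left : D.idx p ≤ n (D.th p) ∨ D.idx p ≤ G (k * D.T + D.th p)

variable {p t k : ℕ} {kap n G tau : ℕ → ℕ}

theorem Growth.add (g : D.Growth p t kap k n G tau) (hk : k < D.cnt t) {f : ℕ}
    (hf : f < D.N) (hn : n (D.th f) = D.idx f) (hG : D.idx f < G (k * D.T + D.th f))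
    {G' : ℕ → ℕ} (hGG' : ∀ x, G x ≤ G' x)
    (hsound : ∀ j < D.cnt t, ∀ i < D.N, D.idx i < G' (j * D.T + D.th i) →
      D.Need p (D.pos t j) i)
    (hle : ∀ j < D.cnt t, ∀ v < D.T, G' (j * D.T + v) ≤ D.cnt v)
    (hw : ∀ w, D.Writer w f → D.idx w < G' (k * D.T + D.th w))
    (hm : ∀ r, D.Match f r → ¬ D.Cl r p → D.idx r < G' (max k (kap r) * D.T + D.th r)) :
    D.Growth p t kap k (Function.update n (D.th f) (D.idx f + 1)) G'
      (Function.update tau f (D.N - k)) := by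
  have hmem : ∀ i < D.N, D.idx i < Function.update n (D.th f) (D.idx f + 1) (D.th i) ↔
      D.idx i < n (D.th i) ∨ i = f := by
    intro i hi
    rw [Function.update_apply]
    split_ifs with h
    · rw [h, hn]
      constructor
      · intro h1
        rcases Nat.lt_succ_iff_lt_or_eq.1 h1 with h2 | h2
        · exact Or.inl h2
        · exact Or.inr (idx_inj h h2)
      · rintro (h1 | rfl) <;> omega
    · refine ⟨Or.inl, ?_⟩
      rintro (h1 | rfl)
      · exact h1
      · exact absurd rfl h
  have hcnt := D.cnt_le t
  have hNk : D.N - k ≠ 0 := by omega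
  refine ⟨g.k_le, ?_, ?_, ?_, hsound, hle, ?_, ?_, ?_, ?_, ?_⟩
  · intro v
    rw [Function.update_apply]
    split_ifs with h
    · subst h; exact idx_lt_cnt hf
    · exact g.n_le v
  · intro i hi
    rw [hmem i hi, Function.update_apply]
    split_ifs with h
    · exact ⟨fun _ => Or.inr h, fun _ => hNk⟩
    · rw [g.tau_ne i hi]; simp [h]
  · intro i hi h1
    rw [Function.update_apply]
    split_ifs with h
    · subst h
      exact ⟨k, le_rfl, hk, rfl, g.G_sound k hk i hi hG⟩
    · rcases (hmem i hi).1 h1 with h2 | h2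
      · exact g.tau_sound i hi h2
      · exact absurd h2 h
  · intro j hj i hi
    have h1 := g.complete j hj i hi
    rw [Function.update_apply]
    split_ifs with h
    · subst h
      have h2 : tau i ≠ 0 := by omega
      have := (g.tau_ne i hf).1 h2
      omega
    · exact h1
  · intro i hi h1 w hwi
    have hwN : w < D.N := hwi.lt.trans hi
    rw [hmem w hwN]
    rcases (hmem i hi).1 h1 with h2 | rfl
    · rcases g.demand_writer i hi h2 w hwi with h3 | h3
      · exact Or.inl (Or.inl h3)
      · exact Or.inr (h3.trans_le (hGG' _))
    · exact Or.inr (hw w hwi)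
  · intro a ha h1 r hmr hcl
    rw [hmem r hmr.lt_N]
    rcases (hmem a ha).1 h1 with h2 | rfl
    · rcases g.demand_lock a ha h2 r hmr hcl with h3 | ⟨j, h3, h4, h5⟩
      · exact Or.inl (Or.inl h3)
      · exact Or.inr ⟨j, h3, h4, h5.trans_le (hGG' _)⟩
    · exact Or.inr ⟨_, le_max_left _ _, by omega, hm r hmr hcl⟩
  · exact fun j h1 h2 => (g.base_right j h1 h2).trans (hGG' _)
  · rcases g.base_left with h | h
    · left
      rw [Function.update_apply]
      split_ifs with h1
      · rw [h1, hn] at h; omega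
      · exact h
    · exact Or.inr (h.trans (hGG' _))

theorem Growth.next (hD : D.Valid) (hp : p < D.N) (ht : t < D.T)
    (hkap : ∀ r < D.N, ∀ q < D.N, D.th q = t → (kap r ≤ D.idx q ↔ ¬ D.Cl r q))
    (g : D.Growth p t kap k n G tau) (hk : k < D.cnt t)
    (hdone : ∀ v < D.T, G (k * D.T + v) ≤ n v) :
    D.Growth p t kap (k + 1) n G tau := by
  obtain ⟨q1, q2, q3⟩ := pos_spec hk
  have hall : ∀ i, D.Need p (D.pos t k) i → D.idx i < n (D.th i) := by
    intro i hi
    induction hi with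
    | left i hip hti =>
      have h1 := (idx_lt_idx hti).2 hip
      have h2 := hdone _ (hD.th_lt p hp)
      rw [hti]
      rcases g.base_left with h | h <;> omega
    | right i hiq hti =>
      have h1 := (idx_lt_idx hti).2 hiq
      have h2 := hdone t ht
      have h3 := g.base_right k le_rfl hk
      rw [hti, q2]
      omega
    | thread i j _ hij hti ih =>
      have h1 := (idx_lt_idx hti).2 hij
      rw [hti]; omega
    | writer w j _ hw ih =>
      rcases g.demand_writer j hw.lt_N ih w hw with h | h
      · exact h
      · exact h.trans_le (hdone _ (hD.th_lt w (hw.lt.trans hw.lt_N)))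
    | lock a r _ hm h1 h2 ih =>
      have h3 := (hkap r hm.lt_N _ q1 q2).2 h2
      rcases g.demand_lock a (hm.lt.trans hm.lt_N) ih r hm h1 with h | ⟨j, h4, h5, h6⟩
      · exact h
      · obtain rfl : j = k := by omega
        exact h6.trans_le (hdone _ (hD.th_lt r hm.lt_N))
  refine ⟨hk, g.n_le, g.tau_ne, ?_, g.G_sound, g.G_le, ?_, ?_, ?_, ?_, ?_⟩
  · intro i hi h
    obtain ⟨j, h1, h2⟩ := g.tau_sound i hi h
    exact ⟨j, by omega, h2⟩
  · intro j hj i hi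
    rcases Nat.lt_succ_iff_lt_or_eq.1 hj with h | rfl
    · exact g.complete j h i hi
    · obtain ⟨l, h1, -, h2, -⟩ := g.tau_sound i (hi.lt_N hp q1) (hall i hi)
      omega
  · intro i hi h w hw
    rcases g.demand_writer i hi h w hw with h1 | h1
    · exact Or.inl h1
    · exact Or.inl (h1.trans_le (hdone _ (hD.th_lt w (hw.lt.trans hw.lt_N))))
  · intro a ha h r hm hc
    rcases g.demand_lock a ha h r hm hc with h1 | ⟨j, h1, h2, h3⟩
    · exact Or.inl h1
    · by_cases hj : j = k
      · subst hj
        exact Or.inl (h3.trans_le (hdone _ (hD.th_lt r hm.lt_N)))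
      · exact Or.inr ⟨j, by omega, by omega, h3⟩
  · exact fun j h1 h2 => g.base_right j (by omega) h2
  · rcases g.base_left with h | h
    · exact Or.inl h
    · exact Or.inl (h.trans (hdone _ (hD.th_lt p hp)))

theorem Growth.final (g : D.Growth p t kap (D.cnt t) n G tau) :
    ∀ k < D.cnt t, ∀ i < D.N, D.N - k ≤ tau i ↔ D.Need p (D.pos t k) i := by
  intro k hk i hi
  refine ⟨fun h => ?_, g.complete k hk i⟩
  have := D.cnt_le t
  obtain ⟨j, h1, h2, h3, h4⟩ := g.tau_sound i hi ((g.tau_ne i hi).1 (by omega))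
  exact h4.mono (by omega) hk

/-- Soundness of the requirements is preserved when an event that is needed is required. -/
theorem sound_raise (hD : D.Valid) {j w : ℕ} (hw : w < D.N)
    (hn : j < D.cnt t → D.Need p (D.pos t j) w)
    (hsound : ∀ j < D.cnt t, ∀ i < D.N, D.idx i < G (j * D.T + D.th i) →
      D.Need p (D.pos t j) i)
    (hle : ∀ j < D.cnt t, ∀ v < D.T, G (j * D.T + v) ≤ D.cnt v) {x : ℕ}
    (hx : x = j * D.T + D.th w) :
    let G' := Function.update G x (max (G x) (D.idx w + 1))
    (∀ y, G y ≤ G' y) ∧ D.idx w < G' x ∧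
    (∀ j < D.cnt t, ∀ i < D.N, D.idx i < G' (j * D.T + D.th i) → D.Need p (D.pos t j) i) ∧
    (∀ j < D.cnt t, ∀ v < D.T, G' (j * D.T + v) ≤ D.cnt v) := by
  intro G'
  have hG' : ∀ y, G' y = if y = x then max (G x) (D.idx w + 1) else G y :=
    fun y => Function.update_apply _ _ _ _
  refine ⟨fun y => ?_, ?_, fun l hl i hi h => ?_, fun l hl v hv => ?_⟩
  · rw [hG']; split_ifs with h
    · subst h; exact le_max_left _ _
    · exact le_rfl
  · rw [hG', if_pos rfl]; omega
  · rw [hG'] at h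
    split_ifs at h with h1
    · obtain ⟨rfl, h2⟩ := pair_inj (hD.th_lt i hi) (hD.th_lt w hw) (h1.trans hx)
      by_cases h3 : D.idx i < G x
      · rw [← h1] at h3; exact hsound _ hl i hi h3
      · rcases lt_or_eq_of_le (show D.idx i ≤ D.idx w by omega) with h4 | h4
        · exact Need.thread i w (hn hl) ((idx_lt_idx h2).1 h4) h2
        · rw [idx_inj h2 h4]; exact hn hl
    · exact hsound l hl i hi h
  · rw [hG']; split_ifs with h1
    · obtain ⟨rfl, rfl⟩ := pair_inj hv (hD.th_lt w hw) (h1.trans hx)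
      rw [← h1]
      exact max_le (hle _ hl _ hv) (idx_lt_cnt hw)
    · exact hle l hl v hv

end NTrace

/-! ### The preprocessing -/

/-- The tables computed from the trace, the event `p` and the thread `t`. -/
structure Prep (D : NTrace) (p t : ℕ) (s : State) : Prop where
  idx : ∀ i < D.N, s.arr 3 i = D.idx i
  cnt : ∀ v, s.arr 4 v = D.cnt v
  ev : ∀ i < D.N, s.arr 5 (D.th i * D.N + D.idx i) = i
  writer : ∀ i < D.N, ∀ w, s.arr 7 i = w + 1 ↔ D.Writer w i
  rel : ∀ a r, s.arr 9 a = r + 1 ↔ D.Match a r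
  kap : ∀ r < D.N, ∀ q < D.N, D.th q = t → (s.arr 10 r ≤ D.idx q ↔ ¬ D.Cl r q)
  left : ∀ r < D.N, s.arr 12 r = 0 ↔ ¬ D.Cl r p

theorem Prep.congr {D : NTrace} {p t : ℕ} {s s' : State} (h : Prep D p t s)
    (ha : ∀ a < 13, s'.arr a = s.arr a) : Prep D p t s' := by
  constructor
  all_goals simp only [ha 3 (by omega), ha 4 (by omega), ha 5 (by omega), ha 7 (by omega),
    ha 9 (by omega), ha 10 (by omega), ha 12 (by omega)]
  exacts [h.idx, h.cnt, h.ev, h.writer, h.rel, h.kap, h.left]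

theorem Prep.ev_pos {D : NTrace} {p t : ℕ} {s : State} (h : Prep D p t s) {v k : ℕ}
    (hk : k < D.cnt v) : s.arr 5 (v * D.N + k) = D.pos v k := by
  obtain ⟨h1, h2, h3⟩ := NTrace.pos_spec hk
  have := h.ev _ h1
  rwa [h2, h3] at this

/-- Compute the tables of `Prep`. -/
def prepCmd : Cmd :=
  indexCmd ++ writerCmd ++ matchCmd ++
  propCmd 10 11 ((get 3 (reg 7) + lit 1) * Expr.eq (get 0 (reg 7)) (reg 5)) ++
  propCmd 12 13 (Expr.eq (reg 7) (reg 4))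

theorem Expr.eval_eq' (s : State) (x y : Expr) :
    (Expr.eq x y).eval s = if x.eval s = y.eval s then 1 else 0 := by
  simp only [Expr.eq, Expr.eval_sub, Expr.eval_add, Expr.eval_lit]
  split_ifs <;> omega

theorem prepCmd_spec {D : NTrace} (hD : D.Valid) {p t K : ℕ} {s : State} (hs : Input D p t s)
    (hK : D.N ≤ K) (h0 : ∀ a, 3 ≤ a → ∀ i, s.arr a i = 0) : Prep D p t (prepCmd.run K s) := by
  set s1 := indexCmd.run K s with e1
  set s2 := writerCmd.run K s1 with e2
  set s3 := matchCmd.run K s2 with e3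
  set s4 := (propCmd 10 11 ((get 3 (reg 7) + lit 1) * Expr.eq (get 0 (reg 7)) (reg 5))).run K s3
    with e4
  set s5 := (propCmd 12 13 (Expr.eq (reg 7) (reg 4))).run K s4 with e5
  change Prep D p t s5
  have i1 : Input D p t s1 := hs.run (by rfl) K
  have i2 : Input D p t s2 := i1.run (by rfl) K
  have i3 : Input D p t s3 := i2.run (by rfl) K
  have i4 : Input D p t s4 := i3.run (by rfl) K
  have f1 : ∀ a, a ∉ indexCmd.arrs → s1.arr a = s.arr a := fun a ha => Cmd.run_arr _ _ _ ha
  have f2 : ∀ a, a ∉ writerCmd.arrs → s2.arr a = s1.arr a := fun a ha => Cmd.run_arr _ _ _ ha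
  have f3 : ∀ a, a ∉ matchCmd.arrs → s3.arr a = s2.arr a := fun a ha => Cmd.run_arr _ _ _ ha
  have f4 : ∀ a, a ∉ [10, 11] → s4.arr a = s3.arr a := fun a ha => Cmd.run_arr _ _ _ ha
  have f5 : ∀ a, a ∉ [12, 13] → s5.arr a = s4.arr a := fun a ha => Cmd.run_arr _ _ _ ha
  have a1 := indexCmd_spec hs hK (h0 4 (by omega))
  rw [← e1] at a1
  have a2 := writerCmd_spec i1 hK (by rw [f1 6 (by decide)]; exact h0 6 (by omega))
    (by rw [f1 7 (by decide)]; exact h0 7 (by omega))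
  rw [← e2] at a2
  have a3 := matchCmd_spec hD i2 hK
    (by rw [f2 8 (by decide), f1 8 (by decide)]; exact h0 8 (by omega))
    (by rw [f2 9 (by decide), f1 9 (by decide)]; exact h0 9 (by omega))
  rw [← e3] at a3
  have h3 : s3.arr 3 = s1.arr 3 := by rw [f3 3 (by decide), f2 3 (by decide)]
  have a4 := propCmd_spec (K := K) (y := 10) (z := 11)
    (init := (get 3 (reg 7) + lit 1) * Expr.eq (get 0 (reg 7)) (reg 5))
    (ini := fun k => if D.th k = t then D.idx k + 1 else 0)
    i3 (by rfl) (by omega) (by omega) (by omega) (by omega)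
    (by rw [f3 7 (by decide)]; exact a2)
    (by rw [f3 11 (by decide), f2 11 (by decide), f1 11 (by decide)]; exact h0 11 (by omega))
    (by
      intro st j hst hj h7 hst'
      have h3' : st.arr 3 = s1.arr 3 := (hst' 3 (by omega) (by omega)).trans h3
      have := NTrace.idx_lt hj
      simp only [Expr.stored, Expr.small_mul, cond_false, Expr.eval_mul, Expr.eval_add,
        Expr.eval_get, Expr.eval_reg, Expr.eval_lit, Expr.eval_eq', h7, h3', a1.idx j hj, hst.th,
        hst.t]
      split_ifs
      · rw [mul_one]; omega
      · rw [mul_zero]; omega)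
  rw [← e4] at a4
  have a5 := propCmd_spec (K := K) (y := 12) (z := 13) (init := Expr.eq (reg 7) (reg 4))
    (ini := fun k => if k = p then 1 else 0)
    i4 (by rfl) (by omega) (by omega) (by omega) (by omega)
    (by rw [f4 7 (by decide), f3 7 (by decide)]; exact a2)
    (by
      rw [f4 13 (by decide), f3 13 (by decide), f2 13 (by decide), f1 13 (by decide)]
      exact h0 13 (by omega))
    (by
      intro st j hst hj h7 hst'
      change (Expr.eq (reg 7) (reg 4)).eval st = _
      simp only [Expr.eval_eq', Expr.eval_reg, h7, hst.p])
  rw [← e5] at a5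
  constructor
  · rw [f5 3 (by decide), f4 3 (by decide), h3]; exact a1.idx
  · rw [f5 4 (by decide), f4 4 (by decide), f3 4 (by decide), f2 4 (by decide)]; exact a1.cnt
  · rw [f5 5 (by decide), f4 5 (by decide), f3 5 (by decide), f2 5 (by decide)]; exact a1.ev
  · rw [f5 7 (by decide), f4 7 (by decide), f3 7 (by decide)]; exact a2
  · rw [f5 9 (by decide), f4 9 (by decide)]; exact a3
  · intro r hr q hq hqt
    rw [f5 10 (by decide), ← not_iff_not, not_le, not_not, ← Nat.succ_le_iff,
      a4 r hr _ (Nat.succ_pos _)]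
    constructor
    · rintro ⟨k, hk, h⟩
      split_ifs at h with h1
      · have h2 := NTrace.idx_lt_idx (D := D) (h1.trans hqt.symm)
        by_cases h3 : q < k
        · exact NTrace.Cl.thread q k hk h3 (hqt.trans h1.symm)
        · rcases (not_lt.1 h3).lt_or_eq with h4 | rfl
          · have := h2.2 h4; omega
          · exact hk
      · omega
    · intro h
      exact ⟨q, h, by rw [if_pos hqt]⟩
  · intro r hr
    have := a5 r hr 1 (by omega)
    rw [← not_iff_not, not_not, ← ne_eq, ← Nat.one_le_iff_ne_zero, this]
    constructor
    · rintro ⟨k, hk, h⟩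
      split_ifs at h with h1
      · exact h1 ▸ hk
      · omega
    · intro h
      exact ⟨p, h, by rw [if_pos rfl]⟩

/-! ### The growth process -/

/-- Put the initial requirements into array `15`. -/
def initCmd : Cmd :=
  loop 7 0 (ite (lt (reg 7) (get 4 (reg 5))) (put 15 (reg 7 * reg 1 + reg 5) (reg 7)) skip) ++
  put 15 (get 0 (reg 4)) (get 3 (reg 4))

/-- Find in register `11` one more than a thread with an outstanding requirement. -/
def findCmd : Cmd :=
  set 11 (lit 0) ++
  loop 8 1 (ite (lt (get 14 (reg 8)) (get 15 (reg 30 * reg 1 + reg 8))) (set 11 (reg 8 + lit 1)) skip)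

/-- Require the writer of the event in register `13`. -/
def demandWriterCmd : Cmd :=
  ite (get 7 (reg 13))
    (set 14 (get 7 (reg 13) - lit 1) ++ set 15 (get 3 (reg 14) + lit 1) ++
      raiseAt 15 (reg 30 * reg 1 + get 0 (reg 14)) (reg 15)) skip

/-- Require the release matching the event in register `13`, at the time when this is due. -/
def demandRelCmd : Cmd :=
  ite (get 9 (reg 13))
    (set 14 (get 9 (reg 13) - lit 1) ++
      ite (get 12 (reg 14)) skip
        (set 15 (get 3 (reg 14) + lit 1) ++ set 16 (reg 30) ++ raise 16 (get 10 (reg 14)) ++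
          raiseAt 15 (reg 16 * reg 1 + get 0 (reg 14)) (reg 15))) skip

/-- Add the next event of the thread found. -/
def addCmd : Cmd :=
  set 12 (reg 11 - lit 1) ++
  set 13 (get 5 (reg 12 * reg 0 + get 14 (reg 12))) ++
  put 16 (reg 13) (reg 0 - reg 30) ++
  put 14 (reg 12) (get 3 (reg 13) + lit 1) ++
  demandWriterCmd ++ demandRelCmd

/-- One step of the growth process. -/
def roundCmd : Cmd :=
  ite (lt (reg 30) (get 4 (reg 5)))
    (findCmd ++ ite (reg 11) addCmd (set 30 (reg 30 + lit 1))) skip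

/-- Compute in array `16` the times at which the events enter the least lock-closed sets. -/
def growCmd : Cmd := initCmd ++ set 30 (lit 0) ++ loop 7 0 (roundCmd ++ roundCmd)

theorem findCmd_spec {D : NTrace} {p t K : ℕ} {s : State} (hs : Input D p t s) (hK : D.T ≤ K) :
    ((findCmd.run K s).reg 11 = 0 ∧ ∀ v < D.T, s.arr 15 (s.reg 30 * D.T + v) ≤ s.arr 14 v) ∨
    ∃ v < D.T, (findCmd.run K s).reg 11 = v + 1 ∧
      s.arr 14 v < s.arr 15 (s.reg 30 * D.T + v) := by
  set s' := (set 11 (lit 0)).run K s with e'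
  have hs' : Input D p t s' := hs.run (by rfl) K
  have key := Cmd.run_loop_input (K := K) hs' 8 1
    (ite (lt (get 14 (reg 8)) (get 15 (reg 30 * reg 1 + reg 8))) (set 11 (reg 8 + lit 1)) skip)
    (by rfl)
    (fun j st => (st.reg 11 = 0 ∧ ∀ v < j, s.arr 15 (s.reg 30 * D.T + v) ≤ s.arr 14 v) ∨
      ∃ v < j, st.reg 11 = v + 1 ∧ s.arr 14 v < s.arr 15 (s.reg 30 * D.T + v))
    (by simp [e']) ?_
  · rw [hs'.T] at key
    exact key
  · rintro j st hj h8 hst hr ha h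
    rw [hs'.T] at hj
    have h30 : st.reg 30 = s.reg 30 := (hr 30 (by decide)).trans (by simp [e'])
    have h14 : st.arr 14 = s.arr 14 := (ha 14 (by decide)).trans (by simp [e'])
    have h15 : st.arr 15 = s.arr 15 := (ha 15 (by decide)).trans (by simp [e'])
    by_cases hlt : s.arr 14 j < s.arr 15 (s.reg 30 * D.T + j)
    · right
      refine ⟨j, by omega, ?_, hlt⟩
      simp [h8, h30, h14, h15, hst.T, hlt]
      omega
    · rcases h with ⟨h1, h2⟩ | ⟨v, h1, h2, h3⟩
      · left
        refine ⟨by simp [h8, h30, h14, h15, hst.T, hlt, h1], fun v hv => ?_⟩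
        rcases Nat.lt_succ_iff_lt_or_eq.1 hv with h | rfl
        · exact h2 v h
        · omega
      · right
        exact ⟨v, by omega, by simp [h8, h30, h14, h15, hst.T, hlt, h2], h3⟩

/-- The requirements recorded in `G` are justified. -/
structure Sound (D : NTrace) (p t : ℕ) (G : ℕ → ℕ) : Prop where
  need : ∀ j < D.cnt t, ∀ i < D.N, D.idx i < G (j * D.T + D.th i) → D.Need p (D.pos t j) i
  le : ∀ j < D.cnt t, ∀ v < D.T, G (j * D.T + v) ≤ D.cnt v

theorem demandWriterCmd_spec {D : NTrace} (hD : D.Valid) {p t K f k : ℕ} {s : State}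
    (hs : Input D p t s) (hp : Prep D p t s) (hK : D.N ≤ K) (hf : f < D.N) (h13 : s.reg 13 = f)
    (h30 : s.reg 30 = k) (hn : D.Need p (D.pos t k) f) (hG : Sound D p t (s.arr 15)) :
    let s' := demandWriterCmd.run K s
    Sound D p t (s'.arr 15) ∧ (∀ x, s.arr 15 x ≤ s'.arr 15 x) ∧
      ∀ w, D.Writer w f → D.idx w < s'.arr 15 (k * D.T + D.th w) := by
  intro s'
  rcases h : s.arr 7 f with _ | w
  · have e : s' = s := by simp [s', demandWriterCmd, h13, h]
    rw [e]
    refine ⟨hG, fun x => le_rfl, fun w hw => ?_⟩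
    rw [← hp.writer f hf w] at hw
    omega
  · have hw := (hp.writer f hf w).1 h
    have hwN : w < D.N := hw.lt.trans hf
    have hlt := NTrace.idx_lt hwN
    have e : s'.arr 15 = Function.update (s.arr 15) (k * D.T + D.th w)
        (max (s.arr 15 (k * D.T + D.th w)) (D.idx w + 1)) := by
      simp [s', demandWriterCmd, h13, h, h30, hs.T, hs.th, hp.idx w hwN,
        min_eq_left (show D.idx w + 1 ≤ K by omega)]
    obtain ⟨h1, h2, h3, h4⟩ := NTrace.sound_raise hD hwN
      (fun _ => NTrace.Need.writer w f hn hw) hG.need hG.le rfl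
    rw [e]
    refine ⟨⟨h3, h4⟩, h1, fun w' hw' => ?_⟩
    rw [← hp.writer f hf w', h] at hw'
    obtain rfl : w = w' := by omega
    exact h2

theorem demandRelCmd_spec {D : NTrace} (hD : D.Valid) {p t K f k : ℕ} {s : State}
    (hs : Input D p t s) (hp : Prep D p t s) (hK : D.N ≤ K) (h13 : s.reg 13 = f)
    (h30 : s.reg 30 = k) (hn : D.Need p (D.pos t k) f) (hG : Sound D p t (s.arr 15)) :
    let s' := demandRelCmd.run K s
    Sound D p t (s'.arr 15) ∧ (∀ x, s.arr 15 x ≤ s'.arr 15 x) ∧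
      ∀ r, D.Match f r → ¬ D.Cl r p →
        D.idx r < s'.arr 15 (max k (s.arr 10 r) * D.T + D.th r) := by
  intro s'
  rcases h : s.arr 9 f with _ | r
  · have e : s' = s := by simp [s', demandRelCmd, h13, h]
    rw [e]
    refine ⟨hG, fun x => le_rfl, fun r hr => ?_⟩
    rw [← hp.rel f r] at hr
    omega
  · have hr := (hp.rel f r).1 h
    have hlt := NTrace.idx_lt hr.lt_N
    have huniq : ∀ r', D.Match f r' → r' = r := fun r' hr' => hr'.unique hr
    by_cases hl : s.arr 12 r = 0
    · have hcl := (hp.left r hr.lt_N).1 hl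
      have e : s'.arr 15 = Function.update (s.arr 15) (max k (s.arr 10 r) * D.T + D.th r)
          (max (s.arr 15 (max k (s.arr 10 r) * D.T + D.th r)) (D.idx r + 1)) := by
        simp [s', demandRelCmd, h13, h, h30, hs.T, hs.th, hp.idx r hr.lt_N, hl,
          min_eq_left (show D.idx r + 1 ≤ K by omega)]
      obtain ⟨h1, h2, h3, h4⟩ := NTrace.sound_raise (D := D) (p := p) (t := t) (G := s.arr 15)
        (j := max k (s.arr 10 r)) hD hr.lt_N
        (fun hlt => by
          obtain ⟨q1, q2, q3⟩ := NTrace.pos_spec hlt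
          refine NTrace.Need.lock f r (hn.mono (le_max_left _ _) hlt) hr hcl
            ((hp.kap r hr.lt_N _ q1 q2).1 ?_)
          rw [q3]; exact le_max_right _ _) hG.need hG.le rfl
      rw [e]
      refine ⟨⟨h3, h4⟩, h1, fun r' hr' _ => ?_⟩
      obtain rfl := huniq r' hr'
      exact h2
    · have e : s' = s.setReg 14 r := by
        simp [s', demandRelCmd, h13, h, hl]
      rw [e]
      refine ⟨hG, fun x => le_rfl, fun r' hr' hc => ?_⟩
      obtain rfl := huniq r' hr'
      exact absurd ((hp.left _ hr.lt_N).2 hc) hl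

/-- The growth invariant for a state. -/
def Growing (D : NTrace) (p t : ℕ) (s : State) : Prop :=
  D.Growth p t (s.arr 10) (s.reg 30) (s.arr 14) (s.arr 15) (s.arr 16)

/-- The number of steps made so far. -/
def progress (D : NTrace) (s : State) : ℕ :=
  ((Finset.range D.N).filter fun i => s.arr 16 i ≠ 0).card + s.reg 30

theorem addCmd_spec {D : NTrace} (hD : D.Valid) {p t K v : ℕ} {s : State}
    (hs : Input D p t s) (hp : Prep D p t s) (hK : D.N ≤ K) (hg : Growing D p t s)
    (hk : s.reg 30 < D.cnt t) (h11 : s.reg 11 = v + 1) (hv : v < D.T)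
    (hlt : s.arr 14 v < s.arr 15 (s.reg 30 * D.T + v)) :
    Growing D p t (addCmd.run K s) ∧ progress D (addCmd.run K s) = progress D s + 1 := by
  set k := s.reg 30 with hk'
  have hnv : s.arr 14 v < D.cnt v := hlt.trans_le (hg.G_le k hk v hv)
  set f := D.pos v (s.arr 14 v) with hf'
  obtain ⟨hf, hfv, hfi⟩ := NTrace.pos_spec hnv
  rw [← hf'] at hf hfv hfi
  have hev : s.arr 5 (v * D.N + s.arr 14 v) = f := hp.ev_pos hnv
  have hidx := NTrace.idx_lt hf
  set c : Cmd := set 12 (reg 11 - lit 1) ++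
    set 13 (get 5 (reg 12 * reg 0 + get 14 (reg 12))) ++
    put 16 (reg 13) (reg 0 - reg 30) ++
    put 14 (reg 12) (get 3 (reg 13) + lit 1) with hc
  set s1 := c.run K s with hs1
  have e1 : s1 = (((s.setReg 12 v).setReg 13 f).setArr 16 f (D.N - k)).setArr 14 v
      (D.idx f + 1) := by
    simp [hs1, hc, h11, hs.N, hev, hp.idx f hf, ← hk', min_eq_left (show D.idx f + 1 ≤ K by omega)]
  have i1 : Input D p t s1 := hs.run (by rfl) K
  have p1 : Prep D p t s1 := hp.congr fun a ha => by
    rw [e1]; simp only [State.arr_setArr, State.arr_setReg]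
    rw [if_neg (by omega), if_neg (by omega)]
  have r13 : s1.reg 13 = f := by simp [e1]
  have r30 : s1.reg 30 = k := by simp [e1, hk']
  have a15 : s1.arr 15 = s.arr 15 := by simp [e1]
  have hn : D.Need p (D.pos t k) f := hg.G_sound k hk f hf (by rw [hfv, hfi]; exact hlt)
  obtain ⟨b1, b2, b3⟩ := demandWriterCmd_spec hD i1 p1 hK hf r13 r30 hn
    (by rw [a15]; exact ⟨hg.G_sound, hg.G_le⟩)
  set s2 := demandWriterCmd.run K s1 with hs2
  have i2 : Input D p t s2 := i1.run (by rfl) K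
  have g2 : ∀ a, a ∉ [15] → s2.arr a = s1.arr a := fun a ha => Cmd.run_arr _ _ _ ha
  have p2 : Prep D p t s2 := p1.congr fun a ha => g2 a (by simp; omega)
  have q2 : ∀ r, r ∉ demandWriterCmd.regs → s2.reg r = s1.reg r :=
    fun r hr => Cmd.run_reg _ _ _ hr
  obtain ⟨c1, c2, c3⟩ := demandRelCmd_spec hD i2 p2 hK ((q2 13 (by decide)).trans r13)
    ((q2 30 (by decide)).trans r30) hn b1
  set s3 := demandRelCmd.run K s2 with hs3
  have g3 : ∀ a, a ∉ [15] → s3.arr a = s2.arr a := fun a ha => Cmd.run_arr _ _ _ ha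
  have q3 : ∀ r, r ∉ demandRelCmd.regs → s3.reg r = s2.reg r :=
    fun r hr => Cmd.run_reg _ _ _ hr
  have hrun : addCmd.run K s = s3 := rfl
  rw [hrun]
  have h30 : s3.reg 30 = k := by rw [q3 30 (by decide), q2 30 (by decide), r30]
  have h10 : s3.arr 10 = s.arr 10 := by
    rw [g3 10 (by decide), g2 10 (by decide), e1]; simp
  have h14 : s3.arr 14 = Function.update (s.arr 14) (D.th f) (D.idx f + 1) := by
    rw [g3 14 (by decide), g2 14 (by decide), e1, hfv]; simp
  have h16 : s3.arr 16 = Function.update (s.arr 16) f (D.N - k) := by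
    rw [g3 16 (by decide), g2 16 (by decide), e1]; simp
  have h10' : s2.arr 10 = s.arr 10 := by rw [g2 10 (by decide), e1]; simp
  constructor
  · unfold Growing
    rw [h30, h10, h14, h16]
    refine hg.add hk hf (by rw [hfv, hfi]) (by rw [hfv, hfi]; exact hlt) (fun x => ?_) c1.need
      c1.le (fun w hw => (b3 w hw).trans_le (c2 _)) fun r hr hcl => ?_
    · exact ((congrFun a15 x).symm.le.trans (b2 x)).trans (c2 x)
    · have := c3 r hr hcl
      rwa [h10'] at this
  · unfold progress
    rw [h30, h16, ← hk']
    have hf0 : s.arr 16 f = 0 := by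
      by_contra h
      have := (hg.tau_ne f hf).1 h
      rw [hfv, hfi] at this
      omega
    have hcnt := D.cnt_le t
    have : (Finset.range D.N).filter (fun i => Function.update (s.arr 16) f (D.N - k) i ≠ 0) =
        insert f ((Finset.range D.N).filter fun i => s.arr 16 i ≠ 0) := by
      ext i
      simp only [Finset.mem_filter, Finset.mem_range, Finset.mem_insert, Function.update_apply]
      split_ifs with h
      · subst h
        exact ⟨fun _ => Or.inl rfl, fun _ => ⟨hf, by omega⟩⟩
      · simp [h]
    rw [this, Finset.card_insert_of_notMem (by simp [hf0])]
    omega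

theorem roundCmd_spec {D : NTrace} (hD : D.Valid) {p t K : ℕ} {s : State}
    (hs : Input D p t s) (hp : Prep D p t s) (hK : D.N ≤ K) (hpN : p < D.N) (ht : t < D.T)
    (hg : Growing D p t s) :
    Growing D p t (roundCmd.run K s) ∧ progress D s ≤ progress D (roundCmd.run K s) ∧
      (s.reg 30 < D.cnt t → progress D s + 1 ≤ progress D (roundCmd.run K s)) := by
  by_cases hk : s.reg 30 < D.cnt t
  swap
  · have : roundCmd.run K s = s := by simp [roundCmd, hs.t, hp.cnt, hk]
    rw [this]
    exact ⟨hg, le_rfl, fun h => absurd h hk⟩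
  have hcnt := D.cnt_le t
  set s1 := findCmd.run K s with hs1
  have i1 : Input D p t s1 := hs.run (by rfl) K
  have g1 : s1.arr = s.arr := funext fun a => Cmd.run_arr _ _ _
    (by rw [show findCmd.arrs = [] from rfl]; simp)
  have p1 : Prep D p t s1 := hp.congr fun a _ => by rw [g1]
  have h30 : s1.reg 30 = s.reg 30 := Cmd.run_reg _ _ _ (by decide)
  have G1 : Growing D p t s1 := by unfold Growing; rw [g1, h30]; exact hg
  have P1 : progress D s1 = progress D s := by unfold progress; rw [g1, h30]
  have hrun : roundCmd.run K s =
      (ite (reg 11) addCmd (set 30 (reg 30 + lit 1))).run K s1 := by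
    simp [roundCmd, hs.t, hp.cnt, hk, hs1]
  rw [hrun]
  rcases findCmd_spec hs (K := K) (hD.T_le.trans hK) with ⟨h11, hdone⟩ | ⟨v, hv, h11, hlt⟩
  · rw [← hs1] at h11
    have : (ite (reg 11) addCmd (set 30 (reg 30 + lit 1))).run K s1 =
        s1.setReg 30 (s.reg 30 + 1) := by
      simp [h11, h30, min_eq_left (show s.reg 30 + 1 ≤ K by omega)]
    rw [this]
    refine ⟨?_, ?_, fun _ => ?_⟩
    · unfold Growing
      simp only [State.reg_setReg, State.arr_setReg, if_true, g1]
      exact hg.next hD hpN ht hp.kap hk hdone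
    all_goals
      unfold progress
      simp only [State.reg_setReg, State.arr_setReg, if_true, g1]
      omega
  · rw [← hs1] at h11
    have : (ite (reg 11) addCmd (set 30 (reg 30 + lit 1))).run K s1 = addCmd.run K s1 := by
      simp [h11]
    rw [this]
    obtain ⟨h1, h2⟩ := addCmd_spec hD i1 p1 hK G1 (by rw [h30]; exact hk) h11 hv
      (by rw [g1, h30]; exact hlt)
    exact ⟨h1, by omega, fun _ => by omega⟩

theorem initCmd_spec {D : NTrace} (hD : D.Valid) {p t K : ℕ} {s : State} (hs : Input D p t s)
    (hp : Prep D p t s) (hpN : p < D.N) (ht : t < D.T) (h14 : ∀ i, s.arr 14 i = 0)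
    (h15 : ∀ i, s.arr 15 i = 0) (h16 : ∀ i, s.arr 16 i = 0) :
    Growing D p t ((initCmd ++ set 30 (lit 0)).run K s) := by
  have hc : initCmd.keepsInput = true := by rfl
  have key := Cmd.run_loop_input (K := K) hs 7 0
    (ite (lt (reg 7) (get 4 (reg 5))) (put 15 (reg 7 * reg 1 + reg 5) (reg 7)) skip) (by rfl)
    (fun j st => ∀ k v, v < D.T → st.arr 15 (k * D.T + v) =
      if v = t ∧ k < D.cnt t ∧ k < j then k else 0) (by simp [h15]) ?_
  · rw [hs.N] at key
    set s1 := (loop 7 0 (ite (lt (reg 7) (get 4 (reg 5)))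
      (put 15 (reg 7 * reg 1 + reg 5) (reg 7)) skip)).run K s with hs1
    have i1 : Input D p t s1 := hs.run (by rfl) K
    have g1 : ∀ a, a ∉ [15] → s1.arr a = s.arr a := fun a ha => Cmd.run_arr _ _ _ ha
    have hth := hD.th_lt p hpN
    have hcnt := D.cnt_le t
    have key' : ∀ k v, v < D.T → s1.arr 15 (k * D.T + v) = if v = t ∧ k < D.cnt t then k else 0 := by
      intro k v hv
      rw [key k v hv]
      congr 1
      apply propext
      constructor
      · exact fun h => ⟨h.1, h.2.1⟩
      · exact fun h => ⟨h.1, h.2, by omega⟩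
    have e : (initCmd ++ set 30 (lit 0)).run K s =
        (s1.setArr 15 (D.th p) (D.idx p)).setReg 30 0 := by
      simp [initCmd, ← hs1, i1.th, i1.p, g1 3 (by decide), hp.idx p hpN]
    rw [e]
    unfold Growing
    have h15' : (((s1.setArr 15 (D.th p) (D.idx p)).setReg 30 0).arr 15) =
        Function.update (s1.arr 15) (D.th p) (D.idx p) := by simp
    have h14' : ∀ i, (((s1.setArr 15 (D.th p) (D.idx p)).setReg 30 0).arr 14) i = 0 := by
      simp [g1 14 (by decide), h14]
    have h16' : ∀ i, (((s1.setArr 15 (D.th p) (D.idx p)).setReg 30 0).arr 16) i = 0 := by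
      simp [g1 16 (by decide), h16]
    have h30' : ((s1.setArr 15 (D.th p) (D.idx p)).setReg 30 0).reg 30 = 0 := by simp
    have hG : ∀ j v, v < D.T → Function.update (s1.arr 15) (D.th p) (D.idx p) (j * D.T + v) =
        if j = 0 ∧ v = D.th p then D.idx p else if v = t ∧ j < D.cnt t then j else 0 := by
      intro j v hv
      rw [Function.update_apply, key' j v hv]
      congr 1
      apply propext
      constructor
      · intro h
        exact pair_inj hv hth (h.trans (by simp : D.th p = 0 * D.T + D.th p))
      · rintro ⟨rfl, rfl⟩; simp
    rw [h15', h30']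
    refine ⟨Nat.zero_le _, fun v => by rw [h14']; exact Nat.zero_le _, fun i _ => by
      rw [h14', h16']; simp, fun i _ h => by rw [h14'] at h; omega, ?_, ?_,
      fun j hj => by omega, fun i _ h => by rw [h14'] at h; omega,
      fun i _ h => by rw [h14'] at h; omega, ?_, ?_⟩
    · intro j hj i hi h
      rw [hG j _ (hD.th_lt i hi)] at h
      obtain ⟨q1, q2, q3⟩ := NTrace.pos_spec hj
      split_ifs at h with h1 h2
      · exact NTrace.Need.left i ((NTrace.idx_lt_idx h1.2).1 h) h1.2
      · have h3 := h2.1.trans q2.symm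
        exact NTrace.Need.right i ((NTrace.idx_lt_idx h3).1 (by omega)) h3
      · omega
    · intro j hj v hv
      rw [hG j v hv]
      split_ifs with h1 h2
      · rw [h1.2]; exact (NTrace.idx_lt_cnt hpN).le
      · rw [h2.1]; omega
      · omega
    · intro j _ hj
      rw [hG j t ht]
      split_ifs with h1 h2
      · omega
      · exact le_rfl
      · exact absurd ⟨rfl, hj⟩ h2
    · right
      rw [hG 0 _ hth, if_pos ⟨rfl, rfl⟩]
  · rintro j st hj h7 hst - ha h
    have h4 : st.arr 4 = s.arr 4 := ha 4 (by decide)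
    intro k v hv
    rw [State.arr_setReg]
    by_cases hjc : j < D.cnt t
    · have : (ite (lt (reg 7) (get 4 (reg 5))) (put 15 (reg 7 * reg 1 + reg 5) (reg 7)) skip).run
          K st = st.setArr 15 (j * D.T + t) j := by
        simp [h7, h4, hst.t, hp.cnt, hjc, hst.T]
      rw [this]
      simp only [State.arr_setArr, if_true, Function.update_apply, h k v hv]
      by_cases he : k * D.T + v = j * D.T + t
      · obtain ⟨rfl, rfl⟩ := pair_inj hv ht he
        simp [hjc]
      · rw [if_neg he]
        congr 1
        apply propext
        refine and_congr_right fun h1 => and_congr_right fun _ => ⟨fun h => by omega, fun h2 => ?_⟩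
        rcases Nat.lt_succ_iff_lt_or_eq.1 h2 with h3 | rfl
        · exact h3
        · exact absurd (by rw [h1]) he
    · have : (ite (lt (reg 7) (get 4 (reg 5))) (put 15 (reg 7 * reg 1 + reg 5) (reg 7)) skip).run
          K st = st := by
        simp [h7, h4, hst.t, hp.cnt, hjc]
      rw [this, h k v hv]
      congr 1
      apply propext
      refine and_congr_right fun _ => and_congr_right fun _ => ⟨fun h => by omega, fun h => by omega⟩

theorem growCmd_spec {D : NTrace} (hD : D.Valid) {p t K : ℕ} {s : State} (hs : Input D p t s)
    (hp : Prep D p t s) (hK : D.N ≤ K) (hpN : p < D.N) (ht : t < D.T) (h14 : ∀ i, s.arr 14 i = 0)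
    (h15 : ∀ i, s.arr 15 i = 0) (h16 : ∀ i, s.arr 16 i = 0) :
    ∀ k < D.cnt t, ∀ i < D.N,
      D.N - k ≤ (growCmd.run K s).arr 16 i ↔ D.Need p (D.pos t k) i := by
  set s1 := (initCmd ++ set 30 (lit 0)).run K s with hs1
  have G1 : Growing D p t s1 := initCmd_spec hD hs hp hpN ht h14 h15 h16
  have i1 : Input D p t s1 := hs.run (by rfl) K
  have g1 : ∀ a, a ∉ [15, 15] → s1.arr a = s.arr a := fun a ha => Cmd.run_arr _ _ _ ha
  have p1 : Prep D p t s1 := hp.congr fun a ha => g1 a (by simp; omega)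
  have hcong : ∀ (st : State) i v, i ≠ 30 → Growing D p t st → Growing D p t (st.setReg i v) := by
    intro st i v hi h
    unfold Growing
    rw [State.reg_setReg, if_neg (Ne.symm hi)]
    exact h
  have hprog : ∀ (st : State) i v, i ≠ 30 → progress D (st.setReg i v) = progress D st := by
    intro st i v hi
    unfold progress
    rw [State.reg_setReg, if_neg (Ne.symm hi), State.arr_setReg]
  have harrs : roundCmd.arrs.all (13 ≤ ·) = true := by rfl
  have hpk : ∀ st, Prep D p t st → Prep D p t (roundCmd.run K st) := fun st h =>
    h.congr fun a ha => Cmd.run_arr _ _ _ fun hm => by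
      have := List.all_eq_true.1 harrs a hm
      simp only [decide_eq_true_eq] at this
      omega
  have key := Cmd.run_loop_input (K := K) i1 7 0 (roundCmd ++ roundCmd) (by rfl)
    (fun j st => Prep D p t st ∧ Growing D p t st ∧
      (st.reg 30 = D.cnt t ∨ 2 * j ≤ progress D st)) ?_ ?_
  · rw [i1.N] at key
    obtain ⟨-, G2, hfin⟩ := key
    have hrun : (loop 7 0 (roundCmd ++ roundCmd)).run K s1 = growCmd.run K s := rfl
    rw [hrun] at G2 hfin
    have h30 : (growCmd.run K s).reg 30 = D.cnt t := by
      have h1 := G2.k_le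
      have h2 := D.cnt_le t
      have h3 : progress D (growCmd.run K s) ≤ D.N + (growCmd.run K s).reg 30 := by
        unfold progress
        have := Finset.card_filter_le (Finset.range D.N) fun i => (growCmd.run K s).arr 16 i ≠ 0
        rw [Finset.card_range] at this
        omega
      omega
    unfold Growing at G2
    rw [h30] at G2
    exact G2.final
  · refine ⟨p1.congr fun _ _ => rfl, hcong _ _ _ (by decide) G1, Or.inr (Nat.zero_le _)⟩
  · rintro j st hj h7 hst - - ⟨hpst, hg, h⟩
    obtain ⟨a1, a2, a3⟩ := roundCmd_spec hD hst hpst hK hpN ht hg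
    have hst' : Input D p t (roundCmd.run K st) := hst.run (by rfl) K
    have hpst' := hpk _ hpst
    obtain ⟨b1, b2, b3⟩ := roundCmd_spec hD hst' hpst' hK hpN ht a1
    refine ⟨(hpk _ hpst').congr fun _ _ => rfl, hcong _ _ _ (by decide) b1, ?_⟩
    have idle : ∀ st, Input D p t st → Prep D p t st → st.reg 30 = D.cnt t →
        roundCmd.run K st = st := fun st i q h => by simp [roundCmd, i.t, q.cnt, h]
    rw [hprog _ _ _ (by decide), State.reg_setReg, if_neg (by decide), Cmd.run_append]
    have hle := hg.k_le
    have hle' := a1.k_le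
    by_cases hlt : st.reg 30 < D.cnt t
    · by_cases hlt' : (roundCmd.run K st).reg 30 < D.cnt t
      · have := a3 hlt
        have := b3 hlt'
        omega
      · left
        rw [idle _ hst' hpst' (by omega)]
        omega
    · left
      have e := idle st hst hpst (by omega)
      rw [e, e]
      omega

/-! ### Reachability of releases -/

@[simp] theorem State.setReg_setReg (s : State) (i v w : ℕ) :
    (s.setReg i v).setReg i w = s.setReg i w := by
  simp [State.setReg]

theorem NTrace.Valid.obj_lt {D : NTrace} (hD : D.Valid) {i : ℕ} (hi : i < D.N) :
    D.obj i < D.V + D.L := by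
  unfold NTrace.obj
  have h1 := hD.kd_lt i hi
  rcases lt_or_ge (D.kd i) 2 with h | h
  · rw [Nat.div_eq_of_lt h]; have := hD.tg_var i hi h; omega
  · have := hD.tg_lock i hi h
    rw [show D.kd i / 2 = 1 by omega]; omega

theorem NTrace.obj_lock {D : NTrace} (hD : D.Valid) {i : ℕ} (hi : i < D.N) (h : 2 ≤ D.kd i) :
    D.obj i = D.tg i + D.V := by
  have h1 := hD.kd_lt i hi
  unfold NTrace.obj
  rw [show D.kd i / 2 = 1 by omega, mul_one]

theorem NTrace.reach_iff {D : NTrace} {S : ℕ → Prop} {y i : ℕ} : D.Reach S y i ↔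
    S i ∧ ((D.kd i = 3 ∧ D.obj i = y) ∨ (∃ j, i < j ∧ D.th j = D.th i ∧ D.Reach S y j) ∨
      ∃ j, i < j ∧ D.obj j = D.obj i ∧ (D.kd i % 2 = 1 ∨ D.kd j = 1) ∧ D.Reach S y j) := by
  constructor
  · rintro (⟨_, h1, h2, h3⟩ | ⟨_, j, h1, h2, h3, h4 | ⟨h4, h5⟩⟩)
    · exact ⟨h1, Or.inl ⟨h2, h3⟩⟩
    · exact ⟨h1, Or.inr (Or.inl ⟨j, h3, h4.symm, h2⟩)⟩
    · exact ⟨h1, Or.inr (Or.inr ⟨j, h3, h4.symm, h5, h2⟩)⟩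
  · rintro ⟨h1, ⟨h2, h3⟩ | ⟨j, h2, h3, h4⟩ | ⟨j, h2, h3, h4, h5⟩⟩
    · exact NTrace.Reach.rel i h1 h2 h3
    · exact NTrace.Reach.step i j h1 h4 ⟨h2, Or.inl h3.symm⟩
    · exact NTrace.Reach.step i j h1 h5 ⟨h2, Or.inr ⟨h3.symm, h4⟩⟩

theorem update_pair {n a b l l' v : ℕ} {f : ℕ → ℕ} (ha : a < n) (hb : b < n) :
    Function.update f (l * n + a) v (l' * n + b) =
      if l' = l ∧ b = a then v else f (l' * n + b) := by
  rw [Function.update_apply]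
  congr 1
  apply propext
  refine ⟨pair_inj hb ha, ?_⟩
  rintro ⟨rfl, rfl⟩; rfl

/-- The index of the object of the event in register `9`, in the row of the lock in register `8`. -/
def objRowE : Expr := reg 8 * (reg 2 + reg 3) + objE (reg 9)

/-- Compute in register `10` the first time at which the event in register `9` has to precede a
release of the lock in register `8`. -/
def reachValueCmd : Cmd :=
  set 9 (reg 0 - lit 1 - reg 7) ++
  set 10 (get 18 (reg 8 * reg 1 + get 0 (reg 9))) ++
  ite (Expr.eq (get 1 (reg 9)) (lit 1) + Expr.eq (get 1 (reg 9)) (lit 3))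
    (raise 10 (get 19 objRowE)) (raise 10 (get 20 objRowE)) ++
  ite (Expr.eq (get 1 (reg 9)) (lit 3))
    (ite (Expr.eq (get 2 (reg 9)) (reg 8)) (set 10 (reg 0)) skip) skip ++
  ite (lt (get 16 (reg 9)) (reg 10)) (set 10 (get 16 (reg 9))) skip

/-- Record the value in register `10`. -/
def reachStoreCmd : Cmd :=
  put 17 (reg 8 * reg 0 + reg 9) (reg 10) ++
  raiseAt 18 (reg 8 * reg 1 + get 0 (reg 9)) (reg 10) ++
  raiseAt 19 objRowE (reg 10) ++
  ite (Expr.eq (get 1 (reg 9)) (lit 1)) (raiseAt 20 objRowE (reg 10)) skip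

/-- Compute array `17`. -/
def reachCmd : Cmd := loop 8 3 (loop 7 0 (reachValueCmd ++ reachStoreCmd))

theorem reachValueCmd_spec {D : NTrace} (hD : D.Valid) {p t K i l : ℕ} {s : State}
    (hs : Input D p t s) (hi : i < D.N) (h7 : s.reg 7 = D.N - 1 - i) (h8 : s.reg 8 = l) :
    let s' := reachValueCmd.run K s
    s'.reg 9 = i ∧ s'.reg 10 = min (s.arr 16 i) (if D.kd i = 3 ∧ D.tg i = l then D.N else
      max (s.arr 18 (l * D.T + D.th i)) (if D.kd i % 2 = 1 then
        s.arr 19 (l * (D.V + D.L) + D.obj i) else s.arr 20 (l * (D.V + D.L) + D.obj i))) := by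
  intro s'
  have hi' : D.N - 1 - (D.N - 1 - i) = i := by omega
  have hk := hD.kd_lt i hi
  have hodd : (D.kd i = 1 ∨ D.kd i = 3) ↔ D.kd i % 2 = 1 := by omega
  set c1 : Cmd := set 9 (reg 0 - lit 1 - reg 7) ++
    set 10 (get 18 (reg 8 * reg 1 + get 0 (reg 9))) with hc1
  set c2 : Cmd := ite (Expr.eq (get 1 (reg 9)) (lit 1) + Expr.eq (get 1 (reg 9)) (lit 3))
    (raise 10 (get 19 objRowE)) (raise 10 (get 20 objRowE)) with hc2
  set c3 : Cmd := ite (Expr.eq (get 1 (reg 9)) (lit 3))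
    (ite (Expr.eq (get 2 (reg 9)) (reg 8)) (set 10 (reg 0)) skip) skip with hc3
  set c4 : Cmd := ite (lt (get 16 (reg 9)) (reg 10)) (set 10 (get 16 (reg 9))) skip with hc4
  have e1 : c1.run K s = (s.setReg 9 i).setReg 10 (s.arr 18 (l * D.T + D.th i)) := by
    simp [hc1, hs.N, hs.T, h7, hi', hs.th, h8]
  set b := s.setReg 9 i with hb
  have bi : Input D p t b := hs.congr (fun r hr => by simp [hb]; omega) fun _ _ => rfl
  have ci : ∀ u, Input D p t (b.setReg 10 u) := fun u =>
    bi.congr (fun r hr => by simp; omega) fun _ _ => rfl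
  have eo : ∀ u, objRowE.eval (b.setReg 10 u) = l * (D.V + D.L) + D.obj i := by
    intro u
    unfold objRowE
    rw [Expr.eval_add, (ci u).eval_objE]
    simp [hb, hs.V, hs.L, h8]
  have e2 : ∀ u, c2.run K (b.setReg 10 u) = b.setReg 10 (max u (if D.kd i % 2 = 1 then
      s.arr 19 (l * (D.V + D.L) + D.obj i) else s.arr 20 (l * (D.V + D.L) + D.obj i))) := by
    intro u
    by_cases h : D.kd i % 2 = 1
    · have h' := hodd.2 h
      rcases h' with h' | h' <;> simp [hc2, hb, hs.kd, h']
      all_goals rw [← hb, eo]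
    · have h1 : D.kd i ≠ 1 := by omega
      have h2 : D.kd i ≠ 3 := by omega
      simp [hc2, hb, hs.kd, h, h1, h2]
      rw [← hb, eo]
  have e3 : ∀ u, c3.run K (b.setReg 10 u) =
      b.setReg 10 (if D.kd i = 3 ∧ D.tg i = l then D.N else u) := by
    intro u
    by_cases h : D.kd i = 3
    · by_cases h1 : D.tg i = l
      · simp [hc3, hb, hs.kd, hs.tg, hs.N, h, h1, h8]
      · simp [hc3, hb, hs.kd, hs.tg, h, h1, h8]
    · simp [hc3, hb, hs.kd, h]
  have e4 : ∀ u, c4.run K (b.setReg 10 u) = b.setReg 10 (min (s.arr 16 i) u) := by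
    intro u
    by_cases h : s.arr 16 i < u
    · simp [hc4, hb, h, min_eq_left h.le]
    · simp [hc4, hb, h, min_eq_right (not_lt.1 h)]
  have hrun : s' = c4.run K (c3.run K (c2.run K (c1.run K s))) := rfl
  rw [hrun, e1, e2, e3, e4]
  exact ⟨by simp [hb], by simp⟩

/-- The events below `N` that are present from level `m` on. -/
def AtLevel (D : NTrace) (tau : ℕ → ℕ) (m i : ℕ) : Prop := i < D.N ∧ m ≤ tau i

/-- The invariant of the computation of a row of array `17`: events from `b` on are done. -/
structure ReachRow (D : NTrace) (tau : ℕ → ℕ) (l b : ℕ) (s : State) : Prop where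
  mu : ∀ i < D.N, b ≤ i → ∀ m, 0 < m → m ≤ D.N →
    (m ≤ s.arr 17 (l * D.N + i) ↔ D.Reach (AtLevel D tau m) (l + D.V) i)
  thr : ∀ v < D.T, ∀ m, 0 < m → m ≤ D.N → (m ≤ s.arr 18 (l * D.T + v) ↔
    ∃ i < D.N, b ≤ i ∧ D.th i = v ∧ D.Reach (AtLevel D tau m) (l + D.V) i)
  all : ∀ x < D.V + D.L, ∀ m, 0 < m → m ≤ D.N → (m ≤ s.arr 19 (l * (D.V + D.L) + x) ↔
    ∃ i < D.N, b ≤ i ∧ D.obj i = x ∧ D.Reach (AtLevel D tau m) (l + D.V) i)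
  write : ∀ x < D.V + D.L, ∀ m, 0 < m → m ≤ D.N → (m ≤ s.arr 20 (l * (D.V + D.L) + x) ↔
    ∃ i < D.N, b ≤ i ∧ D.kd i = 1 ∧ D.obj i = x ∧ D.Reach (AtLevel D tau m) (l + D.V) i)

/-- The rows other than `l` of the arrays agree. -/
structure SameRows (D : NTrace) (l : ℕ) (s s' : State) : Prop where
  mu : ∀ l' ≠ l, ∀ i < D.N, s'.arr 17 (l' * D.N + i) = s.arr 17 (l' * D.N + i)
  thr : ∀ l' ≠ l, ∀ v < D.T, s'.arr 18 (l' * D.T + v) = s.arr 18 (l' * D.T + v)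
  all : ∀ l' ≠ l, ∀ x < D.V + D.L,
    s'.arr 19 (l' * (D.V + D.L) + x) = s.arr 19 (l' * (D.V + D.L) + x)
  write : ∀ l' ≠ l, ∀ x < D.V + D.L,
    s'.arr 20 (l' * (D.V + D.L) + x) = s.arr 20 (l' * (D.V + D.L) + x)

theorem ReachRow.value {D : NTrace} (hD : D.Valid) {tau : ℕ → ℕ} {l i : ℕ} {s : State}
    (h : ReachRow D tau l (i + 1) s) (hi : i < D.N) {m : ℕ} (hm : 0 < m) (hmN : m ≤ D.N) :
    (m ≤ min (tau i) (if D.kd i = 3 ∧ D.tg i = l then D.N else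
      max (s.arr 18 (l * D.T + D.th i)) (if D.kd i % 2 = 1 then
        s.arr 19 (l * (D.V + D.L) + D.obj i) else s.arr 20 (l * (D.V + D.L) + D.obj i)))) ↔
      D.Reach (AtLevel D tau m) (l + D.V) i := by
  have hlt : ∀ j, D.Reach (AtLevel D tau m) (l + D.V) j → j < D.N := fun j hj =>
    (NTrace.reach_iff.1 hj).1.1
  have ho := hD.obj_lt hi
  rw [NTrace.reach_iff, le_min_iff]
  have hc : (D.kd i = 3 ∧ D.obj i = l + D.V) ↔ (D.kd i = 3 ∧ D.tg i = l) :=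
    and_congr_right fun h3 => by rw [NTrace.obj_lock hD hi (by omega)]; omega
  rw [hc]
  unfold AtLevel
  rw [and_assoc, and_iff_right hi]
  refine and_congr_right fun _ => ?_
  by_cases h3 : D.kd i = 3 ∧ D.tg i = l
  · rw [if_pos h3]; exact ⟨fun _ => Or.inl h3, fun _ => hmN⟩
  · rw [if_neg h3, or_iff_right h3, le_max_iff]
    refine or_congr ?_ ?_
    · rw [h.thr _ (hD.th_lt i hi) m hm hmN]
      exact ⟨fun ⟨j, _, h2, h3⟩ => ⟨j, h2, h3⟩, fun ⟨j, h2, h3⟩ => ⟨j, hlt j h3.2, h2, h3⟩⟩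
    · split_ifs with hodd
      · rw [h.all _ ho m hm hmN]
        exact ⟨fun ⟨j, _, h2, h3, h4⟩ => ⟨j, h2, h3, Or.inl hodd, h4⟩,
          fun ⟨j, h2, h3, _, h4⟩ => ⟨j, hlt j h4, h2, h3, h4⟩⟩
      · rw [h.write _ ho m hm hmN]
        exact ⟨fun ⟨j, _, h2, h3, h4, h5⟩ => ⟨j, h2, h4, Or.inr h3, h5⟩,
          fun ⟨j, h2, h3, h4, h5⟩ => ⟨j, hlt j h5, h2, h4.resolve_left hodd, h3, h5⟩⟩

theorem reachStoreCmd_spec {D : NTrace} (hD : D.Valid) {p t K i l y : ℕ} {tau : ℕ → ℕ} {s : State}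
    (hs : Input D p t s) (hi : i < D.N) (h8 : s.reg 8 = l) (h9 : s.reg 9 = i)
    (h10 : s.reg 10 = y) (h : ReachRow D tau l (i + 1) s)
    (hy : ∀ m, 0 < m → m ≤ D.N → (m ≤ y ↔ D.Reach (AtLevel D tau m) (l + D.V) i)) :
    ReachRow D tau l i (reachStoreCmd.run K s) ∧ SameRows D l s (reachStoreCmd.run K s) := by
  have ho := hD.obj_lt hi
  have ht := hD.th_lt i hi
  obtain ⟨a17, a18, a19, a20⟩ : (reachStoreCmd.run K s).arr 17 =
        Function.update (s.arr 17) (l * D.N + i) y ∧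
      (reachStoreCmd.run K s).arr 18 = Function.update (s.arr 18) (l * D.T + D.th i)
        (max (s.arr 18 (l * D.T + D.th i)) y) ∧
      (reachStoreCmd.run K s).arr 19 = Function.update (s.arr 19) (l * (D.V + D.L) + D.obj i)
        (max (s.arr 19 (l * (D.V + D.L) + D.obj i)) y) ∧
      (reachStoreCmd.run K s).arr 20 = if D.kd i = 1 then
        Function.update (s.arr 20) (l * (D.V + D.L) + D.obj i)
          (max (s.arr 20 (l * (D.V + D.L) + D.obj i)) y) else s.arr 20 := by
    by_cases h1 : D.kd i = 1
    · simp [reachStoreCmd, objRowE, objE, h8, h9, h10, hs.N, hs.T, hs.V, hs.L, hs.th, hs.kd,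
        hs.tg, NTrace.obj, h1]
    · simp [reachStoreCmd, objRowE, objE, h8, h9, h10, hs.N, hs.T, hs.V, hs.L, hs.th, hs.kd,
        hs.tg, NTrace.obj, h1]
  have hor : ∀ {A : Prop} [Decidable A] {P : ℕ → Prop} {m x : ℕ}, 0 < m → m ≤ D.N →
      (m ≤ x ↔ ∃ j < D.N, i + 1 ≤ j ∧ P j ∧ D.Reach (AtLevel D tau m) (l + D.V) j) → (A ↔ P i) →
      (m ≤ (if A then max x y else x) ↔
        ∃ j < D.N, i ≤ j ∧ P j ∧ D.Reach (AtLevel D tau m) (l + D.V) j) := by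
    intro A _ P m x hm hmN hx hA
    have e : m ≤ (if A then max x y else x) ↔ m ≤ x ∨ A ∧ m ≤ y := by
      split_ifs with h <;> simp [h]
    rw [e, hx, hA, hy m hm hmN]
    constructor
    · rintro (⟨j, h1, h2, h3⟩ | h)
      · exact ⟨j, h1, by omega, h3⟩
      · exact ⟨i, hi, le_rfl, h⟩
    · rintro ⟨j, h1, h2, h3⟩
      rcases h2.lt_or_eq with h4 | rfl
      · exact Or.inl ⟨j, h1, h4, h3⟩
      · exact Or.inr h3
  refine ⟨⟨fun j hj hij m hm hmN => ?_, fun v hv m hm hmN => ?_, fun x hx m hm hmN => ?_,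
    fun x hx m hm hmN => ?_⟩, ⟨fun l' hl j hj => ?_, fun l' hl v hv => ?_, fun l' hl x hx => ?_,
    fun l' hl x hx => ?_⟩⟩
  · rw [a17, update_pair hi hj]
    split_ifs with h1
    · rw [h1.2]; exact hy m hm hmN
    · exact h.mu j hj (by omega) m hm hmN
  · rw [a18, update_pair ht hv]
    have := hor (A := l = l ∧ v = D.th i) (P := fun i => D.th i = v) hm hmN (h.thr v hv m hm hmN)
      (by simp [eq_comm])
    convert this using 3
    simp_all
  · rw [a19, update_pair ho hx]
    have := hor (A := l = l ∧ x = D.obj i) (P := fun i => D.obj i = x) hm hmN (h.all x hx m hm hmN)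
      (by simp [eq_comm])
    convert this using 3
    simp_all
  · have := hor (A := D.kd i = 1 ∧ x = D.obj i) (P := fun i => D.kd i = 1 ∧ D.obj i = x) hm hmN
      (by simpa only [and_assoc] using h.write x hx m hm hmN) (by simp [eq_comm])
    simp only [and_assoc] at this
    rw [a20, ← this]
    by_cases h1 : D.kd i = 1
    · rw [if_pos h1, update_pair ho hx]
      by_cases h2 : x = D.obj i <;> simp [h1, h2]
    · simp [h1]
  · rw [a17, update_pair hi hj, if_neg (by simp [hl])]
  · rw [a18, update_pair ht hv, if_neg (by simp [hl])]
  · rw [a19, update_pair ho hx, if_neg (by simp [hl])]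
  · rw [a20]
    split_ifs
    · rw [update_pair ho hx, if_neg (by simp [hl])]
    · rfl

theorem ReachRow.of_same {D : NTrace} {tau : ℕ → ℕ} {l l' b : ℕ} {s s' : State}
    (h : ReachRow D tau l' b s) (hs : SameRows D l s s') (hl : l' ≠ l) :
    ReachRow D tau l' b s' := by
  constructor
  · intro i hi; rw [hs.mu l' hl i hi]; exact h.mu i hi
  · intro i hi; rw [hs.thr l' hl i hi]; exact h.thr i hi
  · intro i hi; rw [hs.all l' hl i hi]; exact h.all i hi
  · intro i hi; rw [hs.write l' hl i hi]; exact h.write i hi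

theorem SameRows.trans {D : NTrace} {l : ℕ} {s s' s'' : State} (h : SameRows D l s s')
    (h' : SameRows D l s' s'') : SameRows D l s s'' := by
  constructor
  · intro l' hl i hi; rw [h'.mu l' hl i hi, h.mu l' hl i hi]
  · intro l' hl i hi; rw [h'.thr l' hl i hi, h.thr l' hl i hi]
  · intro l' hl i hi; rw [h'.all l' hl i hi, h.all l' hl i hi]
  · intro l' hl i hi; rw [h'.write l' hl i hi, h.write l' hl i hi]

theorem reachCmd_spec {D : NTrace} (hD : D.Valid) {p t K : ℕ} {s : State}
    (hs : Input D p t s) (h18 : ∀ i, s.arr 18 i = 0)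
    (h19 : ∀ i, s.arr 19 i = 0) (h20 : ∀ i, s.arr 20 i = 0) :
    ∀ l < D.L, ∀ i < D.N, ∀ m, 0 < m → m ≤ D.N →
      (m ≤ (reachCmd.run K s).arr 17 (l * D.N + i) ↔
        D.Reach (AtLevel D (s.arr 16) m) (l + D.V) i) := by
  have key := Cmd.run_loop_input (K := K) hs 8 3 (loop 7 0 (reachValueCmd ++ reachStoreCmd))
    (by rfl) (fun j st => ∀ l < D.L, ReachRow D (s.arr 16) l (if l < j then 0 else D.N) st) ?_ ?_
  · rw [hs.L] at key
    intro l hl i hi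
    have := (key l hl).mu i hi
    rw [if_pos hl] at this
    exact this (Nat.zero_le _)
  · intro l _
    simp only [Nat.not_lt_zero, if_false]
    have hno : ∀ {m : ℕ} {P : ℕ → Prop}, 0 < m → (m ≤ 0 ↔ ∃ i < D.N, D.N ≤ i ∧ P i) :=
      fun hm => ⟨fun h => by omega, fun ⟨i, h1, h2, _⟩ => by omega⟩
    constructor
    · intro i hi h; omega
    all_goals
      intro x _ m hm _
      simp only [State.arr_setReg, h18, h19, h20]
      exact hno hm
  · intro l st hl h8 hst _ ha hrow
    rw [hs.L] at hl
    have h16 : st.arr 16 = s.arr 16 := ha 16 (by decide)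
    have inner := Cmd.run_loop_input (K := K) hst 7 0 (reachValueCmd ++ reachStoreCmd) (by rfl)
      (fun j st' => ReachRow D (s.arr 16) l (D.N - j) st' ∧ SameRows D l st st') ?_ ?_
    · rw [hst.N, Nat.sub_self] at inner
      obtain ⟨hrow', hsame⟩ := inner
      intro l' hl'
      have hdone : ReachRow D (s.arr 16) l' (if l' < l + 1 then 0 else D.N)
          ((loop 7 0 (reachValueCmd ++ reachStoreCmd)).run K st) := by
        by_cases hll : l' = l
        · subst hll; rw [if_pos (by omega)]; exact hrow'
        · have := (hrow l' hl').of_same hsame hll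
          by_cases h : l' < l
          · rw [if_pos h] at this; rw [if_pos (by omega)]; exact this
          · rw [if_neg h] at this; rw [if_neg (by omega)]; exact this
      exact ⟨hdone.mu, hdone.thr, hdone.all, hdone.write⟩
    · have := hrow l hl
      rw [if_neg (lt_irrefl l)] at this
      exact ⟨⟨this.mu, this.thr, this.all, this.write⟩,
        ⟨fun _ _ _ _ => rfl, fun _ _ _ _ => rfl, fun _ _ _ _ => rfl, fun _ _ _ _ => rfl⟩⟩
    · intro j st' hj h7 hst' hr ha' ⟨hrow', hsame⟩
      rw [hst.N] at hj
      have h8' : st'.reg 8 = l := (hr 8 (by decide)).trans h8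
      have h16' : st'.arr 16 = s.arr 16 := (ha' 16 (by decide)).trans h16
      obtain ⟨v9, v10⟩ := reachValueCmd_spec (K := K) (i := D.N - 1 - j) hD hst' (by omega)
        (by omega) h8'
      have hv : (reachValueCmd.run K st').arr = st'.arr :=
        funext fun a => Cmd.run_arr _ _ _ (by rw [show reachValueCmd.arrs = [] from rfl]; simp)
      rw [show D.N - j = D.N - 1 - j + 1 by omega] at hrow'
      have hrow2 : ReachRow D (s.arr 16) l (D.N - 1 - j + 1) (reachValueCmd.run K st') := by
        constructor
        all_goals rw [hv]
        exacts [hrow'.mu, hrow'.thr, hrow'.all, hrow'.write]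
      have hsame2 : SameRows D l st' (reachValueCmd.run K st') := by
        constructor
        all_goals
          intro _ _ _ _
          rw [hv]
      obtain ⟨b1, b2⟩ := reachStoreCmd_spec (K := K) hD (hst'.run (c := reachValueCmd) (by rfl) K)
        (by omega) ((Cmd.run_reg _ _ _ (by decide)).trans h8') v9 v10 hrow2
        (fun m hm hmN => by rw [h16']; exact hrow'.value hD (by omega) hm hmN)
      have b3 := (hsame.trans hsame2).trans b2
      rw [show D.N - (j + 1) = D.N - 1 - j by omega, Cmd.run_append]
      generalize reachStoreCmd.run K (reachValueCmd.run K st') = u at b1 b3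
      exact ⟨⟨b1.mu, b1.thr, b1.all, b1.write⟩, ⟨b3.mu, b3.thr, b3.all, b3.write⟩⟩

/-! ### Open critical sections -/

open Classical in
/-- The sum of `N + i` over the numbers `i < n` that satisfy `P`. -/
noncomputable def wsum (N : ℕ) (P : ℕ → Prop) (n : ℕ) : ℕ :=
  ∑ i ∈ Finset.range n, if P i then N + i else 0

section WSum

variable {N n : ℕ} {P Q : ℕ → Prop}

theorem wsum_zero : wsum N P 0 = 0 := rfl

theorem wsum_succ_pos (h : P n) : wsum N P (n + 1) = wsum N P n + (N + n) := by
  simp [wsum, Finset.sum_range_succ, h]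

theorem wsum_succ_neg (h : ¬ P n) : wsum N P (n + 1) = wsum N P n := by
  simp [wsum, Finset.sum_range_succ, h]

theorem wsum_congr (h : ∀ i < n, P i ↔ Q i) : wsum N P n = wsum N Q n := by
  unfold wsum
  refine Finset.sum_congr rfl fun i hi => ?_
  rw [Finset.mem_range] at hi
  by_cases hq : Q i
  · rw [if_pos hq, if_pos ((h i hi).2 hq)]
  · rw [if_neg hq, if_neg fun hp => hq ((h i hi).1 hp)]

theorem wsum_add (h : ∀ i < n, ¬ (P i ∧ Q i)) :
    wsum N P n + wsum N Q n = wsum N (fun i => P i ∨ Q i) n := by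
  unfold wsum
  rw [← Finset.sum_add_distrib]
  refine Finset.sum_congr rfl fun i hi => ?_
  have := h i (Finset.mem_range.1 hi)
  by_cases hp : P i <;> by_cases hq : Q i <;> simp_all

theorem wsum_le (hn : n ≤ N) : wsum N P n ≤ 2 * N * N := by
  have : ∀ m ≤ N, wsum N P m ≤ m * (2 * N) := by
    intro m
    induction m with
    | zero => intro _; rw [wsum_zero]; exact Nat.zero_le _
    | succ m ih =>
      intro h
      have := ih (by omega)
      rw [Nat.succ_mul]
      by_cases hp : P m
      · rw [wsum_succ_pos hp]; omega
      · rw [wsum_succ_neg hp]; omega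
  refine (this n hn).trans ?_
  rw [mul_comm]
  exact Nat.mul_le_mul_left _ hn

theorem wsum_eq_zero (h : ∀ i < n, ¬ P i) : wsum N P n = 0 :=
  Finset.sum_eq_zero fun i hi => if_neg (h i (Finset.mem_range.1 hi))

theorem wsum_eq_of_unique {a : ℕ} (ha : a < n) (hP : P a) (h : ∀ i < n, P i → i = a) :
    wsum N P n = N + a := by
  unfold wsum
  rw [Finset.sum_eq_single_of_mem a (Finset.mem_range.2 ha)]
  · rw [if_pos hP]
  · exact fun i hi hne => if_neg fun hp => hne (h i (Finset.mem_range.1 hi) hp)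

theorem le_wsum_of_ne {a b : ℕ} (ha : a < n) (hb : b < n) (hPa : P a) (hPb : P b) (hab : a ≠ b) :
    2 * N ≤ wsum N P n := by
  have h : wsum N (fun i => i = a ∨ i = b) n ≤ wsum N P n := by
    unfold wsum
    refine Finset.sum_le_sum fun i _ => ?_
    by_cases h : i = a ∨ i = b
    · have : P i := by rcases h with rfl | rfl <;> assumption
      rw [if_pos h, if_pos this]
    · rw [if_neg h]; exact Nat.zero_le _
  rw [← wsum_add (by rintro i _ ⟨rfl, rfl⟩; exact hab rfl),
    wsum_eq_of_unique (P := fun i => i = a) ha rfl fun _ _ h => h,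
    wsum_eq_of_unique (P := fun i => i = b) hb rfl fun _ _ h => h] at h
  omega

end WSum

/-- The index of the entry for the lock of the event in register `7`. -/
def lockRowE (key : Expr) : Expr := key * reg 3 + get 2 (reg 7)

/-- For each time and lock, sum up the weights of those events of this lock that satisfy `cond` and
have a key up to this time, in array `y`. -/
def tallyCmd (y : ℕ) (cond key : Expr) : Cmd :=
  loop 7 0 (ite cond (put y (lockRowE key) (get y (lockRowE key) + (reg 0 + reg 7))) skip) ++
  loop 7 0 (loop 8 3 (ite (reg 7) (put y (reg 7 * reg 3 + reg 8)
    (get y (reg 7 * reg 3 + reg 8) + get y ((reg 7 - lit 1) * reg 3 + reg 8))) skip))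

theorem tallyCmd_spec {D : NTrace} {p t K y : ℕ} {cond key : Expr} {c : ℕ → Prop} {κ : ℕ → ℕ}
    {s : State} (hs : Input D p t s) (hy3 : 3 ≤ y)
    (hK : 2 * D.N * D.N ≤ K) (hy : ∀ i, s.arr y i = 0)
    (hc : ∀ i < D.N, c i → D.tg i < D.L)
    (hev : ∀ st j, Input D p t st → j < D.N → st.reg 7 = j → (∀ a, a ≠ y → st.arr a = s.arr a) →
      (cond.eval st ≠ 0 ↔ c j) ∧ key.eval st = κ j) :
    ∀ k < D.N, ∀ l < D.L, ((tallyCmd y cond key).run K s).arr y (k * D.L + l) =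
      wsum D.N (fun i => c i ∧ D.tg i = l ∧ κ i ≤ k) D.N := by
  have key1 := Cmd.run_loop_input (K := K) hs 7 0 (ite cond
      (put y (lockRowE key) (get y (lockRowE key) + (reg 0 + reg 7))) skip)
    (by simp [Cmd.keepsInput, Cmd.regs, Cmd.arrs, hy3])
    (fun j st => ∀ k, ∀ l < D.L, st.arr y (k * D.L + l) =
      wsum D.N (fun i => c i ∧ D.tg i = l ∧ κ i = k) j)
    (fun k l _ => by rw [State.arr_setReg, hy, wsum_zero]) ?_
  · rw [hs.N] at key1
    set s1 := (loop 7 0 (ite cond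
      (put y (lockRowE key) (get y (lockRowE key) + (reg 0 + reg 7))) skip)).run K s with hs1
    have i1 : Input D p t s1 :=
      hs.run (by simp [Cmd.keepsInput, Cmd.regs, Cmd.arrs, hy3]) K
    have key2 := Cmd.run_loop_input (K := K) i1 7 0 (loop 8 3 (ite (reg 7)
        (put y (reg 7 * reg 3 + reg 8)
          (get y (reg 7 * reg 3 + reg 8) + get y ((reg 7 - lit 1) * reg 3 + reg 8))) skip))
      (by simp [Cmd.keepsInput, Cmd.regs, Cmd.arrs, hy3])
      (fun j st => ∀ k < D.N, ∀ l < D.L, st.arr y (k * D.L + l) =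
        if k < j then wsum D.N (fun i => c i ∧ D.tg i = l ∧ κ i ≤ k) D.N
        else wsum D.N (fun i => c i ∧ D.tg i = l ∧ κ i = k) D.N)
      (fun k _ l hl => by rw [State.arr_setReg, key1 k l hl, if_neg (Nat.not_lt_zero _)]) ?_
    · rw [i1.N] at key2
      intro k hk l hl
      have := key2 k hk l hl
      rwa [if_pos hk] at this
    · intro j st hj h7 hst _ _ hinv
      rw [i1.N] at hj
      have inner := Cmd.run_loop_input (K := K) hst 8 3 (ite (reg 7)
          (put y (reg 7 * reg 3 + reg 8)
            (get y (reg 7 * reg 3 + reg 8) + get y ((reg 7 - lit 1) * reg 3 + reg 8))) skip)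
        (by simp [Cmd.keepsInput, Cmd.regs, Cmd.arrs, hy3])
        (fun b st => ∀ k < D.N, ∀ l < D.L, st.arr y (k * D.L + l) =
          if k < j ∨ k = j ∧ l < b then wsum D.N (fun i => c i ∧ D.tg i = l ∧ κ i ≤ k) D.N
          else wsum D.N (fun i => c i ∧ D.tg i = l ∧ κ i = k) D.N) ?_ ?_
      · rw [hst.L] at inner
        intro k hk l hl
        rw [State.arr_setReg, inner k hk l hl]
        congr 1
        apply propext
        omega
      · intro k hk l hl
        rw [State.arr_setReg, hinv k hk l hl]
        congr 1
        apply propext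
        omega
      · intro b st' hb h8 hst' hr _ hinv'
        rw [hst.L] at hb
        have h7' : st'.reg 7 = j := (hr 7 (by simp [Cmd.regs])).trans h7
        rcases j with _ | j
        · have e : (ite (reg 7) (put y (reg 7 * reg 3 + reg 8)
              (get y (reg 7 * reg 3 + reg 8) + get y ((reg 7 - lit 1) * reg 3 + reg 8))) skip).run
              K st' = st' := by simp [h7']
          rw [e]
          intro k hk l hl
          rw [State.arr_setReg, hinv' k hk l hl]
          by_cases hkb : k = 0 ∧ l = b
          · obtain ⟨rfl, rfl⟩ := hkb
            rw [if_neg (by omega), if_pos (by omega)]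
            exact wsum_congr fun i _ => by simp
          · congr 1
            apply propext
            omega
        · have v1 := hinv' (j + 1) hj b hb
          have v2 := hinv' j (by omega) b hb
          rw [if_neg (by omega)] at v1
          rw [if_pos (by omega)] at v2
          have hsum : wsum D.N (fun i => c i ∧ D.tg i = b ∧ κ i = j + 1) D.N +
              wsum D.N (fun i => c i ∧ D.tg i = b ∧ κ i ≤ j) D.N =
              wsum D.N (fun i => c i ∧ D.tg i = b ∧ κ i ≤ j + 1) D.N := by
            rw [wsum_add (by rintro i _ ⟨⟨-, -, h1⟩, -, -, h2⟩; omega)]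
            refine wsum_congr fun i _ => ?_
            constructor
            · rintro (⟨h1, h2, h3⟩ | ⟨h1, h2, h3⟩)
              · exact ⟨h1, h2, by omega⟩
              · exact ⟨h1, h2, by omega⟩
            · rintro ⟨h1, h2, h3⟩
              rcases h3.lt_or_eq with h | h
              · exact Or.inr ⟨h1, h2, by omega⟩
              · exact Or.inl ⟨h1, h2, h⟩
          have hle : wsum D.N (fun i => c i ∧ D.tg i = b ∧ κ i ≤ j + 1) D.N ≤ K :=
            (wsum_le le_rfl).trans hK
          have e : (ite (reg 7) (put y (reg 7 * reg 3 + reg 8)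
              (get y (reg 7 * reg 3 + reg 8) + get y ((reg 7 - lit 1) * reg 3 + reg 8))) skip).run
              K st' = st'.setArr y ((j + 1) * D.L + b)
                (wsum D.N (fun i => c i ∧ D.tg i = b ∧ κ i ≤ j + 1) D.N) := by
            simp only [Cmd.run_ite, Expr.eval_reg, h7', Nat.succ_ne_zero, if_false, Cmd.run_put,
              Expr.eval_add, Expr.eval_mul, Expr.eval_get, Expr.eval_sub, Expr.eval_lit, hst'.L, h8,
              Nat.add_sub_cancel, v1, v2, hsum, Expr.small_add, cond_false, min_eq_left hle]
          rw [e]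
          intro k hk l hl
          rw [State.arr_setReg, State.arr_setArr, if_pos rfl, update_pair hb hl]
          by_cases hkb : k = j + 1 ∧ l = b
          · obtain ⟨rfl, rfl⟩ := hkb
            rw [if_pos ⟨rfl, rfl⟩, if_pos (by omega)]
          · rw [if_neg hkb, hinv' k hk l hl]
            congr 1
            apply propext
            omega
  · intro j st hj h7 hst _ ha hinv
    rw [hs.N] at hj
    obtain ⟨h1, h2⟩ := hev st j hst hj h7 fun a hay => ha a (by simp [Cmd.arrs, hay])
    by_cases hcj : c j
    · have htg := hc j hj hcj
      have hv := hinv (κ j) (D.tg j) htg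
      have hle : wsum D.N (fun i => c i ∧ D.tg i = D.tg j ∧ κ i = κ j) (j + 1) ≤ K :=
        (wsum_le (by omega)).trans hK
      rw [wsum_succ_pos ⟨hcj, rfl, rfl⟩] at hle
      have e : (ite cond
          (put y (lockRowE key) (get y (lockRowE key) + (reg 0 + reg 7))) skip).run K st =
          st.setArr y (κ j * D.L + D.tg j)
            (wsum D.N (fun i => c i ∧ D.tg i = D.tg j ∧ κ i = κ j) j + (D.N + j)) := by
        simp only [Cmd.run_ite, h1.2 hcj, if_false, Cmd.run_put, lockRowE, Expr.eval_reg,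
          Expr.eval_add, Expr.eval_mul, Expr.eval_get, h2, hst.L, hst.tg, h7, hst.N, hv,
          Expr.small_add, cond_false, min_eq_left hle]
      rw [e]
      intro k l hl
      rw [State.arr_setReg, State.arr_setArr, if_pos rfl, update_pair htg hl]
      by_cases hkl : k = κ j ∧ l = D.tg j
      · obtain ⟨rfl, rfl⟩ := hkl
        rw [if_pos ⟨rfl, rfl⟩, wsum_succ_pos ⟨hcj, rfl, rfl⟩]
      · rw [if_neg hkl, hinv k l hl, wsum_succ_neg]
        rintro ⟨-, h3, h4⟩
        exact hkl ⟨h4.symm, h3.symm⟩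
    · have e : (ite cond
          (put y (lockRowE key) (get y (lockRowE key) + (reg 0 + reg 7))) skip).run K st = st := by
        have h0 : cond.eval st = 0 := by by_contra h; exact hcj (h1.1 h)
        simp [h0]
      rw [e]
      intro k l hl
      rw [State.arr_setReg, hinv k l hl, wsum_succ_neg fun h => hcj h.1]

/-- Sum up the acquires (array `21`) and the matched acquires (array `22`) at each time. -/
def openCmd : Cmd :=
  tallyCmd 21 (Expr.eq (get 1 (reg 7)) (lit 2)) (reg 0 - get 16 (reg 7)) ++
  tallyCmd 22 (get 9 (reg 7)) (reg 0 - get 16 (get 9 (reg 7) - lit 1))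

theorem openCmd_spec {D : NTrace} (hD : D.Valid) {p t K k l : ℕ} {s : State} {S : ℕ → Prop}
    (hs : Input D p t s) (hp : Prep D p t s) (hK : 2 * D.N * D.N ≤ K) (h21 : ∀ i, s.arr 21 i = 0)
    (h22 : ∀ i, s.arr 22 i = 0) (hk : k < D.N) (hl : l < D.L)
    (hS : ∀ i < D.N, D.N - k ≤ s.arr 16 i ↔ S i)
    (hthr : ∀ i j, S j → i < j → D.th i = D.th j → S i) :
    (openCmd.run K s).arr 21 (k * D.L + l) - (openCmd.run K s).arr 22 (k * D.L + l) =
      wsum D.N (fun i => D.Open S i ∧ D.tg i = l) D.N := by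
  set s1 := (tallyCmd 21 (Expr.eq (get 1 (reg 7)) (lit 2)) (reg 0 - get 16 (reg 7))).run K s
    with hs1
  have i1 : Input D p t s1 := hs.run (by rfl) K
  have f1 : ∀ a, a ∉ [21, 21] → s1.arr a = s.arr a := fun a ha => Cmd.run_arr _ _ _ ha
  have t1 := tallyCmd_spec (K := K) (y := 21) (cond := Expr.eq (get 1 (reg 7)) (lit 2))
    (key := reg 0 - get 16 (reg 7)) (c := fun i => D.kd i = 2) (κ := fun i => D.N - s.arr 16 i)
    hs (by omega) hK h21 (fun i hi h => hD.tg_lock i hi h.ge) (by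
      intro st j hst hj h7 ha
      have h16 : st.arr 16 = s.arr 16 := ha 16 (by omega)
      simp [hst.kd, h7, hst.N, h16]) k hk l hl
  have t2 := tallyCmd_spec (K := K) (y := 22) (cond := get 9 (reg 7))
    (key := reg 0 - get 16 (get 9 (reg 7) - lit 1)) (c := fun i => ∃ r, D.Match i r)
    (κ := fun i => D.N - s.arr 16 (s.arr 9 i - 1))
    i1 (by omega) hK (by rw [f1 22 (by decide)]; exact h22)
    (fun i hi ⟨r, h⟩ => hD.tg_lock i hi h.kd_acq.ge) (by
      intro st j hst hj h7 ha
      have h16 : st.arr 16 = s.arr 16 := (ha 16 (by omega)).trans (f1 16 (by decide))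
      have h9 : st.arr 9 = s.arr 9 := (ha 9 (by omega)).trans (f1 9 (by decide))
      simp only [Expr.eval_get, Expr.eval_reg, h7, h9, Expr.eval_sub, hst.N, h16, Expr.eval_lit,
        and_true]
      constructor
      · intro h
        obtain ⟨r, hr⟩ := Nat.exists_eq_succ_of_ne_zero h
        exact ⟨r, (hp.rel j r).1 hr⟩
      · rintro ⟨r, hr⟩
        rw [(hp.rel j r).2 hr]; omega) k hk l hl
  have e21 : (openCmd.run K s).arr 21 = s1.arr 21 := by
    unfold openCmd
    rw [Cmd.run_append]
    exact Cmd.run_arr _ _ _ (by decide)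
  have e22 : (openCmd.run K s).arr 22 = ((tallyCmd 22 (get 9 (reg 7))
    (reg 0 - get 16 (get 9 (reg 7) - lit 1))).run K s1).arr 22 := rfl
  rw [e21, e22, t1, t2]
  have hiff : ∀ i < D.N, D.N - s.arr 16 i ≤ k ↔ S i := fun i hi => by
    rw [← hS i hi]; omega
  have hrel : ∀ i r, D.Match i r → (D.N - s.arr 16 (s.arr 9 i - 1) ≤ k ↔ S r) := fun i r h => by
    rw [(hp.rel i r).2 h, Nat.add_sub_cancel, hiff r h.lt_N]
  refine Nat.sub_eq_of_eq_add' (Eq.symm ?_)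
  rw [wsum_add]
  · refine wsum_congr fun i hi => ?_
    rw [hiff i hi]
    constructor
    · rintro (⟨⟨r, hr⟩, h1, h2⟩ | ⟨⟨h1, h2, -⟩, h3⟩)
      · exact ⟨hr.kd_acq, h1, hthr i r ((hrel i r hr).1 h2) hr.lt hr.th_eq⟩
      · exact ⟨h2, h3, h1⟩
    · rintro ⟨h1, h2, h3⟩
      by_cases h : ∃ r, D.Match i r ∧ S r
      · obtain ⟨r, hr, hSr⟩ := h
        exact Or.inl ⟨⟨r, hr⟩, h2, (hrel i r hr).2 hSr⟩
      · exact Or.inr ⟨⟨h3, h1, fun r hr hSr => h ⟨r, hr, hSr⟩⟩, h2⟩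
  · rintro i - ⟨⟨⟨r, hr⟩, -, h2⟩, ⟨-, -, h3⟩, -⟩
    exact h3 r hr ((hrel i r hr).1 h2)

/-! ### Deciding acyclicity -/

/-- `E` restricted to `X` has a rank function. -/
def Ranked (E : ℕ → ℕ → Prop) (X : ℕ → Prop) : Prop :=
  ∃ rank : ℕ → ℕ, ∀ l l', X l → X l' → E l l' → rank l < rank l'

/-- Every element of `X` has a predecessor in `X`. -/
def Stuck (E : ℕ → ℕ → Prop) (X : ℕ → Prop) : Prop := ∀ l', X l' → ∃ l, X l ∧ E l l'

theorem Ranked.remove {E : ℕ → ℕ → Prop} {X : ℕ → Prop} {a : ℕ} (ha : ∀ l, X l → ¬ E l a) :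
    Ranked E X ↔ Ranked E fun l => X l ∧ l ≠ a := by
  constructor
  · rintro ⟨rank, h⟩
    exact ⟨rank, fun l l' hl hl' => h l l' hl.1 hl'.1⟩
  · rintro ⟨rank, h⟩
    refine ⟨fun l => if l = a then 0 else rank l + 1, fun l l' hl hl' he => ?_⟩
    have h1 : l' ≠ a := by rintro rfl; exact ha l hl he
    simp only [if_neg h1]
    split_ifs with h2
    · omega
    · have := h l l' ⟨hl, h2⟩ ⟨hl', h1⟩ he
      omega

theorem Stuck.eq_empty {E : ℕ → ℕ → Prop} {X : ℕ → Prop} (hs : Stuck E X) (hr : Ranked E X) (l : ℕ) :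
    ¬ X l := by
  obtain ⟨rank, h⟩ := hr
  have : ∀ n l, rank l = n → ¬ X l := by
    intro n
    induction n using Nat.strong_induction_on with
    | _ n ih =>
      intro l hl hX
      obtain ⟨l', h1, h2⟩ := hs l hX
      exact ih _ (hl ▸ h l' l h1 hX h2) l' rfl h1
  exact this _ l rfl

/-- Tests whether the acquire `x` does not have to precede a release of lock `l'` at the time in
register `7`. -/
def noEdgeE (l' x : Expr) : Expr := lt (get 17 (l' * reg 0 + x)) (reg 0 - reg 7)

/-- Count the predecessors of each lock in array `24`. -/
def degCmd : Cmd :=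
  loop 8 3 (put 24 (reg 8) (lit 0) ++
    loop 9 3 (ite (get 23 (reg 9)) (ite (noEdgeE (reg 8) (get 23 (reg 9) - reg 0)) skip
      (put 24 (reg 8) (get 24 (reg 8) + lit 1))) skip))

/-- Find in register `11` one more than a lock without predecessors. -/
def sourceCmd : Cmd :=
  set 11 (lit 0) ++
  loop 8 3 (ite (get 23 (reg 8)) (ite (get 24 (reg 8)) skip (set 11 (reg 8 + lit 1))) skip)

/-- Remove the lock found. -/
def removeCmd : Cmd :=
  set 12 (get 23 (reg 11 - lit 1) - reg 0) ++ put 23 (reg 11 - lit 1) (lit 0) ++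
  loop 8 3 (ite (noEdgeE (reg 8) (reg 12)) skip (put 24 (reg 8) (get 24 (reg 8) - lit 1)))

/-- Remove locks without predecessors as long as possible. -/
def kahnCmd : Cmd := degCmd ++ loop 10 3 (sourceCmd ++ ite (reg 11) removeCmd skip)

open Classical in
/-- The number of predecessors of `l'` in `X`, among the numbers below `n`. -/
noncomputable def indeg (E : ℕ → ℕ → Prop) (X : ℕ → Prop) (n l' : ℕ) : ℕ :=
  ((Finset.range n).filter fun l => X l ∧ E l l').card

open Classical in
theorem indeg_eq_zero {E : ℕ → ℕ → Prop} {X : ℕ → Prop} {n l' : ℕ} :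
    indeg E X n l' = 0 ↔ ∀ l < n, X l → ¬ E l l' := by
  simp [indeg, Finset.filter_eq_empty_iff]

open Classical in
theorem indeg_succ {E : ℕ → ℕ → Prop} {X : ℕ → Prop} {n l' : ℕ} :
    indeg E X (n + 1) l' = indeg E X n l' + if X n ∧ E n l' then 1 else 0 := by
  unfold indeg
  rw [Finset.range_add_one, Finset.filter_insert]
  split_ifs with h
  · rw [Finset.card_insert_of_notMem (by simp)]
  · rfl

open Classical in
theorem indeg_remove {E : ℕ → ℕ → Prop} {X : ℕ → Prop} {n a l' : ℕ} (ha : a < n) (hX : X a) :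
    indeg E (fun l => X l ∧ l ≠ a) n l' = indeg E X n l' - if E a l' then 1 else 0 := by
  have : indeg E (fun l => X l ∧ l ≠ a) n l' =
      (((Finset.range n).filter fun l => X l ∧ E l l').erase a).card := by
    unfold indeg
    congr 1
    ext i
    simp only [Finset.mem_filter, Finset.mem_range, Finset.mem_erase]
    tauto
  rw [this, Finset.card_erase_eq_ite]
  simp only [Finset.mem_filter, Finset.mem_range, ha, hX, true_and]
  unfold indeg
  split_ifs <;> rfl

open Classical in
theorem indeg_le {E : ℕ → ℕ → Prop} {X : ℕ → Prop} {n l' : ℕ} : indeg E X n l' ≤ n :=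
  (Finset.card_filter_le _ _).trans (Finset.card_range n).le

/-- The relation on locks at time `k` that is read off from array `17`, when lock `l` has the open
acquire `A l - N`. -/
def Edge (D : NTrace) (mu A : ℕ → ℕ) (k l l' : ℕ) : Prop := D.N - k ≤ mu (l' * D.N + (A l - D.N))

theorem degCmd_spec {D : NTrace} {p t K k : ℕ} {s : State} (hs : Input D p t s) (hK : D.L ≤ K)
    (h7 : s.reg 7 = k) : ∀ l' < D.L, (degCmd.run K s).arr 24 l' =
      indeg (Edge D (s.arr 17) (s.arr 23) k) (fun l => s.arr 23 l ≠ 0) D.L l' := by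
  have key := Cmd.run_loop_input (K := K) hs 8 3 (put 24 (reg 8) (lit 0) ++
    loop 9 3 (ite (get 23 (reg 9)) (ite (noEdgeE (reg 8) (get 23 (reg 9) - reg 0)) skip
      (put 24 (reg 8) (get 24 (reg 8) + lit 1))) skip)) (by rfl)
    (fun j st => ∀ l' < j, st.arr 24 l' =
      indeg (Edge D (s.arr 17) (s.arr 23) k) (fun l => s.arr 23 l ≠ 0) D.L l')
    (fun l' h => by omega) ?_
  · rw [hs.L] at key; exact key
  · intro j st hj h8 hst hr ha hinv
    set u := (put 24 (reg 8) (lit 0)).run K st with hu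
    have eu : u = st.setArr 24 j 0 := by simp [hu, h8]
    have iu : Input D p t u := hst.run (by rfl) K
    have inner := Cmd.run_loop_input (K := K) iu 9 3
      (ite (get 23 (reg 9)) (ite (noEdgeE (reg 8) (get 23 (reg 9) - reg 0)) skip
        (put 24 (reg 8) (get 24 (reg 8) + lit 1))) skip) (by rfl)
      (fun b st' => (∀ l' < j, st'.arr 24 l' =
        indeg (Edge D (s.arr 17) (s.arr 23) k) (fun l => s.arr 23 l ≠ 0) D.L l') ∧
        st'.arr 24 j = indeg (Edge D (s.arr 17) (s.arr 23) k) (fun l => s.arr 23 l ≠ 0) b j) ?_ ?_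
    · rw [iu.L] at inner
      intro l' hl'
      rw [State.arr_setReg]
      rcases Nat.lt_succ_iff_lt_or_eq.1 hl' with h | rfl
      · exact inner.1 l' h
      · exact inner.2
    · rw [State.arr_setReg, eu]
      refine ⟨fun l' hl' => ?_, ?_⟩
      · rw [State.arr_setArr, if_pos rfl, Function.update_of_ne (by omega), hinv l' hl']
      · rw [State.arr_setArr, if_pos rfl, Function.update_self, eq_comm, indeg_eq_zero]
        intro l hl; omega
    · intro b st' hb h9 hst' hr' ha' ⟨v1, v2⟩
      rw [iu.L] at hb
      have g8 : st'.reg 8 = j := (hr' 8 (by decide)).trans (by simp [eu, h8])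
      have g7 : st'.reg 7 = k :=
        (hr' 7 (by decide)).trans ((by simp [eu] : u.reg 7 = st.reg 7).trans ((hr 7 (by decide)).trans h7))
      have g17 : st'.arr 17 = s.arr 17 :=
        (ha' 17 (by decide)).trans ((by simp [eu] : u.arr 17 = st.arr 17).trans (ha 17 (by decide)))
      have g23 : st'.arr 23 = s.arr 23 :=
        (ha' 23 (by decide)).trans ((by simp [eu] : u.arr 23 = st.arr 23).trans (ha 23 (by decide)))
      have hle : indeg (Edge D (s.arr 17) (s.arr 23) k) (fun l => s.arr 23 l ≠ 0) b j ≤ b := indeg_le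
      by_cases hx : s.arr 23 b ≠ 0 ∧ Edge D (s.arr 17) (s.arr 23) k b j
      · have hx2 := hx.2
        unfold Edge at hx2
        have e : (ite (get 23 (reg 9)) (ite (noEdgeE (reg 8) (get 23 (reg 9) - reg 0)) skip
            (put 24 (reg 8) (get 24 (reg 8) + lit 1))) skip).run K st' =
            st'.setArr 24 j (indeg (Edge D (s.arr 17) (s.arr 23) k)
              (fun l => s.arr 23 l ≠ 0) (b + 1) j) := by
          rw [indeg_succ, if_pos hx]
          simp only [Cmd.run_ite, Expr.eval_get, Expr.eval_reg, h9, g23, hx.1, if_false, noEdgeE,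
            Expr.eval_lt, Expr.eval_add, Expr.eval_mul, Expr.eval_sub, g8, hst'.N, g17, g7,
            not_lt.2 hx2, not_false_eq_true, if_true, Cmd.run_put, v2, Expr.eval_lit,
            Expr.small_add, cond_false, min_eq_left (show indeg (Edge D (s.arr 17) (s.arr 23) k)
              (fun l => s.arr 23 l ≠ 0) b j + 1 ≤ K by omega)]
        rw [e]
        refine ⟨fun l' hl' => ?_, ?_⟩
        · rw [State.arr_setReg, State.arr_setArr, if_pos rfl, Function.update_of_ne (by omega),
            v1 l' hl']
        · rw [State.arr_setReg, State.arr_setArr, if_pos rfl, Function.update_self]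
      · have e : (ite (get 23 (reg 9)) (ite (noEdgeE (reg 8) (get 23 (reg 9) - reg 0)) skip
            (put 24 (reg 8) (get 24 (reg 8) + lit 1))) skip).run K st' = st' := by
          by_cases h0 : s.arr 23 b = 0
          · simp [h9, g23, h0]
          · have hx2 : ¬ Edge D (s.arr 17) (s.arr 23) k b j := fun h => hx ⟨h0, h⟩
            unfold Edge at hx2
            simp only [Cmd.run_ite, Expr.eval_get, Expr.eval_reg, h9, g23, h0, if_false, noEdgeE,
              Expr.eval_lt, Expr.eval_add, Expr.eval_mul, Expr.eval_sub, g8, hst'.N, g17, g7,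
              not_le.1 hx2, not_true_eq_false, Cmd.run_skip]
        rw [e]
        refine ⟨v1, ?_⟩
        rw [State.arr_setReg, v2, indeg_succ, if_neg hx, Nat.add_zero]

theorem sourceCmd_spec {D : NTrace} {p t K : ℕ} {s : State} (hs : Input D p t s) (hK : D.L ≤ K) :
    ((sourceCmd.run K s).reg 11 = 0 ∧ ∀ l < D.L, s.arr 23 l ≠ 0 → s.arr 24 l ≠ 0) ∨
    ∃ l < D.L, (sourceCmd.run K s).reg 11 = l + 1 ∧ s.arr 23 l ≠ 0 ∧ s.arr 24 l = 0 := by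
  set s' := (set 11 (lit 0)).run K s with e'
  have hs' : Input D p t s' := hs.run (by rfl) K
  have key := Cmd.run_loop_input (K := K) hs' 8 3
    (ite (get 23 (reg 8)) (ite (get 24 (reg 8)) skip (set 11 (reg 8 + lit 1))) skip)
    (by rfl)
    (fun j st => (st.reg 11 = 0 ∧ ∀ l < j, s.arr 23 l ≠ 0 → s.arr 24 l ≠ 0) ∨
      ∃ l < j, st.reg 11 = l + 1 ∧ s.arr 23 l ≠ 0 ∧ s.arr 24 l = 0) (by simp [e']) ?_
  · rw [hs'.L] at key
    exact key
  · rintro j st hj h8 hst hr ha h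
    rw [hs'.L] at hj
    have h23 : st.arr 23 = s.arr 23 := (ha 23 (by decide)).trans (by simp [e'])
    have h24 : st.arr 24 = s.arr 24 := (ha 24 (by decide)).trans (by simp [e'])
    by_cases hlt : s.arr 23 j ≠ 0 ∧ s.arr 24 j = 0
    · right
      refine ⟨j, by omega, ?_, hlt⟩
      simp [h8, h23, h24, hlt.1, hlt.2, min_eq_left (show j + 1 ≤ K by omega)]
    · have e : (ite (get 23 (reg 8)) (ite (get 24 (reg 8)) skip (set 11 (reg 8 + lit 1))) skip).run
          K st = st := by
        by_cases h0 : s.arr 23 j = 0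
        · simp [h8, h23, h0]
        · have h1 : s.arr 24 j ≠ 0 := fun h1 => hlt ⟨h0, h1⟩
          simp [h8, h23, h24, h0, h1]
      rw [e, State.reg_setReg, if_neg (by decide)]
      rcases h with ⟨h1, h2⟩ | ⟨l, h1, h2, h3⟩
      · left
        refine ⟨h1, fun l hl h0 h3 => ?_⟩
        rcases Nat.lt_succ_iff_lt_or_eq.1 hl with h | rfl
        · exact h2 l h h0 h3
        · exact hlt ⟨h0, h3⟩
      · exact Or.inr ⟨l, by omega, h2, h3⟩

theorem removeCmd_spec {D : NTrace} {p t K k l : ℕ} {s : State} (hs : Input D p t s)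
    (h7 : s.reg 7 = k) (h11 : s.reg 11 = l + 1) :
    (removeCmd.run K s).arr 23 = Function.update (s.arr 23) l 0 ∧
    ∀ l' < D.L, (removeCmd.run K s).arr 24 l' = s.arr 24 l' -
      if D.N - k ≤ s.arr 17 (l' * D.N + (s.arr 23 l - D.N)) then 1 else 0 := by
  set s' := (set 12 (get 23 (reg 11 - lit 1) - reg 0) ++ put 23 (reg 11 - lit 1) (lit 0)).run K s
    with e'
  have hs' : Input D p t s' := hs.run (by rfl) K
  have es : s' = (s.setReg 12 (s.arr 23 l - D.N)).setArr 23 l 0 := by simp [e', h11, hs.N]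
  have key := Cmd.run_loop_input (K := K) hs' 8 3
    (ite (noEdgeE (reg 8) (reg 12)) skip (put 24 (reg 8) (get 24 (reg 8) - lit 1))) (by rfl)
    (fun j st => ∀ l', st.arr 24 l' = s.arr 24 l' -
      if l' < j ∧ D.N - k ≤ s.arr 17 (l' * D.N + (s.arr 23 l - D.N)) then 1 else 0)
    (by simp [es]) ?_
  · constructor
    · have : (removeCmd.run K s).arr 23 = s'.arr 23 := by
        unfold removeCmd
        rw [Cmd.run_append]
        exact Cmd.run_arr _ _ _ (by decide)
      rw [this, es]; simp
    · rw [hs'.L] at key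
      intro l' hl'
      have := key l'
      simp only [hl', true_and] at this
      exact this
  · intro j st hj h8 hst hr ha hinv l'
    have h12 : st.reg 12 = s.arr 23 l - D.N := (hr 12 (by decide)).trans (by simp [es])
    have h7' : st.reg 7 = k := (hr 7 (by decide)).trans (by simp [es, h7])
    have h17 : st.arr 17 = s.arr 17 := (ha 17 (by decide)).trans (by simp [es])
    have hne : (noEdgeE (reg 8) (reg 12)).eval st = 0 ↔
        D.N - k ≤ s.arr 17 (j * D.N + (s.arr 23 l - D.N)) := by
      unfold noEdgeE
      rw [Expr.eval_lt]
      simp only [Expr.eval_get, Expr.eval_add, Expr.eval_mul, Expr.eval_reg, Expr.eval_sub, h8,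
        hst.N, h12, h17, h7', not_lt]
    rw [State.arr_setReg, Cmd.run_ite]
    by_cases h : D.N - k ≤ s.arr 17 (j * D.N + (s.arr 23 l - D.N))
    · rw [if_pos (hne.2 h)]
      have := hinv j
      rw [if_neg (by omega), Nat.sub_zero] at this
      simp only [Cmd.run_put, Expr.eval_reg, h8, Expr.small_sub, Expr.small_get, cond_true,
        Expr.eval_sub, Expr.eval_get, Expr.eval_lit, State.arr_setArr, if_true,
        Function.update_apply, this]
      by_cases hl : l' = j
      · subst hl; rw [if_pos rfl, if_pos ⟨by omega, h⟩]
      · rw [if_neg hl, hinv l']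
        congr 2
        apply propext
        exact and_congr_left fun _ => by omega
    · rw [if_neg fun h' => h (hne.1 h'), Cmd.run_skip, hinv l']
      congr 2
      apply propext
      constructor
      · exact fun h' => ⟨by omega, h'.2⟩
      · rintro ⟨h1, h2⟩
        refine ⟨?_, h2⟩
        rcases Nat.lt_succ_iff_lt_or_eq.1 h1 with h3 | rfl
        · exact h3
        · exact absurd h2 h

/-- The invariant of the removal of locks. -/
structure Removing (D : NTrace) (E : ℕ → ℕ → Prop) (A : ℕ → ℕ) (s : State) : Prop where
  alive : ∀ l < D.L, s.arr 23 l = 0 ∨ s.arr 23 l = A l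
  deg : ∀ l' < D.L, s.arr 24 l' = indeg E (fun l => s.arr 23 l ≠ 0) D.L l'

/-- The locks that are not removed. -/
def Alive (D : NTrace) (s : State) (l : ℕ) : Prop := l < D.L ∧ s.arr 23 l ≠ 0

theorem kahnCmd_spec {D : NTrace} {p t K k : ℕ} {s : State} (hs : Input D p t s) (hK : D.L ≤ K)
    (h7 : s.reg 7 = k) : (∀ l < D.L, (kahnCmd.run K s).arr 23 l = 0) ↔
      Ranked (Edge D (s.arr 17) (s.arr 23) k) (Alive D s) := by
  set E := Edge D (s.arr 17) (s.arr 23) k with hE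
  set s1 := degCmd.run K s with hs1
  have i1 : Input D p t s1 := hs.run (by rfl) K
  have f1 : ∀ a, a ∉ degCmd.arrs → s1.arr a = s.arr a := fun a ha => Cmd.run_arr _ _ _ ha
  have g7 : s1.reg 7 = k := (Cmd.run_reg _ _ _ (by decide)).trans h7
  have f23 := f1 23 (by decide)
  have f17 := f1 17 (by decide)
  have key := Cmd.run_loop_input (K := K) i1 10 3 (sourceCmd ++ ite (reg 11) removeCmd skip)
    (by rfl)
    (fun j st => Removing D E (s.arr 23) st ∧ (Ranked E (Alive D s) ↔ Ranked E (Alive D st)) ∧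
      (Stuck E (Alive D st) ∨
        ((Finset.range D.L).filter fun l => st.arr 23 l ≠ 0).card + j ≤ D.L)) ?_ ?_
  · rw [i1.L] at key
    change Removing D E (s.arr 23) (kahnCmd.run K s) ∧
      (Ranked E (Alive D s) ↔ Ranked E (Alive D (kahnCmd.run K s))) ∧ (Stuck E _ ∨
        ((Finset.range D.L).filter fun l => (kahnCmd.run K s).arr 23 l ≠ 0).card + D.L ≤ D.L) at key
    obtain ⟨-, h2, h3⟩ := key
    rw [h2]
    constructor
    · intro h
      exact ⟨fun _ => 0, fun l l' hl => absurd (h l hl.1) hl.2⟩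
    · intro h l hl
      rcases h3 with h3 | h3
      · by_contra h4
        exact h3.eq_empty h l ⟨hl, h4⟩
      · have h4 : (Finset.range D.L).filter (fun l => (kahnCmd.run K s).arr 23 l ≠ 0) = ∅ :=
          Finset.card_eq_zero.1 (by omega)
        rw [Finset.filter_eq_empty_iff] at h4
        exact not_not.1 (h4 (Finset.mem_range.2 hl))
  · have hA : Alive D (s1.setReg 10 0) = Alive D s := by
      unfold Alive
      rw [State.arr_setReg, f23]
    refine ⟨⟨fun l _ => ?_, fun l' hl' => ?_⟩, ?_, Or.inr ?_⟩
    · right; rw [State.arr_setReg, f23]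
    · rw [State.arr_setReg, f23]; exact degCmd_spec hs hK h7 l' hl'
    · rw [hA]
    · exact (Finset.card_filter_le _ _).trans (Finset.card_range _).le
  · intro j st hj _ hst hr ha ⟨hrem, hrk, hst'⟩
    rw [i1.L] at hj
    have k7 : st.reg 7 = k := (hr 7 (by decide)).trans g7
    have k17 : st.arr 17 = s.arr 17 := (ha 17 (by decide)).trans f17
    set st1 := sourceCmd.run K st with hst1
    have j1 : Input D p t st1 := hst.run (by rfl) K
    have e1 : st1.arr = st.arr :=
      funext fun a => Cmd.run_arr _ _ _ (by rw [show sourceCmd.arrs = [] from rfl]; simp)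
    have m7 : st1.reg 7 = k := (Cmd.run_reg _ _ _ (by decide)).trans k7
    rw [Cmd.run_append, ← hst1, Cmd.run_ite]
    rcases sourceCmd_spec (K := K) hst hK with ⟨h11, hno⟩ | ⟨l, hl, h11, h23, h24⟩
    · rw [← hst1] at h11
      rw [Expr.eval_reg, h11, if_pos rfl, Cmd.run_skip]
      have hA : Alive D (st1.setReg 10 (j + 1)) = Alive D st := by
        unfold Alive
        rw [State.arr_setReg, e1]
      refine ⟨⟨?_, ?_⟩, ?_, ?_⟩
      · rw [State.arr_setReg, e1]; exact hrem.alive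
      · rw [State.arr_setReg, e1]; exact hrem.deg
      · rw [hA]; exact hrk
      · left
        rw [hA]
        rintro l' ⟨hl', h0⟩
        have h1 := hno l' hl' h0
        rw [hrem.deg l' hl', ne_eq, indeg_eq_zero] at h1
        push Not at h1
        obtain ⟨l, h2, h3, h4⟩ := h1
        exact ⟨l, ⟨h2, h3⟩, h4⟩
    · rw [← hst1] at h11
      rw [Expr.eval_reg, h11, if_neg (Nat.succ_ne_zero l)]
      obtain ⟨r1, r2⟩ := removeCmd_spec (K := K) j1 m7 h11
      rw [e1] at r1 r2
      generalize removeCmd.run K st1 = u at r1 r2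
      have hne : ∀ i, u.arr 23 i ≠ 0 ↔ st.arr 23 i ≠ 0 ∧ i ≠ l := by
        intro i
        rw [r1, Function.update_apply]
        split_ifs with h <;> simp [h]
      have hA : Alive D (u.setReg 10 (j + 1)) = fun i => Alive D st i ∧ i ≠ l := by
        funext i
        unfold Alive
        rw [State.arr_setReg]
        exact propext ((and_congr_right fun _ => hne i).trans and_assoc.symm)
      have hl0 : st.arr 23 l = s.arr 23 l := (hrem.alive l hl).resolve_left h23
      have hsrc : ∀ i, Alive D st i → ¬ E i l := fun i hi => by
        have := h24
        rw [hrem.deg l hl, indeg_eq_zero] at this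
        exact this i hi.1 hi.2
      refine ⟨⟨fun i hi => ?_, fun l' hl' => ?_⟩, ?_, ?_⟩
      · rw [State.arr_setReg, r1, Function.update_apply]
        split_ifs
        · exact Or.inl rfl
        · exact hrem.alive i hi
      · rw [State.arr_setReg, r2 l' hl', hrem.deg l' hl', k17, hl0]
        have : (fun i => u.arr 23 i ≠ 0) = fun i => st.arr 23 i ≠ 0 ∧ i ≠ l :=
          funext fun i => propext (hne i)
        rw [this, indeg_remove hl h23]
        congr 1
        simp only [hE, Edge]
      · rw [hA, hrk, Ranked.remove hsrc]
      · rcases hst' with hst' | hst'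
        · obtain ⟨i, hi, hi'⟩ := hst' l ⟨hl, h23⟩
          exact absurd hi' (hsrc i hi)
        · right
          have : (Finset.range D.L).filter (fun i => (u.setReg 10 (j + 1)).arr 23 i ≠ 0) =
              ((Finset.range D.L).filter fun i => st.arr 23 i ≠ 0).erase l := by
            ext i
            rw [Finset.mem_filter, Finset.mem_erase, Finset.mem_filter, State.arr_setReg, hne i]
            tauto
          have hmem : l ∈ (Finset.range D.L).filter fun i => st.arr 23 i ≠ 0 := by
            simp [hl, h23]
          have hpos := Finset.card_pos.2 ⟨l, hmem⟩
          rw [this, Finset.card_erase_of_mem hmem]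
          omega

/-! ### The test for one event -/

theorem NTrace.good_iff {D : NTrace} (hD : D.Valid) {p q k : ℕ} {A mu : ℕ → ℕ} (hpN : p < D.N)
    (hqN : q < D.N)
    (hA : ∀ l < D.L, A l = wsum D.N (fun i => D.Open (D.Need p q) i ∧ D.tg i = l) D.N)
    (hmu : ∀ l < D.L, ∀ i < D.N,
      (D.N - k ≤ mu (l * D.N + i) ↔ D.Reach (D.Need p q) (l + D.V) i)) :
    D.Good p q ↔ ¬ D.Need p q p ∧ ¬ D.Need p q q ∧ (∀ l < D.L, A l < 2 * D.N) ∧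
      Ranked (Edge D mu A k) (fun l => l < D.L ∧ A l ≠ 0) := by
  have hlt : ∀ {a}, D.Open (D.Need p q) a → a < D.N := fun h => h.1.lt_N hpN hqN
  have htg : ∀ {a}, D.Open (D.Need p q) a → D.tg a < D.L := fun h =>
    hD.tg_lock _ (hlt h) h.2.1.ge
  have hobj : ∀ {a}, D.Open (D.Need p q) a → D.obj a = D.tg a + D.V := fun h =>
    NTrace.obj_lock hD (hlt h) h.2.1.ge
  have huniq : (∀ l < D.L, A l < 2 * D.N) ↔ ∀ a b, D.Open (D.Need p q) a →
      D.Open (D.Need p q) b → D.obj a = D.obj b → a = b := by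
    constructor
    · intro h a b ha hb hab
      by_contra hne
      rw [hobj ha, hobj hb] at hab
      have h1 := h _ (htg ha)
      rw [hA _ (htg ha)] at h1
      have h2 := le_wsum_of_ne (N := D.N) (P := fun i => D.Open (D.Need p q) i ∧ D.tg i = D.tg a)
        (hlt ha) (hlt hb) ⟨ha, rfl⟩ ⟨hb, by omega⟩ hne
      omega
    · intro h l hl
      rw [hA l hl]
      by_cases he : ∃ a, D.Open (D.Need p q) a ∧ D.tg a = l
      · obtain ⟨a, ha, rfl⟩ := he
        rw [wsum_eq_of_unique (a := a) (hlt ha) ⟨ha, rfl⟩ fun i _ hi =>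
          h i a hi.1 ha (by rw [hobj hi.1, hobj ha, hi.2])]
        have := hlt ha
        omega
      · rw [wsum_eq_zero fun i _ hi => he ⟨i, hi⟩]
        omega
  have hrank : (∀ a b, D.Open (D.Need p q) a → D.Open (D.Need p q) b → D.obj a = D.obj b → a = b) →
      (Ranked (Edge D mu A k) (fun l => l < D.L ∧ A l ≠ 0) ↔
        ∃ rank : ℕ → ℕ, ∀ a b, D.Open (D.Need p q) a → D.Open (D.Need p q) b →
          D.Reach (D.Need p q) (D.obj b) a → rank a < rank b) := by
    intro hu
    have hAa : ∀ {a}, D.Open (D.Need p q) a → A (D.tg a) = D.N + a := by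
      intro a ha
      rw [hA _ (htg ha), wsum_eq_of_unique (a := a) (hlt ha) ⟨ha, rfl⟩ fun i _ hi =>
          hu i a hi.1 ha (by rw [hobj hi.1, hobj ha, hi.2])]
    have hedge : ∀ {a b}, D.Open (D.Need p q) a → D.Open (D.Need p q) b →
        (Edge D mu A k (D.tg a) (D.tg b) ↔ D.Reach (D.Need p q) (D.obj b) a) := by
      intro a b ha hb
      unfold Edge
      rw [hAa ha, Nat.add_sub_cancel_left, hmu _ (htg hb) _ (hlt ha), hobj hb]
    constructor
    · rintro ⟨rank, h⟩
      refine ⟨fun a => rank (D.tg a), fun a b ha hb hr => h _ _ ⟨htg ha, ?_⟩ ⟨htg hb, ?_⟩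
        ((hedge ha hb).2 hr)⟩
      · rw [hAa ha]; have := hlt ha; omega
      · rw [hAa hb]; have := hlt hb; omega
    · rintro ⟨rank, h⟩
      refine ⟨fun l => rank (A l - D.N), ?_⟩
      have hex : ∀ l, l < D.L ∧ A l ≠ 0 → ∃ a, D.Open (D.Need p q) a ∧ D.tg a = l := by
        rintro l ⟨hl, h0⟩
        by_contra hne
        exact h0 (by rw [hA l hl, wsum_eq_zero fun i _ hi => hne ⟨i, hi⟩])
      intro l l' hl hl' he
      obtain ⟨a, ha, rfl⟩ := hex l hl
      obtain ⟨b, hb, rfl⟩ := hex l' hl'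
      simp only [hAa ha, hAa hb, Nat.add_sub_cancel_left]
      exact h a b ha hb ((hedge ha hb).1 he)
  constructor
  · intro g
    exact ⟨g.not_left, g.not_right, huniq.2 g.unique, (hrank g.unique).2 g.acyclic⟩
  · rintro ⟨h1, h2, h3, h4⟩
    exact ⟨h1, h2, huniq.1 h3, (hrank (huniq.1 h3)).1 h4⟩

/-- Run `c` if all the tests `l` succeed. -/
def Cmd.guard (l : List Expr) (c : Cmd) : Cmd := l.foldr (fun x c => Cmd.ite x c Cmd.skip) c

open Classical in
theorem Cmd.run_guard (K : ℕ) (s : State) (l : List Expr) (c : Cmd) :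
    (Cmd.guard l c).run K s = if ∀ x ∈ l, x.eval s ≠ 0 then c.run K s else s := by
  induction l with
  | nil => simp [Cmd.guard]
  | cons x l ih =>
    change (if x.eval s = 0 then s else (Cmd.guard l c).run K s) = _
    rw [ih]
    by_cases h : x.eval s = 0 <;> simp [h]

/-- Set register `14` if the test `x` succeeds for some lock. -/
def anyCmd (x : Expr) : Cmd := loop 8 3 (ite x (set 14 (lit 1)) skip)

theorem anyCmd_spec {D : NTrace} {p t K : ℕ} {s : State} (hs : Input D p t s) {x : Expr}
    {P : ℕ → Prop} (hx : ∀ st l, Input D p t st → l < D.L → st.reg 8 = l → st.arr = s.arr →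
      (x.eval st ≠ 0 ↔ P l)) :
    ((anyCmd x).run K s).reg 14 = 0 ↔ s.reg 14 = 0 ∧ ∀ l < D.L, ¬ P l := by
  have key := Cmd.run_loop_input (K := K) hs 8 3 (ite x (set 14 (lit 1)) skip) (by rfl)
    (fun j st => st.reg 14 = 0 ↔ s.reg 14 = 0 ∧ ∀ l < j, ¬ P l) (by simp) ?_
  · rw [hs.L] at key; exact key
  · intro j st hj h8 hst _ ha hinv
    rw [hs.L] at hj
    have h := hx st j hst hj h8 (funext fun a => ha a (by simp [Cmd.arrs]))
    by_cases hP : P j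
    · have e : ((ite x (set 14 (lit 1)) skip).run K st).reg 14 = 1 := by
        simp [h.2 hP]
      rw [State.reg_setReg, if_neg (by decide), e]
      exact iff_of_false (by omega) fun h => h.2 j (by omega) hP
    · have e : (ite x (set 14 (lit 1)) skip).run K st = st := by
        have : x.eval st = 0 := by by_contra h0; exact hP (h.1 h0)
        simp [this]
      rw [State.reg_setReg, if_neg (by decide), e, hinv]
      refine and_congr_right fun _ => ⟨fun h l hl => ?_, fun h l hl => h l (by omega)⟩
      rcases Nat.lt_succ_iff_lt_or_eq.1 hl with h1 | rfl
      · exact h l h1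
      · exact hP

/-- Collect the open acquires at the time in register `7` in array `23`. -/
def fillCmd : Cmd :=
  loop 8 3 (put 23 (reg 8) (get 21 (reg 7 * reg 3 + reg 8) - get 22 (reg 7 * reg 3 + reg 8)))

theorem fillCmd_spec {D : NTrace} {p t K k : ℕ} {s : State} (hs : Input D p t s)
    (h7 : s.reg 7 = k) : ∀ l < D.L, (fillCmd.run K s).arr 23 l =
      s.arr 21 (k * D.L + l) - s.arr 22 (k * D.L + l) := by
  have key := Cmd.run_loop_input (K := K) hs 8 3
    (put 23 (reg 8) (get 21 (reg 7 * reg 3 + reg 8) - get 22 (reg 7 * reg 3 + reg 8))) (by rfl)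
    (fun j st => ∀ l < j, st.arr 23 l = s.arr 21 (k * D.L + l) - s.arr 22 (k * D.L + l))
    (fun l h => by omega) ?_
  · rw [hs.L] at key; exact key
  · intro j st hj h8 hst hr ha hinv l hl
    have h7' : st.reg 7 = k := (hr 7 (by decide)).trans h7
    have h21 : st.arr 21 = s.arr 21 := ha 21 (by decide)
    have h22 : st.arr 22 = s.arr 22 := ha 22 (by decide)
    simp only [Cmd.run_put, Expr.small_sub, Expr.small_get, cond_true, State.arr_setReg,
      State.arr_setArr, if_true, Expr.eval_sub, Expr.eval_get, Expr.eval_add, Expr.eval_mul,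
      Expr.eval_reg, h8, h7', hst.L, h21, h22, Function.update_apply]
    split_ifs with h
    · rw [h]
    · exact hinv l (by omega)

/-- The tests for a conflict, and for both events being outside of the least lock-closed set. -/
def pairTests : List Expr :=
  [(reg 4 - reg 13) + (reg 13 - reg 4), Expr.eq (get 2 (reg 4)) (get 2 (reg 13)),
    lt (get 1 (reg 4)) (lit 2), lt (get 1 (reg 13)) (lit 2),
    Expr.eq (get 1 (reg 4)) (lit 1) + Expr.eq (get 1 (reg 13)) (lit 1),
    lt (get 16 (reg 4)) (reg 0 - reg 7), lt (get 16 (reg 13)) (reg 0 - reg 7)]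

/-- Set register `31` if the open acquires are unique and can be ordered. -/
def orderCmd : Cmd :=
  fillCmd ++ set 14 (lit 0) ++ anyCmd (lt (reg 0 + reg 0 - lit 1) (get 23 (reg 8))) ++
  ite (reg 14) skip
    (kahnCmd ++ anyCmd (get 23 (reg 8)) ++ ite (reg 14) skip (set 31 (lit 1)))

/-- Set register `31` if the event at the place in register `7` is in a race with the given one. -/
def checkCmd : Cmd :=
  Cmd.guard [lt (reg 7) (get 4 (reg 5))]
    (set 13 (get 5 (reg 5 * reg 0 + reg 7)) ++ Cmd.guard pairTests orderCmd)

open Classical in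
theorem orderCmd_spec {D : NTrace} {p t K k : ℕ} {A : ℕ → ℕ} {s : State} (hs : Input D p t s)
    (hN : 0 < D.N) (hK : D.L ≤ K) (h7 : s.reg 7 = k)
    (hA : ∀ l < D.L, s.arr 21 (k * D.L + l) - s.arr 22 (k * D.L + l) = A l) :
    (orderCmd.run K s).reg 31 = if (∀ l < D.L, A l < 2 * D.N) ∧
      Ranked (Edge D (s.arr 17) A k) (fun l => l < D.L ∧ A l ≠ 0) then 1 else s.reg 31 := by
  set s1 := fillCmd.run K s with hs1
  set s2 := (set 14 (lit 0)).run K s1 with hs2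
  set s3 := (anyCmd (lt (reg 0 + reg 0 - lit 1) (get 23 (reg 8)))).run K s2 with hs3
  set s4 := kahnCmd.run K s3 with hs4
  set s5 := (anyCmd (get 23 (reg 8))).run K s4 with hs5
  have i1 : Input D p t s1 := hs.run (by rfl) K
  have i2 : Input D p t s2 := i1.run (by rfl) K
  have i3 : Input D p t s3 := i2.run (by rfl) K
  have i4 : Input D p t s4 := i3.run (by rfl) K
  have a1 : ∀ l < D.L, s1.arr 23 l = A l := fun l hl => by
    rw [hs1, fillCmd_spec hs h7 l hl, hA l hl]
  have f1 : s1.arr 17 = s.arr 17 := Cmd.run_arr _ _ _ (by decide)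
  have f2 : s2.arr = s1.arr := rfl
  have f3 : s3.arr = s2.arr := funext fun a => Cmd.run_arr _ _ _ (by simp [anyCmd, Cmd.arrs])
  have h31 : s3.reg 31 = s.reg 31 := by
    rw [hs3, Cmd.run_reg _ _ 31 (by decide), hs2, Cmd.run_reg _ _ 31 (by decide), hs1,
      Cmd.run_reg _ _ 31 (by decide)]
  have h37 : s3.reg 7 = k := by
    rw [hs3, Cmd.run_reg _ _ 7 (by decide), hs2, Cmd.run_reg _ _ 7 (by decide), hs1,
      Cmd.run_reg _ _ 7 (by decide), h7]
  have r3 : s3.reg 14 = 0 ↔ ∀ l < D.L, A l < 2 * D.N := by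
    rw [hs3, anyCmd_spec i2 (P := fun l => 2 * D.N ≤ A l)]
    · simp [hs2]
    · intro st l hst hl h8 harr
      have := a1 l hl
      rw [ne_eq, Expr.eval_lt, not_not]
      simp only [Expr.eval_sub, Expr.eval_add, Expr.eval_reg, Expr.eval_lit, Expr.eval_get, hst.N,
        h8, harr, f2, this]
      omega
  have r5 : s3.reg 14 = 0 → (s5.reg 14 = 0 ↔
      Ranked (Edge D (s.arr 17) A k) (fun l => l < D.L ∧ A l ≠ 0)) := by
    intro h14
    rw [hs5, anyCmd_spec i4 (P := fun l => s4.arr 23 l ≠ 0)]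
    · have h4 : s4.reg 14 = 0 := by rw [hs4, Cmd.run_reg _ _ 14 (by decide), h14]
      rw [and_iff_right h4]
      simp only [not_not]
      rw [hs4, kahnCmd_spec i3 hK h37, f3, f2, f1]
      have hal : Alive D s3 = fun l => l < D.L ∧ A l ≠ 0 := by
        funext l
        unfold Alive
        rw [f3, f2]
        exact propext (and_congr_right fun hl => by rw [a1 l hl])
      rw [hal]
      unfold Ranked
      refine exists_congr fun rank => forall_congr' fun l => forall_congr' fun l' =>
        forall_congr' fun hl => forall_congr' fun hl' => ?_
      unfold Edge
      rw [a1 l hl.1]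
    · intro st l hst hl h8 harr
      simp [h8, harr]
  have hrun : orderCmd.run K s =
      if s3.reg 14 = 0 then (if s5.reg 14 = 0 then s5.setReg 31 1 else s5) else s3 := rfl
  rw [hrun]
  by_cases h3 : s3.reg 14 = 0
  · rw [if_pos h3]
    by_cases h5 : s5.reg 14 = 0
    · rw [if_pos h5, if_pos ⟨r3.1 h3, (r5 h3).1 h5⟩, State.reg_setReg, if_pos rfl]
    · rw [if_neg h5, if_neg fun h => h5 ((r5 h3).2 h.2), hs5, Cmd.run_reg _ _ 31 (by decide), hs4,
        Cmd.run_reg _ _ 31 (by decide), h31]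
  · rw [if_neg h3, if_neg fun h => h3 (r3.2 h.1), h31]

open Classical in
theorem checkCmd_spec {D : NTrace} (hD : D.Valid) {p t K k : ℕ} {s : State} (hs : Input D p t s)
    (hp : Prep D p t s) (hpN : p < D.N) (hK : D.L ≤ K) (h7 : s.reg 7 = k)
    (htau : k < D.cnt t → ∀ i < D.N, D.N - k ≤ s.arr 16 i ↔ D.Need p (D.pos t k) i)
    (hmu : k < D.cnt t → ∀ l < D.L, ∀ i < D.N,
      (D.N - k ≤ s.arr 17 (l * D.N + i) ↔ D.Reach (D.Need p (D.pos t k)) (l + D.V) i))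
    (hA : k < D.cnt t → ∀ l < D.L, s.arr 21 (k * D.L + l) - s.arr 22 (k * D.L + l) =
      wsum D.N (fun i => D.Open (D.Need p (D.pos t k)) i ∧ D.tg i = l) D.N) :
    (checkCmd.run K s).reg 31 =
      if k < D.cnt t ∧ D.Conflict p (D.pos t k) ∧ D.Good p (D.pos t k) then 1 else s.reg 31 := by
  rw [checkCmd, Cmd.run_guard]
  have h1 : (∀ x ∈ [lt (reg 7) (get 4 (reg 5))], x.eval s ≠ 0) ↔ k < D.cnt t := by
    simp [h7, hs.t, hp.cnt]
  by_cases hk : k < D.cnt t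
  swap
  · rw [if_neg fun h => hk (h1.1 h), if_neg fun h => hk h.1]
  rw [if_pos (h1.2 hk), Cmd.run_append]
  obtain ⟨q1, q2, q3⟩ := NTrace.pos_spec hk
  set q := D.pos t k with hq
  set s1 := (set 13 (get 5 (reg 5 * reg 0 + reg 7))).run K s with hs1
  have e1 : s1 = s.setReg 13 q := by
    simp [hs1, hs.t, hs.N, h7, hp.ev_pos hk, ← hq]
  have i1 : Input D p t s1 := hs.run (by rfl) K
  have h71 : s1.reg 7 = k := by simp [e1, h7]
  have h31 : s1.reg 31 = s.reg 31 := by simp [e1]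
  have arr1 : s1.arr = s.arr := by simp [e1]
  have h13 : s1.reg 13 = q := by simp [e1]
  have htests : (∀ x ∈ pairTests, x.eval s1 ≠ 0) ↔
      D.Conflict p q ∧ ¬ D.Need p q p ∧ ¬ D.Need p q q := by
    rw [← htau hk p hpN, ← htau hk q q1]
    unfold pairTests NTrace.Conflict
    simp only [List.forall_mem_cons, List.not_mem_nil, false_imp_iff, implies_true, and_true,
      ne_eq, Expr.eval_lt, Expr.eval_add, Expr.eval_eq, Nat.add_eq_zero_iff, not_not, Expr.eval_sub,
      Expr.eval_reg, Expr.eval_get, Expr.eval_lit, i1.p, h13, i1.tg, i1.kd, i1.N, h71, arr1,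
      not_le, not_and_or]
    have hobj : D.kd p < 2 → D.kd q < 2 → (D.obj p = D.obj q ↔ D.tg p = D.tg q) := by
      intro h1 h2
      simp [NTrace.obj, Nat.div_eq_of_lt h1, Nat.div_eq_of_lt h2]
    constructor
    · rintro ⟨b1, b2, b3, b4, b5, b6, b7⟩
      exact ⟨⟨by omega, (hobj b3 b4).2 b2, b3, b4, b5⟩, b6, b7⟩
    · rintro ⟨⟨b1, b2, b3, b4, b5⟩, b6, b7⟩
      exact ⟨by omega, (hobj b3 b4).1 b2, b3, b4, b5, b6, b7⟩
  have hgood := NTrace.good_iff hD (k := k) (mu := s.arr 17)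
    (A := fun l => s.arr 21 (k * D.L + l) - s.arr 22 (k * D.L + l)) hpN q1 (hA hk) (hmu hk)
  rw [Cmd.run_guard]
  by_cases ht : ∀ x ∈ pairTests, x.eval s1 ≠ 0
  · rw [if_pos ht]
    have ht' := htests.1 ht
    rw [orderCmd_spec i1 (by omega) hK h71 (fun l _ => rfl), arr1, h31]
    congr 1
    apply propext
    rw [and_iff_right hk, and_iff_right ht'.1, hgood, and_iff_right ht'.2.1,
      and_iff_right ht'.2.2]
  · rw [if_neg ht, h31, if_neg]
    rintro ⟨-, h2, h3⟩
    exact ht (htests.2 ⟨h2, h3.not_left, h3.not_right⟩)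

/-! ### The whole program -/

/-- The program: its answer is left in register `31`. -/
def mainCmd : Cmd := prepCmd ++ growCmd ++ reachCmd ++ openCmd ++ loop 7 0 checkCmd

open Classical in
theorem mainCmd_spec {D : NTrace} (hD : D.Valid) {p t K : ℕ} {s : State} (hs : Input D p t s)
    (hpN : p < D.N) (ht : t < D.T) (hK : 2 * D.N * D.N ≤ K)
    (h0 : ∀ a, 3 ≤ a → ∀ i, s.arr a i = 0) (h31 : s.reg 31 = 0) :
    (mainCmd.run K s).reg 31 =
      if ∃ k < D.cnt t, D.Conflict p (D.pos t k) ∧ D.Good p (D.pos t k) then 1 else 0 := by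
  have hN : 0 < D.N := by omega
  have hNK : D.N ≤ K := (Nat.le_mul_of_pos_left D.N (by omega)).trans hK
  set s1 := prepCmd.run K s with hs1
  set s2 := growCmd.run K s1 with hs2
  set s3 := reachCmd.run K s2 with hs3
  set s4 := openCmd.run K s3 with hs4
  have i1 : Input D p t s1 := hs.run (by rfl) K
  have i2 : Input D p t s2 := i1.run (by rfl) K
  have i3 : Input D p t s3 := i2.run (by rfl) K
  have i4 : Input D p t s4 := i3.run (by rfl) K
  have f1 : ∀ a, a ∉ prepCmd.arrs → s1.arr a = s.arr a := fun a ha => Cmd.run_arr _ _ _ ha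
  have f2 : ∀ a, a ∉ growCmd.arrs → s2.arr a = s1.arr a := fun a ha => Cmd.run_arr _ _ _ ha
  have f3 : ∀ a, a ∉ reachCmd.arrs → s3.arr a = s2.arr a := fun a ha => Cmd.run_arr _ _ _ ha
  have f4 : ∀ a, a ∉ openCmd.arrs → s4.arr a = s3.arr a := fun a ha => Cmd.run_arr _ _ _ ha
  have frame : ∀ {c : Cmd} {u : State}, c.arrs.all (13 ≤ ·) = true → Prep D p t u →
      Prep D p t (c.run K u) := fun hc hu => hu.congr fun a ha => Cmd.run_arr _ _ _ fun hm => by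
    have := List.all_eq_true.1 hc a hm
    simp only [decide_eq_true_eq] at this
    omega
  have p1 : Prep D p t s1 := prepCmd_spec hD hs hNK h0
  have p2 : Prep D p t s2 := frame (by rfl) p1
  have p3 : Prep D p t s3 := frame (by rfl) p2
  have p4 : Prep D p t s4 := frame (by rfl) p3
  have z1 : ∀ a, 14 ≤ a → ∀ i, s1.arr a i = 0 := fun a ha i => by
    rw [f1 a fun hm => ?_, h0 a (by omega)]
    have := List.all_eq_true.1 (by rfl : prepCmd.arrs.all (· < 14) = true) a hm
    simp only [decide_eq_true_eq] at this
    omega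
  have tau := growCmd_spec hD i1 p1 hNK hpN ht (z1 14 (by omega)) (z1 15 (by omega))
    (z1 16 (by omega))
  rw [← hs2] at tau
  have hset : ∀ k < D.cnt t, AtLevel D (s2.arr 16) (D.N - k) = D.Need p (D.pos t k) := by
    intro k hk
    funext i
    unfold AtLevel
    refine propext ⟨fun h => (tau k hk i h.1).1 h.2, fun h => ?_⟩
    have hi := h.lt_N hpN (NTrace.pos_spec hk).1
    exact ⟨hi, (tau k hk i hi).2 h⟩
  have hcnt := D.cnt_le t
  have mu : ∀ k < D.cnt t, ∀ l < D.L, ∀ i < D.N, (D.N - k ≤ s3.arr 17 (l * D.N + i) ↔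
      D.Reach (D.Need p (D.pos t k)) (l + D.V) i) := by
    intro k hk l hl i hi
    rw [hs3, reachCmd_spec hD i2 (by rw [f2 18 (by decide)]; exact z1 18 (by omega))
      (by rw [f2 19 (by decide)]; exact z1 19 (by omega))
      (by rw [f2 20 (by decide)]; exact z1 20 (by omega)) l hl i hi _ (by omega) (by omega),
      hset k hk]
  have e16 : s3.arr 16 = s2.arr 16 := f3 16 (by decide)
  have opn : ∀ k < D.cnt t, ∀ l < D.L, s4.arr 21 (k * D.L + l) - s4.arr 22 (k * D.L + l) =
      wsum D.N (fun i => D.Open (D.Need p (D.pos t k)) i ∧ D.tg i = l) D.N := by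
    intro k hk l hl
    refine openCmd_spec hD i3 p3 hK
      (by rw [f3 21 (by decide), f2 21 (by decide)]; exact z1 21 (by omega))
      (by rw [f3 22 (by decide), f2 22 (by decide)]; exact z1 22 (by omega)) (by omega) hl ?_
      fun i j hj hij hth => NTrace.Need.thread i j hj hij hth
    rw [e16]
    exact tau k hk
  have r31 : s4.reg 31 = 0 := by
    rw [hs4, Cmd.run_reg _ _ 31 (by decide), hs3, Cmd.run_reg _ _ 31 (by decide), hs2,
      Cmd.run_reg _ _ 31 (by decide), hs1, Cmd.run_reg _ _ 31 (by decide), h31]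
  have key := Cmd.run_loop_input (K := K) i4 7 0 checkCmd (by rfl)
    (fun j st => st.reg 31 = if ∃ k < j, k < D.cnt t ∧ D.Conflict p (D.pos t k) ∧
      D.Good p (D.pos t k) then 1 else 0) ?_ ?_
  · rw [i4.N] at key
    have hrun : mainCmd.run K s = (loop 7 0 checkCmd).run K s4 := rfl
    rw [hrun, key]
    congr 1
    apply propext
    exact ⟨fun ⟨k, _, h⟩ => ⟨k, h⟩, fun ⟨k, h⟩ => ⟨k, by omega, h⟩⟩
  · rw [State.reg_setReg, if_neg (by decide), r31, if_neg]
    rintro ⟨k, hk, -⟩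
    omega
  · intro j st hj h7 hst hr ha hinv
    have e : ∀ a, a ∉ checkCmd.arrs → st.arr a = s4.arr a := ha
    have pst : Prep D p t st := p4.congr fun a h => ha a fun hm => by
      have := List.all_eq_true.1 (by rfl : checkCmd.arrs.all (13 ≤ ·) = true) a hm
      simp only [decide_eq_true_eq] at this
      omega
    have := checkCmd_spec (K := K) hD hst pst hpN (hD.L_le.trans hNK) h7
      (fun hk => by rw [e 16 (by decide), f4 16 (by decide), e16]; exact tau j hk)
      (fun hk => by rw [e 17 (by decide), f4 17 (by decide)]; exact mu j hk)
      (fun hk => by rw [e 21 (by decide), e 22 (by decide)]; exact opn j hk)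
    rw [State.reg_setReg, if_neg (by decide), this, hinv]
    by_cases h : j < D.cnt t ∧ D.Conflict p (D.pos t j) ∧ D.Good p (D.pos t j)
    · rw [if_pos h, if_pos ⟨j, by omega, h⟩]
    · rw [if_neg h]
      congr 1
      apply propext
      constructor
      · rintro ⟨k, hk, hk'⟩; exact ⟨k, by omega, hk'⟩
      · rintro ⟨k, hk, hk'⟩
        rcases Nat.lt_succ_iff_lt_or_eq.1 hk with h1 | rfl
        · exact ⟨k, h1, hk'⟩
        · exact absurd hk' h

/-! ### Running time -/

/-- The maximal number of repetitions of an instruction. -/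
def Cmd.nest (f : ℕ → ℕ) : Cmd → ℕ
  | skip => 1
  | set _ _ => 1
  | put _ _ _ => 1
  | seq p q => max (p.nest f) (q.nest f)
  | ite _ p q => max (p.nest f) (q.nest f)
  | loop _ n p => f n * p.nest f

theorem Cmd.one_le_nest {f : ℕ → ℕ} (hf : ∀ n, 1 ≤ f n) (p : Cmd) : 1 ≤ p.nest f := by
  induction p with
  | skip => exact le_rfl
  | set i x => exact le_rfl
  | put a ix x => exact le_rfl
  | seq p q hp hq => exact hp.trans (le_max_left _ _)
  | ite x p q hp hq => exact hp.trans (le_max_left _ _)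
  | loop i n p hp => exact Nat.mul_le_mul (hf n) hp

theorem Cmd.time_mono {f g : ℕ → ℕ} (h : ∀ n, f n ≤ g n) (p : Cmd) : p.time f ≤ p.time g := by
  induction p with
  | skip => exact le_rfl
  | set i x => exact le_rfl
  | put a ix x => exact le_rfl
  | seq p q hp hq => exact Nat.add_le_add hp hq
  | ite x p q hp hq => simp only [Cmd.time]; omega
  | loop i n p hp =>
    exact Nat.add_le_add_right (Nat.mul_le_mul (h n) (Nat.add_le_add_right hp 8)) 6

theorem Cmd.time_le {f : ℕ → ℕ} (hf : ∀ n, 1 ≤ f n) (p : Cmd) :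
    p.time f ≤ p.time (fun _ => 1) * p.nest f := by
  induction p with
  | skip => simp [Cmd.time, Cmd.nest]
  | set i x => simp [Cmd.time, Cmd.nest]
  | put a ix x => simp [Cmd.time, Cmd.nest]
  | seq p q hp hq =>
    have h1 := hp.trans (Nat.mul_le_mul_left _ (le_max_left (p.nest f) (q.nest f)))
    have h2 := hq.trans (Nat.mul_le_mul_left _ (le_max_right (p.nest f) (q.nest f)))
    simp only [Cmd.time, Cmd.nest, Nat.add_mul]
    omega
  | ite x p q hp hq =>
    have h1 := hp.trans (Nat.mul_le_mul_left _ (le_max_left (p.nest f) (q.nest f)))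
    have h2 := hq.trans (Nat.mul_le_mul_left _ (le_max_right (p.nest f) (q.nest f)))
    have h3 : 1 ≤ max (p.nest f) (q.nest f) := (p.one_le_nest hf).trans (le_max_left _ _)
    have h4 := Nat.mul_le_mul_left (x.cost + 1) h3
    simp only [Cmd.time, Cmd.nest, Nat.add_mul] at *
    omega
  | loop i n p hp =>
    have h1 := p.one_le_nest hf
    have h2 := hf n
    have h3 : 1 ≤ f n * p.nest f := Nat.mul_le_mul h2 h1
    have h4 : f n * p.time f ≤ f n * (p.time (fun _ => 1) * p.nest f) := Nat.mul_le_mul_left _ hp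
    have h5 : f n * 1 ≤ f n * p.nest f := Nat.mul_le_mul_left _ h1
    simp only [Cmd.time, Cmd.nest]
    nlinarith

theorem Cmd.nest_append (f : ℕ → ℕ) (p q : Cmd) : (p ++ q).nest f = max (p.nest f) (q.nest f) := rfl

theorem mainCmd_nest_le {f : ℕ → ℕ} {U : ℕ} (h01 : f 0 * f 1 ≤ U) (h03 : f 0 * (f 3 * f 3) ≤ U)
    (h1 : ∀ n, 1 ≤ f n) : mainCmd.nest f ≤ U := by
  have a0 : f 0 ≤ U := (Nat.le_mul_of_pos_right _ (h1 1)).trans h01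
  have a1 : 1 ≤ U := (h1 0).trans a0
  have a03 : f 0 * f 3 ≤ U :=
    (Nat.mul_le_mul_left _ (Nat.le_mul_of_pos_right _ (h1 3))).trans h03
  have a30 : f 3 * f 0 ≤ U := by rw [mul_comm]; exact a03
  simp only [mainCmd, prepCmd, indexCmd, writerCmd, matchCmd, propCmd, growCmd, initCmd, roundCmd,
    findCmd, addCmd, demandWriterCmd, demandRelCmd, reachCmd, reachValueCmd, reachStoreCmd, openCmd,
    tallyCmd, checkCmd, Cmd.guard, pairTests, List.foldr, orderCmd, fillCmd, anyCmd, kahnCmd,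
    degCmd, sourceCmd, removeCmd, Cmd.raise, Cmd.raiseAt, Cmd.nest_append, Cmd.nest, max_self,
    mul_max, Nat.mul_one, max_le_iff]
  simp only [a0, a1, h01, h03, a03, a30, and_self]

/-- The program for the machine. -/
def mainProg : Prog :=
  Prog.seq (Prog.set 6 (lit 8 * reg 0 * reg 0)) (Prog.seq mainCmd.compile (Prog.set 0 (reg 31)))

theorem mainCmd_wf : mainCmd.wf = true := by rfl

variable {Thr Var Lck : Type} {nt : Thr → ℕ} {nv : Var → ℕ} {nl : Lck → ℕ}
  {σ : Trace Thr Var Lck}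

theorem Coded.exists_race_iff (c : Coded nt nv nl σ) {p : ℕ} {e : Event Thr Var Lck}
    (he : σ[p]? = some e) {t : Thr} (ht : t ∈ threads σ) :
    (∃ e', e'.thread = t ∧ IsOSRRace σ e e') ↔
      ∃ k < (code nt nv nl σ).cnt (nt t),
        (code nt nv nl σ).Conflict p ((code nt nv nl σ).pos (nt t) k) ∧
        (code nt nv nl σ).Good p ((code nt nv nl σ).pos (nt t) k) := by
  constructor
  · rintro ⟨e', rfl, hr⟩
    obtain ⟨q, hq⟩ := exists_pos hr.2.1
    have hqN : q < (code nt nv nl σ).N := pos_lt hq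
    have h := NTrace.idx_lt_cnt hqN
    have h' := NTrace.pos_idx hqN
    rw [code_th _ _ _ hq] at h h'
    refine ⟨_, h, ?_⟩
    rw [h']
    exact (c.isOSRRace_iff he hq).1 hr
  · rintro ⟨k, hk, h⟩
    obtain ⟨h1, h2, -⟩ := NTrace.pos_spec hk
    obtain ⟨e', hq⟩ := exists_at h1
    refine ⟨e', ?_, (c.isOSRRace_iff he hq).2 h⟩
    rw [code_th _ _ _ hq] at h2
    exact c.thr.injOn ⟨e', mem_of_pos hq, rfl⟩ ht h2


theorem Coded.inputState_bdd (c : Coded nt nv nl σ) {i K : ℕ} {t : Thr} (hi : i < σ.length)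
    (ht : t ∈ threads σ) (hK : 8 * σ.length * σ.length ≤ K) :
    (inputState nt nv nl σ i t).Bdd K := by
  have hv := c.valid
  have hNK : σ.length ≤ K := by nlinarith
  have h8 : 8 ≤ K := by nlinarith
  have hT : (threads σ).ncard ≤ σ.length := hv.T_le
  have hV : (vars σ).ncard ≤ σ.length := hv.V_le
  have hL : (locks σ).ncard ≤ σ.length := hv.L_le
  have hnt : nt t < (threads σ).ncard := c.thr.mapsTo ht
  constructor
  · intro r
    match r with
    | 0 => exact hNK
    | 1 => exact hT.trans hNK
    | 2 => exact hV.trans hNK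
    | 3 => exact hL.trans hNK
    | 4 => exact hi.le.trans hNK
    | 5 => exact hnt.le.trans (hT.trans hNK)
    | _ + 6 => exact Nat.zero_le _
  · have key : ∀ {f : Event Thr Var Lck → ℕ}, (∀ e ∈ σ, f e ≤ K) → ∀ j, (σ.map f).getD j 0 ≤ K := by
      intro f hf j
      rw [List.getD_eq_getElem?_getD, List.getElem?_map]
      rcases h : σ[j]? with _ | e
      · exact Nat.zero_le _
      · exact hf e (mem_of_pos h)
    intro a j
    match a with
    | 0 =>
      refine key (fun e he => ?_) j
      have h : nt e.thread < (threads σ).ncard := c.thr.mapsTo ⟨e, he, rfl⟩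
      omega
    | 1 => exact key (fun e _ => by have := e.op.kind_lt; omega) j
    | 2 =>
      refine key (fun e he => ?_) j
      obtain ⟨k, hk⟩ := exists_pos he
      have hkN := pos_lt hk
      have h4 := hv.kd_lt k hkN
      have e2 := code_tg nt nv nl hk
      rw [← e2]
      rcases lt_or_ge ((code nt nv nl σ).kd k) 2 with h | h
      · have h1 : _ < (vars σ).ncard := hv.tg_var k hkN h
        omega
      · have h1 : _ < (locks σ).ncard := hv.tg_lock k hkN h
        omega
    | _ + 3 => exact Nat.zero_le _

theorem pow_lt_mul_pow {b N k m x : ℕ} (hb : b ^ k < m) (hN : 0 < N) :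
    (b * N * N) ^ k < (x + m) * N ^ (2 * k) := by
  rw [mul_assoc, mul_pow, ← pow_two, ← pow_mul]
  exact Nat.mul_lt_mul_of_pos_right (by omega) (Nat.pow_pos hN)

theorem Coded.exec_mainProg (c : Coded nt nv nl σ) {i W : ℕ} {t : Thr} (hi : i < σ.length)
    (ht : t ∈ threads σ) (hKW : (8 * σ.length * σ.length) ^ 32 < W) :
    ∃ (s : State) (n : ℕ),
      Exec W mainProg (inputState nt nv nl σ i t) s n ∧
      n ≤ (mainCmd.time (fun _ => 1) + 8) * (((threads σ).ncard ^ 2 + (locks σ).ncard) *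
        max (locks σ).ncard 1 * σ.length) ∧
      s.reg 0 = (mainCmd.run (8 * σ.length * σ.length)
        ((inputState nt nv nl σ i t).setReg 6 (8 * σ.length * σ.length))).reg 31 := by
  set N := σ.length with hN
  set T := (threads σ).ncard with hT
  set L := (locks σ).ncard with hL
  set K := 8 * N * N with hKdef
  have hnt : nt t < T := c.thr.mapsTo ht
  have hK : 8 ≤ K := by nlinarith
  have hb := c.inputState_bdd hi ht le_rfl
  rw [← hN, ← hKdef] at hb
  set s0 := inputState nt nv nl σ i t with hs0
  have hset := Exec.set (W := W) s0 6 (lit 8 * reg 0 * reg 0)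
    (Expr.fits_of_leaves hK hb hKW _ rfl (show 3 ≤ 32 by omega))
  have heval : (lit 8 * reg 0 * reg 0 : Expr).eval s0 = K := rfl
  rw [heval] at hset
  set s1 := s0.setReg 6 K with hs1
  have hb1 : s1.Bdd K := hb.setReg 6 le_rfl
  have h6 : s1.reg 6 = K := by simp [hs1]
  have hr : ∀ r < 7, s1.reg r = if r = 6 then K else s0.reg r := fun r _ => State.reg_setReg _ _ _ _
  obtain ⟨n, hn, hn'⟩ := Cmd.exec hK hKW mainCmd s1 mainCmd_wf hb1 h6 s1.reg fun _ _ => rfl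
  obtain ⟨hb2, -⟩ := Cmd.run_bdd hK mainCmd s1 mainCmd_wf hb1 h6
  have hout := Exec.set (W := W) (mainCmd.run K s1) 0 (reg 31)
    (Expr.fits_of_leaves hK hb2 hKW _ rfl (show 1 ≤ 32 by omega))
  refine ⟨_, _, Exec.seq _ _ _ _ _ _ _ hset (Exec.seq _ _ _ _ _ _ _ hn hout), ?_, by simp⟩
  set U := (T ^ 2 + L) * max L 1 * N with hU
  set g : ℕ → ℕ := fun r => max (s1.reg r) 1 with hg
  have g0 : g 0 = N := max_eq_left (show 1 ≤ N by omega)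
  have g1 : g 1 = T := max_eq_left (show 1 ≤ T by omega)
  have g3 : g 3 = max L 1 := rfl
  have hM : 1 ≤ max L 1 := le_max_right _ _
  have hTT : T ≤ T ^ 2 := Nat.le_self_pow (by omega) T
  have hML : max L 1 ≤ T ^ 2 + L := by omega
  have hnest : mainCmd.nest g ≤ U := by
    refine mainCmd_nest_le ?_ ?_ fun r => le_max_right _ _
    · rw [g0, g1, hU, mul_comm N]
      refine Nat.mul_le_mul_right _ ?_
      calc T = T * 1 := (mul_one T).symm
        _ ≤ (T ^ 2 + L) * max L 1 := Nat.mul_le_mul (by omega) hM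
    · rw [g0, g3, hU, mul_comm N]
      exact Nat.mul_le_mul_right _ (Nat.mul_le_mul_right _ hML)
  have hU1 : 1 ≤ U := (mainCmd.one_le_nest fun r => le_max_right _ _).trans hnest
  have htime : mainCmd.time s1.reg ≤ mainCmd.time (fun _ => 1) * U :=
    ((mainCmd.time_mono fun r => le_max_left _ _).trans
      (mainCmd.time_le fun r => le_max_right _ _)).trans (Nat.mul_le_mul_left _ hnest)
  have hcost : (lit 8 * reg 0 * reg 0 : Expr).cost + 1 + (n + ((reg 31).cost + 1)) = n + 8 := by
    change 1 + 1 + 1 + 1 + 1 + 1 + (n + (1 + 1)) = n + 8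
    omega
  rw [hcost, Nat.add_mul]
  omega

end OSR

/-- One fixed program, on a word RAM with words of `O(log N)` bits, decides for every trace `σ`,
access event `e` and thread `t` whether `e` is in an optimistic sync-reversal race with an event of
`t`, in time `O((T² + L) · max(L, 1) · N)`; the answer is left in register `0`. -/
theorem mainTheorem5 :
    ∃ (P : OSR.Prog) (C k : ℕ),
      ∀ (Thr Var Lck : Type) (σ : OSR.Trace Thr Var Lck), OSR.WellFormed σ →
      ∀ (nt : Thr → ℕ) (nv : Var → ℕ) (nl : Lck → ℕ),
        OSR.IsNumbering (OSR.threads σ) nt → OSR.IsNumbering (OSR.vars σ) nv →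
        OSR.IsNumbering (OSR.locks σ) nl →
      ∀ (i : ℕ) (e : OSR.Event Thr Var Lck), σ[i]? = some e → e.IsAccess →
      ∀ t ∈ OSR.threads σ,
        ∃ (s : OSR.State) (c : ℕ),
          OSR.Exec (C * σ.length ^ k) P (OSR.inputState nt nv nl σ i t) s c ∧
          c ≤ C * (((OSR.threads σ).ncard ^ 2 + (OSR.locks σ).ncard) *
            max (OSR.locks σ).ncard 1 * σ.length) ∧
          (((∃ e' : OSR.Event Thr Var Lck, e'.thread = t ∧ OSR.IsOSRRace σ e e') ∧ s.reg 0 = 1) ∨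
            ((¬ ∃ e' : OSR.Event Thr Var Lck, e'.thread = t ∧ OSR.IsOSRRace σ e e') ∧
              s.reg 0 = 0)) := by
  refine ⟨OSR.mainProg, OSR.mainCmd.time (fun _ => 1) + 8 + 8 ^ 33, 2 * 32, fun Thr Var Lck σ hσ nt nv nl h1 h2 h3 i e he _ t ht => ?_⟩
  have c : OSR.Coded nt nv nl σ := ⟨hσ, h1, h2, h3⟩
  have hi := OSR.pos_lt he
  obtain ⟨s, n, hs, hn, hr⟩ := c.exec_mainProg hi ht
    (OSR.pow_lt_mul_pow (x := OSR.mainCmd.time (fun _ => 1) + 8) (m := 8 ^ 33) (by norm_num)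
      (by omega))
  refine ⟨s, n, hs, hn.trans (Nat.mul_le_mul_right _ (Nat.le_add_right _ _)), ?_⟩
  have key := OSR.mainCmd_spec (D := OSR.code nt nv nl σ) (p := i) (t := nt t)
    (K := 8 * σ.length * σ.length)
    (s := (OSR.inputState nt nv nl σ i t).setReg 6 (8 * σ.length * σ.length)) c.valid
    ⟨rfl, rfl, rfl, rfl, rfl, rfl, rfl, rfl, rfl⟩ hi (h1.mapsTo ht)
    (Nat.mul_le_mul_right _ (Nat.mul_le_mul_right _ (by omega)))
    (fun a ha j => by obtain ⟨b, rfl⟩ := Nat.exists_eq_add_of_le' ha; rfl) rfl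
  rw [hr, key, c.exists_race_iff he ht]
  split_ifs with h
  · exact Or.inl ⟨h, rfl⟩
  · exact Or.inr ⟨h, rfl⟩
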